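/- Let $M$ be a connected complex manifold of dimension $m$ with an effective holomorphic action of $\mathbb T^m=(\mathbb R/2\pi\mathbb Z)^m$, and let $(L,h)\to M$ be a positive hermitian holomorphic line bundle, with Kähler form $\omega=R(h)=-\frac i2\partial\bar\partial\log\|e_L\|_h^2$, such that the action lifts to $L$ by holomorphic bundle maps preserving $h$. Assume that the action is Hamiltonian with a proper moment map $\mu_h:M\to\mathbb R^m$ (normalized by $d\mu_{h,k}=2\,\omega(\cdot,\partial/\partial\theta_k)$, so that $\mu_h=(|z_1|^2,\dots,|z_m|^2)$ for $\omega=\frac i2\sum_j dz_j\wedge d\bar z_j$ on $\mathbb C^m$); in particular $M$ may be any polarized noncompact complete toric Kähler manifold. On the dense open orbit $M^o$, where the torus acts freely, let $z=e^{\rho/2+i\theta}$ be equivariant holomorphic logarithmic coordinates, identifying $M^o$ with $\Omega\times i\mathbb T^m$, where $\Omega\subset\mathbb R^m$ is open and convex (for instance $\Omega=\mathbb R^m$), and let $e_L$ be an invariant holomorphic frame of $L$ over $M^o$, with $\|e_L\|_h^2=e^{-\phi(\rho)}$ and $\mu_h=\nabla_\rho\phi(\rho)$. Let $P=\mu_h(M)$,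 and for $x\in\mu_h(M^o)$ let $u_\phi(x)=\langle x,\rho\rangle-\phi(\rho)$, where $\nabla\phi(\rho)=x$, be the symplectic potential. Fix an integer $N\ge 1$ and assume that $\|z^\alpha\|_{h^N}^2=\int_M|z^\alpha|^2e^{-N\phi}\,\frac{\omega^m}{m!}<\infty$ for all $\alpha\in\mathbb Z^m\cap NP$. Let $B_{h^N}(z,w)=\sum_j s_j(z)\otimes\overline{s_j(w)}$ be the Bergman kernel, $(s_j)$ being any orthonormal basis of the Hilbert space $H^0_{L^2}(M,L^N)$ of $L^2$ holomorphic sections of $L^N$ over $M$; the value $B_{h^N}(e^{i\theta}z,z)$ is regarded as a number through the lifted unitary action, which identifies the fibres of $L^N$ at $z$ and at $e^{i\theta}z$. For $f\in C_0^\infty(\mathbb R^m)$ and $x\in\mu_h(M^o)$ define the generalized Szasz function $$S_{h^N}(f)(x)=\frac{1}{B_{h^N}(z,z)}\,\mathcal N_{h^N}f(x),\qquad \mathcal N_{h^N}f(x)=\sum_{\alpha\in\mathbb Z^m\cap NP}f\left(\frac\alpha N\right)\frac{e^{N\left(u_\phi(x)+\langle\frac\alpha N-x,\nabla u_\phi(x)\rangle\right)}}{\|z^\alpha\|_{h^N}^2},\qquad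 z\in M^o,\ \mu_h(z)=x,$$ and let $f(N^{-1}D_\theta)$, $D_\theta=(\frac1i\partial_{\theta_1},\dots,\frac1i\partial_{\theta_m})$, be the operator on functions on $\mathbb T^m$ given by the spectral theorem, $f(N^{-1}D_\theta)e^{i\langle k,\theta\rangle}=f(k/N)e^{i\langle k,\theta\rangle}$ for $k\in\mathbb Z^m$. Then the series defining $B_{h^N}(e^{i\theta}z,z)$ converges absolutely for all $\theta$ and all $z\in M$, and for every $x\in\mu_h(M^o)$ and every $z\in M^o$ with $\mu_h(z)=x$, $$S_{h^N}(f)(x)=\frac{1}{B_{h^N}(z,z)}\,f(N^{-1}D_\theta)B_{h^N}(e^{i\theta}z,z)\Big|_{\theta=0}.$$ The formula extends to all of $M$ when $\mathcal N_{h^N}f$ is extended by continuity: for every $q\in M$, $$\lim_{M^o\ni z\to q}\frac{1}{B_{h^N}(q,q)}\,\mathcal N_{h^N}f(\mu_h(z))=\frac{1}{B_{h^N}(q,q)}\,f(N^{-1}D_\theta)B_{h^N}(e^{i\theta}q,q)\Big|_{\theta=0}$$ (with the convention $1/0=0$). -/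

import Mathlib

open Bundle Set Filter Topology MeasureTheory
open scoped Manifold ContDiff TensorProduct ComplexConjugate

noncomputable section

namespace ToricSzasz

/-! ## The torus and functions of `D_θ` -/

/-- The model space `ℂ^m`. -/
abbrev Model (m : ℕ) : Type := Fin m → ℂ

/-- The compact torus `𝕋^m`. -/
abbrev Torus (m : ℕ) : Type := Fin m → Circle

/-- The element `e^{iθ}` of the torus. -/
def expTorus {m : ℕ} (θ : Fin m → ℝ) : Torus m := fun j => Circle.exp (θ j)

/-- The character `θ ↦ e^{i⟨k, θ⟩}`. -/
def character {m : ℕ} (k : Fin m → ℤ) (θ : Fin m → ℝ) : ℂ :=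
  Complex.exp (Complex.I * ((∑ j, (k j : ℝ) * θ j : ℝ) : ℂ))

/-- The `k`-th Fourier coefficient of a function of the angles `θ ∈ [0, 2π]^m`. -/
def angleFourierCoeff {m : ℕ} (ψ : (Fin m → ℝ) → ℂ) (k : Fin m → ℤ) : ℂ :=
  (((2 * Real.pi) ^ m : ℝ) : ℂ)⁻¹ *
    ∫ θ in Set.Icc (0 : Fin m → ℝ) (fun _ => 2 * Real.pi), ψ θ * character (-k) θ

/-- The point `α / N` of `ℝ^m`, for a lattice point `α`. -/
def latticePoint {m : ℕ} (N : ℕ) (α : Fin m → ℤ) : Fin m → ℝ := fun j => (α j : ℝ) / (N : ℝ)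

/-- The operator `f(N⁻¹ D_θ)`, `D_θ = (-i ∂/∂θ_1, …, -i ∂/∂θ_m)`, given by the spectral theorem on
the torus: it multiplies the joint eigenfunction `e^{i⟨k, θ⟩}` by `f(k / N)`. -/
def functionOfD {m : ℕ} (f : (Fin m → ℝ) → ℂ) (N : ℕ) (ψ : (Fin m → ℝ) → ℂ)
    (θ : Fin m → ℝ) : ℂ :=
  ∑' k : Fin m → ℤ, f (latticePoint N k) * angleFourierCoeff ψ k * character k θ

/-! ## Complex Hessians -/

/-- The complex Hessian `∑ g_{j k̄} v_j w̄_k` at `y` of a real function `g` on `ℂ^m`, written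
through the real second derivative `D²g` as
`¼ (D²g(v,w) + D²g(iv,iw) + i (D²g(v,iw) - D²g(iv,w)))`. -/
def complexHessian {m : ℕ} (g : Model m → ℝ) (y v w : Model m) : ℂ :=
  let D2 : Model m → Model m → ℝ := fun a b => fderiv ℝ (fun q => fderiv ℝ g q a) y b
  (1 / 4 : ℂ) * (((D2 v w + D2 (Complex.I • v) (Complex.I • w) : ℝ) : ℂ)
    + Complex.I * ((D2 v (Complex.I • w) - D2 (Complex.I • v) w : ℝ) : ℂ))

/-- The matrix `(g_{j k̄})` at `y`. -/
def complexHessianMatrix {m : ℕ} (g : Model m → ℝ) (y : Model m) : Matrix (Fin m) (Fin m) ℂ :=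
  Matrix.of fun j k => complexHessian g y (Pi.single j 1) (Pi.single k 1)

section Bundle

variable {m : ℕ} {M : Type*} [TopologicalSpace M] [ChartedSpace (Model m) M]
  (L : M → Type*) [TopologicalSpace (TotalSpace ℂ L)] [∀ p, AddCommGroup (L p)]
  [∀ p, Module ℂ (L p)] [∀ p, TopologicalSpace (L p)] [FiberBundle ℂ L]

/-! ## Hermitian holomorphic line bundles and their curvature -/

/-- The local holomorphic frame of `L` near `x` given by the preferred trivialization at `x`. -/
def localFrame (x p : M) : L p := (trivializationAt ℂ L x).symm p 1

/-- `e` is a holomorphic frame of `L` over `U`. -/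
structure IsHolomorphicFrame (m : ℕ) [ChartedSpace (Model m) M] (e : ∀ p, L p) (U : Set M) :
    Prop where
  isOpen : IsOpen U
  holomorphic : ContMDiffOn 𝓘(ℂ, Model m) (𝓘(ℂ, Model m).prod 𝓘(ℂ, ℂ)) ω
    (fun p => (⟨p, e p⟩ : TotalSpace ℂ L)) U
  ne_zero : ∀ p ∈ U, e p ≠ 0

/-- A smooth hermitian metric on `L`; `inner p v w` is conjugate linear in `v`. -/
structure HermitianMetric (m : ℕ) [ChartedSpace (Model m) M] where
  inner : ∀ p, L p →ₗ⋆[ℂ] L p →ₗ[ℂ] ℂ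
  conj_symm : ∀ p (v w : L p), conj (inner p w v) = inner p v w
  pos : ∀ p (v : L p), v ≠ 0 → 0 < (inner p v v).re
  smooth : ∀ x, ContMDiffOn 𝓘(ℝ, Model m) 𝓘(ℝ, ℝ) ∞
    (fun p => (inner p (localFrame L x p) (localFrame L x p)).re)
    (trivializationAt ℂ L x).baseSet

variable {L}

namespace HermitianMetric

/-- The squared norm `‖v‖²_h`. -/
def normSq (h : HermitianMetric L m) {p : M} (v : L p) : ℝ := (h.inner p v v).re

/-- The local Kähler potential `-log ‖e_L‖²_h` for the local frame `e_L` near `x`. -/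
def localPotential (h : HermitianMetric L m) (x p : M) : ℝ :=
  -Real.log (h.normSq (localFrame L x p))

/-- The coefficients of the curvature
`ω = R(h) = -(i/2) ∂∂̄ log ‖e_L‖²_h = (i/2) ∑ g_{j k̄} dz_j ∧ dz̄_k`
at `y` in the chart of `M` at `x`, as the hermitian form `∑ g_{j k̄} v_j w̄_k`. -/
def curvature (h : HermitianMetric L m) (x : M) (y v w : Model m) : ℂ :=
  complexHessian (fun q => h.localPotential ((chartAt (Model m) x).symm y)
    ((chartAt (Model m) x).symm q)) y v w

/-- The real two-form `ω = R(h)` at `p`, on tangent vectors written in the chart at `p`. -/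
def kahlerForm (h : HermitianMetric L m) (p : M) (v w : Model m) : ℝ :=
  -(h.curvature p (chartAt (Model m) p p) v w).im

/-- `(L, h)` is positive: `ω = R(h)` is a Kähler form. -/
def IsPositive (h : HermitianMetric L m) : Prop :=
  ∀ (p : M) (v : Model m), v ≠ 0 → 0 < (h.curvature p (chartAt (Model m) p p) v v).re

/-- The measure `ω^m / m! = det (g_{j k̄}) · Lebesgue` on the domain of the chart at `x`. -/
def chartVolume (h : HermitianMetric L m) [MeasurableSpace M] (x : M) : Measure M :=
  Measure.map (chartAt (Model m) x).symm
    ((volume.restrict (chartAt (Model m) x).target).withDensity fun y =>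
      ENNReal.ofReal (complexHessianMatrix (fun q =>
        h.localPotential ((chartAt (Model m) x).symm y)
          ((chartAt (Model m) x).symm q)) y).det.re)

/-- The measure `ω^m / m!` on `M`: the local measures agree on overlaps, so that their supremum is
the measure that restricts to each of them. -/
def kahlerVolume (h : HermitianMetric L m) [MeasurableSpace M] : Measure M :=
  ⨆ x : M, h.chartVolume x

/-! ## Powers of `L`, holomorphic `L²` sections and the Bergman kernel -/

/-- For `e ≠ 0` in a fibre of `L`, the coefficient `c` of `T = c e^{⊗N}` in the fibre of `L^N`. -/
def coeff (h : HermitianMetric L m) {N : ℕ} {p : M} (e : L p) : (⨂[ℂ]^N (L p)) →ₗ[ℂ] ℂ :=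
  PiTensorProduct.lift ((MultilinearMap.mkPiAlgebra ℂ (Fin N) ℂ).compLinearMap
    fun _ => (h.inner p e e)⁻¹ • h.inner p e)

/-- The metric `h^N` on `L^N`: `h^N(c e^{⊗N}, d e^{⊗N}) = c d̄ ‖e‖_h^{2N}`. -/
def innerPow (h : HermitianMetric L m) {N : ℕ} {p : M} (S T : ⨂[ℂ]^N (L p)) : ℂ :=
  h.coeff (localFrame L p p) S * conj (h.coeff (localFrame L p p) T) *
    ((h.normSq (localFrame L p p) ^ N : ℝ) : ℂ)

/-- A global section of `L^N` is holomorphic if its coefficient in every local holomorphic frame of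
`L` is a holomorphic function. -/
def IsHolomorphicSection (h : HermitianMetric L m) {N : ℕ} (s : ∀ p, ⨂[ℂ]^N (L p)) : Prop :=
  ∀ (e : ∀ p, L p) (U : Set M), IsHolomorphicFrame L m e U →
    MDifferentiableOn 𝓘(ℂ, Model m) 𝓘(ℂ, ℂ) (fun p => h.coeff (e p) (s p)) U

/-- The space `H⁰_{L²}(M, L^N)`. -/
def IsL2HolomorphicSection (h : HermitianMetric L m) [MeasurableSpace M] {N : ℕ}
    (s : ∀ p, ⨂[ℂ]^N (L p)) : Prop :=
  h.IsHolomorphicSection s ∧ Integrable (fun p => h.innerPow (s p) (s p)) h.kahlerVolume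

/-- The inner product `∫_M h^N(s, t) ω^m / m!`. -/
def hilb (h : HermitianMetric L m) [MeasurableSpace M] {N : ℕ}
    (s t : ∀ p, ⨂[ℂ]^N (L p)) : ℂ :=
  ∫ p, h.innerPow (s p) (t p) ∂h.kahlerVolume

/-- `(s_j)` is an orthonormal basis of the Hilbert space `H⁰_{L²}(M, L^N)`: an orthonormal system
with trivial orthogonal complement. -/
structure IsOrthonormalBasis (h : HermitianMetric L m) [MeasurableSpace M] {N : ℕ} {ι : Type*}
    (s : ι → ∀ p, ⨂[ℂ]^N (L p)) : Prop where
  mem : ∀ j, h.IsL2HolomorphicSection (s j)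
  norm_one : ∀ j, h.hilb (s j) (s j) = 1
  orthogonal : ∀ j k, j ≠ k → h.hilb (s j) (s k) = 0
  complete : ∀ t : (∀ p, ⨂[ℂ]^N (L p)), h.IsL2HolomorphicSection t →
    (∀ j, h.hilb t (s j) = 0) → t = 0

end HermitianMetric

/-! ## Toric structures -/

/-- A torus action on `M` by biholomorphic maps, smooth and effective. -/
structure IsToricAction (m : ℕ) (M : Type*) [TopologicalSpace M] [ChartedSpace (Model m) M]
    [MulAction (Torus m) M] : Prop where
  smooth : ContMDiff (𝓘(ℝ, Fin m → ℝ).prod 𝓘(ℝ, Model m)) 𝓘(ℝ, Model m) ∞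
    (fun x : (Fin m → ℝ) × M => expTorus x.1 • x.2)
  holomorphic : ∀ t : Torus m, ContMDiff 𝓘(ℂ, Model m) 𝓘(ℂ, Model m) ω (fun p : M => t • p)
  effective : ∀ t : Torus m, (∀ p : M, t • p = p) → t = 1

/-- A lift of the torus action on `M` to an action on `L` by holomorphic bundle maps which
preserves the hermitian metric. -/
structure ToricLift [MulAction (Torus m) M] (h : HermitianMetric L m) where
  act : ∀ (t : Torus m) (p : M), L p →ₗ[ℂ] L (t • p)
  one_act : ∀ (p : M) (v : L p),
    (⟨(1 : Torus m) • p, act 1 p v⟩ : TotalSpace ℂ L) = ⟨p, v⟩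
  mul_act : ∀ (t t' : Torus m) (p : M) (v : L p),
    (⟨(t * t') • p, act (t * t') p v⟩ : TotalSpace ℂ L)
      = ⟨t • t' • p, act t (t' • p) (act t' p v)⟩
  continuous_act : Continuous (fun x : Torus m × TotalSpace ℂ L =>
    (⟨x.1 • x.2.1, act x.1 x.2.1 x.2.2⟩ : TotalSpace ℂ L))
  holomorphic_act : ∀ t : Torus m,
    ContMDiff (𝓘(ℂ, Model m).prod 𝓘(ℂ, ℂ)) (𝓘(ℂ, Model m).prod 𝓘(ℂ, ℂ)) ω
      (fun v : TotalSpace ℂ L => (⟨t • v.1, act t v.1 v.2⟩ : TotalSpace ℂ L))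
  isometry : ∀ (t : Torus m) (p : M) (v w : L p),
    h.inner (t • p) (act t p v) (act t p w) = h.inner p v w

/-- The generator `∂/∂θ_k` of the action at `p`, in the chart at `p`. -/
def generator [MulAction (Torus m) M] (k : Fin m) (p : M) : Model m :=
  deriv (fun t : ℝ => chartAt (Model m) p (expTorus (Pi.single k t) • p)) 0

/-- `μ` is a moment map for `ω = R(h)`, in the normalization `dμ_k = 2 ω(·, ∂/∂θ_k)` for which
`z ↦ (|z_1|², …, |z_m|²)` is the moment map of `(i/2) ∑ dz_j ∧ dz̄_j`. -/
structure IsMomentMap [MulAction (Torus m) M] (h : HermitianMetric L m)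
    (μ : M → Fin m → ℝ) : Prop where
  smooth : ContMDiff 𝓘(ℝ, Model m) 𝓘(ℝ, Fin m → ℝ) ∞ μ
  hamiltonian : ∀ (p : M) (k : Fin m) (v : Model m),
    fderiv ℝ (fun q => μ ((chartAt (Model m) p).symm q) k) (chartAt (Model m) p p) v
      = 2 * h.kahlerForm p v (generator k p)

/-- The open orbit `M°`: the points at which the torus acts freely. -/
def openOrbit (m : ℕ) (M : Type*) [MulAction (Torus m) M] : Set M :=
  {p | ∀ t : Torus m, t • p = p → t = 1}

/-- The gradient of a function on `ℝ^m`. -/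
def grad {m : ℕ} (g : (Fin m → ℝ) → ℝ) (x : Fin m → ℝ) : Fin m → ℝ :=
  fun j => fderiv ℝ g x (Pi.single j 1)

/-- Logarithmic coordinates on the open orbit: a holomorphic equivariant identification
`z = e^{ρ/2 + iθ}` of the dense open set `M°` with `Ω × i𝕋^m`, where the range `Ω` of `ρ` is an open
convex subset of `ℝ^m` (all of `ℝ^m`, or smaller, as for the unit ball), and an invariant
holomorphic frame `e` of `L` over `M°`, with potential `φ` given by `‖e‖²_h = e^{-φ(ρ)}`. The moment
map is `∇_ρ φ`. -/
structure LogCoordinates [MulAction (Torus m) M] (h : HermitianMetric L m) (A : ToricLift h)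
    (μ : M → Fin m → ℝ) where
  /-- the coordinates, used on `M°` -/
  z : M → Model m
  /-- the range of `ρ` -/
  Ω : Set (Fin m → ℝ)
  /-- the invariant frame, used on `M°` -/
  e : ∀ p, L p
  /-- the Kähler potential as a function of `ρ ∈ Ω` -/
  φ : (Fin m → ℝ) → ℝ
  isOpen_orbit : IsOpen (openOrbit m M)
  dense_orbit : Dense (openOrbit m M)
  isOpen_Ω : IsOpen Ω
  convex_Ω : Convex ℝ Ω
  holomorphic_z : ContMDiffOn 𝓘(ℂ, Model m) 𝓘(ℂ, Model m) ω z (openOrbit m M)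
  injOn_z : Set.InjOn z (openOrbit m M)
  image_z : z '' openOrbit m M =
    {w | (∀ j, w j ≠ 0) ∧ (fun j => Real.log (‖w j‖ ^ 2)) ∈ Ω}
  equivariant_z : ∀ (t : Torus m), ∀ p ∈ openOrbit m M, ∀ j, z (t • p) j = (t j : ℂ) * z p j
  frame_e : IsHolomorphicFrame L m e (openOrbit m M)
  invariant_e : ∀ (t : Torus m), ∀ p ∈ openOrbit m M, A.act t p (e p) = e (t • p)
  normSq_e : ∀ p ∈ openOrbit m M,
    h.normSq (e p) = Real.exp (-φ fun j => Real.log (‖z p j‖ ^ 2))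
  moment_eq : ∀ p ∈ openOrbit m M, μ p = grad φ fun j => Real.log (‖z p j‖ ^ 2)

namespace HermitianMetric

/-- The Bergman kernel `B(z, z) = ∑_j ‖s_j(z)‖²_{h^N}` on the diagonal. -/
def bergmanDiag (h : HermitianMetric L m) {N : ℕ} {ι : Type*}
    (s : ι → ∀ p, ⨂[ℂ]^N (L p)) (p : M) : ℂ :=
  ∑' j, h.innerPow (s j p) (s j p)

/-- The `j`-th term of the Bergman kernel `B(t z, z) = ∑_j s_j(t z) ⊗ conj (s_j(z))`. The fibre of
`L^N` at `z` is identified with the fibre at `t z` by the unitary lifted action of `t`, so that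
the term is the number `h^N(s_j(t z), t · s_j(z))`. In an invariant frame with `s_j = F_j e^{⊗N}` it is
`F_j(t z) conj (F_j(z)) e^{-Nφ}`. -/
def bergmanOrbitTerm [MulAction (Torus m) M] (h : HermitianMetric L m) (A : ToricLift h) {N : ℕ}
    {ι : Type*} (s : ι → ∀ p, ⨂[ℂ]^N (L p)) (t : Torus m) (p : M) (j : ι) : ℂ :=
  h.innerPow (s j (t • p)) (PiTensorProduct.map (fun _ => A.act t p) (s j p))

/-- The Bergman kernel `B(t z, z)`. -/
def bergmanOrbit [MulAction (Torus m) M] (h : HermitianMetric L m) (A : ToricLift h) {N : ℕ}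
    {ι : Type*} (s : ι → ∀ p, ⨂[ℂ]^N (L p)) (t : Torus m) (p : M) : ℂ :=
  ∑' j, h.bergmanOrbitTerm A s t p j

end HermitianMetric

namespace LogCoordinates

variable [MulAction (Torus m) M] {h : HermitianMetric L m} {A : ToricLift h} {μ : M → Fin m → ℝ}

/-- The coordinate `ρ = (log |z_1|², …, log |z_m|²)`. -/
def rho (C : LogCoordinates h A μ) (p : M) : Fin m → ℝ := fun j => Real.log (‖C.z p j‖ ^ 2)

/-- The symplectic potential, the Legendre dual of `φ`: `u(x) = ⟨x, ρ⟩ - φ(ρ)`, where `ρ ∈ Ω` is the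
point with `∇φ(ρ) = x`. -/
def symplecticPotential (C : LogCoordinates h A μ) (x : Fin m → ℝ) : ℝ :=
  (∑ j, x j * Function.invFunOn (grad C.φ) C.Ω x j) -
    C.φ (Function.invFunOn (grad C.φ) C.Ω x)

/-- The pointwise norm `|z^α|² e^{-Nφ}` of the section `z^α e^{⊗N}` on the open orbit. -/
def monomialDensity (C : LogCoordinates h A μ) (N : ℕ) (α : Fin m → ℤ) (p : M) : ℝ :=
  (∏ j, (‖C.z p j‖ ^ 2) ^ α j) * Real.exp (-(N * C.φ (C.rho p)))

/-- `‖z^α‖²_{h^N} = ∫ |z^α|² e^{-Nφ} ω^m / m!`, finite. -/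
def MonomialL2 (C : LogCoordinates h A μ) [MeasurableSpace M] (N : ℕ) (α : Fin m → ℤ) : Prop :=
  IntegrableOn (C.monomialDensity N α) (openOrbit m M) h.kahlerVolume

/-- The squared norm `‖z^α‖²_{h^N} = ∫ |z^α|² e^{-Nφ} ω^m / m!`. -/
def monomialNormSq (C : LogCoordinates h A μ) [MeasurableSpace M] (N : ℕ) (α : Fin m → ℤ) : ℝ :=
  ∫ p in openOrbit m M, C.monomialDensity N α p ∂h.kahlerVolume

/-- The sum `∑_{α ∈ ℤ^m ∩ NP} f(α/N) e^{N(u(x) + ⟨α/N - x, ∇u(x)⟩)} / ‖z^α‖²_{h^N}`, where `P` is the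
image of the moment map. -/
def szaszSum (C : LogCoordinates h A μ) [MeasurableSpace M] (N : ℕ) (f : (Fin m → ℝ) → ℂ)
    (x : Fin m → ℝ) : ℂ :=
  ∑' α : {α : Fin m → ℤ // latticePoint N α ∈ Set.range μ},
    f (latticePoint N α.1) *
      ((Real.exp (N * (C.symplecticPotential x +
        ∑ j, (latticePoint N α.1 j - x j) * grad C.symplecticPotential x j)) /
          C.monomialNormSq N α.1 : ℝ) : ℂ)

/-- The generalized Szasz function `S_{h^N}(f)(x) = B(z, z)⁻¹ · szaszSum f x`, `z ∈ μ⁻¹(x)`, for `x` in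
the image of the open orbit under the moment map. -/
def szasz (C : LogCoordinates h A μ) [MeasurableSpace M] [Nonempty M] {N : ℕ} {ι : Type*}
    (s : ι → ∀ p, ⨂[ℂ]^N (L p)) (f : (Fin m → ℝ) → ℂ) (x : Fin m → ℝ) : ℂ :=
  (h.bergmanDiag s (Function.invFunOn μ (openOrbit m M) x))⁻¹ * C.szaszSum N f x

end LogCoordinates

end Bundle

end ToricSzasz

end

set_option linter.unusedSectionVars false

noncomputable section

namespace ToricSzasz

/-! ## Holomorphic functions of several variables -/

section SeveralVariables

variable {E : Type*} [NormedAddCommGroup E] [NormedSpace ℂ E]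

/-! The monomials `z^α e^{⊗N}` with `α/N ∈ P`, divided by their norms, form an orthonormal basis of
the `L²` holomorphic sections. In this basis `B(e^{iθ}z, z)` is the absolutely convergent Fourier
series `∑ e^{i⟨α,θ⟩} |z^α|² e^{-Nφ} / ‖z^α‖²`, and applying `f(N⁻¹D_θ)` at `θ = 0` inserts the
factor `f(α/N)`. Legendre duality, `∇u(x) = ρ` for `x = ∇φ(ρ)`, rewrites `|z^α|² e^{-Nφ}` as the
exponential in the Szasz sum. At an arbitrary point of `M` the sum is finite, because `f` has
compact support, and its terms are continuous.

The work lies in the orthonormal basis (`isOrthonormalBasis_monomials`), since `M` is not compact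
and nothing is assumed about the complement of `M°`. In a chart this complement is the zero set of a
holomorphic function, the determinant of the generators of the action (`generatorDet_ne_zero_iff`).
Hence it is null for the Kähler volume, and locally bounded holomorphic sections over `M°` extend
across it (`exists_section_extension`).

If `α/N = μ(q)`, then `|z^α|² e^{-Nφ} = exp(N(⟨α/N,ρ⟩ - φ(ρ)))` is bounded on `M°`. For `q ∈ M°`
this is convexity of `φ`. For other `q` one approximates `μ(q)` by rational values `β/n` of `μ` on
`M°` and applies the mean value property to `z^β` on discs with boundary circles in a compact part
of `M°`; after an `n`-th root the bound does not depend on `n` (`exists_legendre_le`).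

Conversely, let `z^k` occur as a Fourier coefficient, along the orbits, of some holomorphic section.
Then `z^k e^{⊗N}` is locally bounded and extends to a section `S`. Since `μ` is proper, `‖S‖²` has a
maximum on the preimage of a ball about `k/N`. At a maximum with `μ(p) ≠ k/N`, moving along `-iX_a`
with `a = k/N - μ(p)` increases `‖S‖²` and brings `μ` closer to `k/N`, a contradiction; so `k/N ∈ P`
(`mem_range_of_monomial`).

Orthogonality and completeness follow from averaging over the torus (`hilb_monomial`), which uses
invariance of the volume (`map_kahlerVolume`). The kernel is independent of the basis because point
evaluations are bounded (`exists_coeff_bound`) and the sections form a closed subspace of `L²`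
(`isClosed_range_toL2`), so that Riesz representation and Parseval apply
(`exists_hasSum_functional`). -/

lemma deriv_line_eq_fderiv {f : E → ℂ} {x : E} (hf : DifferentiableAt ℂ f x) (v : E) :
    HasDerivAt (fun w : ℂ => f (x + w • v)) (fderiv ℂ f x v) 0 := by
  have h1 : HasDerivAt (fun w : ℂ => x + w • v) v 0 := by
    simpa using ((hasDerivAt_id (0 : ℂ)).smul_const v).const_add x
  have h2 : HasFDerivAt f (fderiv ℂ f x) (x + (0 : ℂ) • v) := by simpa using hf.hasFDerivAt
  exact h2.comp_hasDerivAt (0 : ℂ) h1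

/-- The derivative of a holomorphic function is jointly continuous in the point and in parameters
on which the function depends continuously. -/
theorem continuousOn_fderiv_param [FiniteDimensional ℂ E] {P : Type*} [TopologicalSpace P]
    {K : Set P} {U : Set E} (hU : IsOpen U) {F : P → E → ℂ}
    (hF : ContinuousOn (fun q : P × E => F q.1 q.2) (K ×ˢ U))
    (hd : ∀ θ ∈ K, DifferentiableOn ℂ (F θ) U) :
    ContinuousOn (fun q : P × E => fderiv ℂ (F q.1) q.2) (K ×ˢ U) := by
  rw [continuousOn_clm_apply]
  rintro v ⟨θ₀, x₀⟩ ⟨hθ₀, hx₀⟩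
  simp only at hθ₀ hx₀
  obtain ⟨ε, hε, hball⟩ := Metric.isOpen_iff.1 hU x₀ hx₀
  -- For `|w| < r` the displacement `w • v` has norm at most `ε / 2`; the `+ 1` keeps `r` positive
  -- when `v = 0`.
  set r : ℝ := ε / (2 * (‖v‖ + 1)) with hr
  have hv : 0 < ‖v‖ + 1 := by positivity
  have hr0 : 0 < r := by positivity
  have hmem : ∀ x ∈ Metric.ball x₀ (ε / 2), ∀ w ∈ Metric.ball (0 : ℂ) r, x + w • v ∈ U := by
    intro x hx w hw
    apply hball
    rw [Metric.mem_ball] at hx ⊢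
    rw [mem_ball_zero_iff] at hw
    have h1 : ‖w • v‖ ≤ ε / 2 := by
      rw [norm_smul]
      calc ‖w‖ * ‖v‖ ≤ r * (‖v‖ + 1) := by gcongr; linarith
        _ = ε / 2 := by rw [hr]; field_simp
    calc dist (x + w • v) x₀ ≤ dist (x + w • v) x + dist x x₀ := dist_triangle _ _ _
      _ < ε := by simp only [dist_self_add_left]; linarith
  set l : Filter (P × E) := 𝓝[K ×ˢ U] (θ₀, x₀)
  have hev : ∀ᶠ q : P × E in l, q.1 ∈ K ∧ q.2 ∈ Metric.ball x₀ (ε / 2) := by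
    have h1 : ∀ᶠ q : P × E in l, q ∈ K ×ˢ U := self_mem_nhdsWithin
    have h2 : ∀ᶠ q : P × E in l, q.2 ∈ Metric.ball x₀ (ε / 2) :=
      nhdsWithin_le_nhds (continuous_snd.continuousAt.preimage_mem_nhds
        (Metric.ball_mem_nhds _ (by positivity)))
    filter_upwards [h1, h2] with q hq hq' using ⟨hq.1, hq'⟩
  -- Joint continuity makes the restrictions to the complex line through `q.2` in direction `v`
  -- converge locally uniformly, and in one variable locally uniform limits commute with
  -- derivatives.
  have hT : TendstoLocallyUniformlyOn (fun (q : P × E) (w : ℂ) => F q.1 (q.2 + w • v))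
      (fun w => F θ₀ (x₀ + w • v)) l (Metric.ball 0 r) := by
    rw [Metric.tendstoLocallyUniformlyOn_iff]
    intro η hη w₀ hw₀
    have hcont : Tendsto (fun a : (P × E) × ℂ => F a.1.1 (a.1.2 + a.2 • v))
        (l ×ˢ 𝓝 w₀) (𝓝 (F θ₀ (x₀ + w₀ • v))) := by
      have hx : x₀ + w₀ • v ∈ U := hmem _ (Metric.mem_ball_self (by positivity)) _ hw₀
      have h1 := hF (θ₀, x₀ + w₀ • v) ⟨hθ₀, hx⟩
      refine Tendsto.comp (g := fun q : P × E => F q.1 q.2) h1 (f := fun a : (P × E) × ℂ =>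
        ((a.1.1, a.1.2 + a.2 • v) : P × E)) ?_
      refine tendsto_nhdsWithin_iff.2 ⟨?_, ?_⟩
      · have : Continuous (fun a : (P × E) × ℂ => ((a.1.1, a.1.2 + a.2 • v) : P × E)) := by
          fun_prop
        have h2 := this.tendsto ((θ₀, x₀), w₀)
        refine h2.mono_left ?_
        rw [nhds_prod_eq]
        exact Filter.prod_mono nhdsWithin_le_nhds le_rfl
      · have h3 : ∀ᶠ a : (P × E) × ℂ in l ×ˢ 𝓝 w₀, a.2 ∈ Metric.ball (0 : ℂ) r :=
          tendsto_snd (Metric.isOpen_ball.mem_nhds hw₀)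
        filter_upwards [tendsto_fst.eventually hev, h3] with a ha ha'
        exact ⟨ha.1, hmem _ ha.2 _ ha'⟩
    have h4 := hcont (Metric.ball_mem_nhds _ (half_pos hη))
    rw [mem_map, mem_prod_iff] at h4
    obtain ⟨A, hA, B, hB, hAB⟩ := h4
    refine ⟨B, nhdsWithin_le_nhds hB, ?_⟩
    filter_upwards [hA] with q hq y hy
    have h5 : dist (F q.1 (q.2 + y • v)) (F θ₀ (x₀ + w₀ • v)) < η / 2 :=
      hAB (show (q, y) ∈ A ×ˢ B from ⟨hq, hy⟩)
    have hself : (θ₀, x₀) ∈ A := mem_of_mem_nhdsWithin (s := K ×ˢ U) ⟨hθ₀, hx₀⟩ hA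
    have h6 : dist (F θ₀ (x₀ + y • v)) (F θ₀ (x₀ + w₀ • v)) < η / 2 :=
      hAB (show ((θ₀, x₀), y) ∈ A ×ˢ B from ⟨hself, hy⟩)
    calc _ ≤ _ := dist_triangle_right _ _ (F θ₀ (x₀ + w₀ • v))
      _ < η := by linarith
  have hD := (hT.deriv (by
    filter_upwards [hev] with q hq
    intro w hw
    have h7 := (hd q.1 hq.1).differentiableAt (hU.mem_nhds (hmem _ hq.2 _ hw))
    have : DifferentiableAt ℂ (fun w : ℂ => q.2 + w • v) w := by fun_prop
    exact (DifferentiableAt.comp w h7 this).differentiableWithinAt)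
    Metric.isOpen_ball).tendsto_at (Metric.mem_ball_self hr0)
  have e0 := (deriv_line_eq_fderiv ((hd θ₀ hθ₀).differentiableAt (hU.mem_nhds hx₀)) v).deriv
  rw [e0] at hD
  refine hD.congr' ?_
  filter_upwards [self_mem_nhdsWithin] with q hq
  exact (deriv_line_eq_fderiv ((hd q.1 hq.1).differentiableAt (hU.mem_nhds hq.2)) v).deriv

theorem continuousOn_fderiv_of_differentiableOn [FiniteDimensional ℂ E] {U : Set E}
    (hU : IsOpen U) {f : E → ℂ} (hf : DifferentiableOn ℂ f U) : ContinuousOn (fderiv ℂ f) U := by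
  have h := continuousOn_fderiv_param (P := Unit) (K := univ) hU (F := fun _ => f)
    (hf.continuousOn.comp continuous_snd.continuousOn fun q hq => hq.2) (fun _ _ => hf)
  exact h.comp (f := fun x => ((), x)) (by fun_prop) fun x hx => ⟨trivial, hx⟩

/-- The dominating function is a constant: by `continuousOn_fderiv_param` the derivative is bounded
on the compact product of `K` with a closed ball. -/
theorem differentiableOn_integral_param [FiniteDimensional ℂ E] {P : Type*} [TopologicalSpace P]
    [MeasurableSpace P] [OpensMeasurableSpace P] [SecondCountableTopology P] {ν : Measure P}
    [IsFiniteMeasureOnCompacts ν] {K : Set P} (hK : IsCompact K) (hKm : MeasurableSet K)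
    {U : Set E} (hU : IsOpen U) {F : P → E → ℂ}
    (hF : ContinuousOn (fun q : P × E => F q.1 q.2) (K ×ˢ U))
    (hd : ∀ θ ∈ K, DifferentiableOn ℂ (F θ) U) :
    DifferentiableOn ℂ (fun x => ∫ θ in K, F θ x ∂ν) U := by
  intro x₀ hx₀
  have : ProperSpace E := FiniteDimensional.proper ℂ E
  obtain ⟨ε, hε, hball⟩ := Metric.nhds_basis_closedBall.mem_iff.1 (hU.mem_nhds hx₀)
  have hsub : K ×ˢ Metric.closedBall x₀ ε ⊆ K ×ˢ U := prod_mono subset_rfl hball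
  have hcF := continuousOn_fderiv_param hU hF hd
  obtain ⟨C, hC⟩ := (hK.prod (isCompact_closedBall x₀ ε)).exists_bound_of_continuousOn
    (hcF.mono hsub)
  have hslice : ∀ x ∈ U, ContinuousOn (fun θ => F θ x) K := fun x hx =>
    hF.comp (f := fun θ => (θ, x)) (by fun_prop) fun θ hθ => ⟨hθ, hx⟩
  refine (hasFDerivAt_integral_of_dominated_of_fderiv_le (𝕜 := ℂ)
    (F' := fun x θ => fderiv ℂ (F θ) x)
    (s := Metric.closedBall x₀ ε) (bound := fun _ => C) (Metric.closedBall_mem_nhds _ hε) ?_ ?_ ?_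
    ?_ ?_ ?_).differentiableAt.differentiableWithinAt
  · filter_upwards [hU.mem_nhds hx₀] with x hx
    exact (hslice x hx).aestronglyMeasurable hKm
  · have : IsFiniteMeasure (ν.restrict K) := ⟨by simpa using hK.measure_lt_top⟩
    obtain ⟨C', hC'⟩ := hK.exists_bound_of_continuousOn (hslice x₀ hx₀)
    exact Integrable.of_bound ((hslice x₀ hx₀).aestronglyMeasurable hKm) C'
      (by filter_upwards [ae_restrict_mem hKm] with θ hθ using hC' θ hθ)
  · exact (hcF.comp (f := fun θ => (θ, x₀)) (by fun_prop)
      fun θ hθ => ⟨hθ, hx₀⟩).aestronglyMeasurable hKm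
  · filter_upwards [ae_restrict_mem hKm] with θ hθ x hx using hC (θ, x) ⟨hθ, hx⟩
  · have : IsFiniteMeasure (ν.restrict K) := ⟨by simpa using hK.measure_lt_top⟩
    exact integrable_const _
  · filter_upwards [ae_restrict_mem hKm] with θ hθ x hx
    exact ((hd θ hθ).differentiableAt (hU.mem_nhds (hball hx))).hasFDerivAt

/-- Weierstrass' theorem in several variables. Cauchy's estimate turns a uniformly Cauchy sequence
on `U` into uniformly Cauchy derivatives on a smaller ball. -/
theorem differentiableOn_of_tendstoUniformlyOn {U : Set E} (hU : IsOpen U) {f : ℕ → E → ℂ}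
    {g : E → ℂ} (hf : ∀ n, DifferentiableOn ℂ (f n) U) (h : TendstoUniformlyOn f g atTop U) :
    DifferentiableOn ℂ g U := by
  intro x₀ hx₀
  obtain ⟨ε, hε, hball⟩ := Metric.isOpen_iff.1 hU x₀ hx₀
  have hin : ∀ x ∈ Metric.ball x₀ (ε / 2), Metric.ball x (ε / 2) ⊆ U := fun x hx y hy => by
    apply hball
    have := dist_triangle y x x₀
    rw [Metric.mem_ball] at *
    linarith
  have hx0 : x₀ ∈ Metric.ball x₀ (ε / 2) := Metric.mem_ball_self (by positivity)
  have hcau : UniformCauchySeqOn (fun n => fderiv ℂ (f n)) atTop (Metric.ball x₀ (ε / 2)) := by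
    rw [Metric.uniformCauchySeqOn_iff]
    intro η hη
    obtain ⟨n₀, hn₀⟩ := Metric.uniformCauchySeqOn_iff.1 h.uniformCauchySeqOn (η * ε / 16)
      (by positivity)
    refine ⟨n₀, fun a ha b hb x hx => ?_⟩
    have hxU : x ∈ U := hin x hx (Metric.mem_ball_self (by positivity))
    have hda := (hf a).differentiableAt (hU.mem_nhds hxU)
    have hdb := (hf b).differentiableAt (hU.mem_nhds hxU)
    -- `R₂` is twice the Cauchy tolerance `η ε / 16`, because the value at the centre is subtracted;
    -- the resulting bound `η / 4` on the derivative is below `η`.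
    have h1 := Complex.norm_fderiv_le_div_of_mapsTo_ball (f := fun y => f a y - f b y) (c := x)
      (R₁ := ε / 2) (R₂ := η * ε / 8) (((hf a).sub (hf b)).mono (hin x hx)) (by
        intro y hy
        have h1 := hn₀ a ha b hb y (hin x hx hy)
        have h2 := hn₀ a ha b hb x hxU
        rw [dist_eq_norm] at h1 h2
        rw [mem_closedBall_iff_norm]
        calc _ ≤ _ := norm_sub_le _ _
          _ ≤ η * ε / 8 := by linarith) (by positivity)
    rw [dist_eq_norm, ← fderiv_fun_sub hda hdb]
    refine h1.trans_lt ?_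
    rw [div_lt_iff₀ (by positivity)]
    nlinarith [mul_pos hη hε]
  have hlim : ∀ x ∈ Metric.ball x₀ (ε / 2), ∃ L, Tendsto (fun n => fderiv ℂ (f n) x) atTop (𝓝 L) :=
    fun x hx => cauchySeq_tendsto_of_complete (hcau.cauchySeq hx)
  choose! g' hg' using hlim
  have hu : TendstoUniformlyOn (fun n => fderiv ℂ (f n)) g' atTop (Metric.ball x₀ (ε / 2)) :=
    hcau.tendstoUniformlyOn_of_tendsto hg'
  exact (hasFDerivAt_of_tendstoUniformlyOn Metric.isOpen_ball hu (fun n x hx =>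
    ((hf n).differentiableAt (hU.mem_nhds (hin x hx
      (Metric.mem_ball_self (by positivity))))).hasFDerivAt)
    (fun x hx => h.tendsto_at (hin x hx (Metric.mem_ball_self (by positivity)))) hx0
    ).differentiableAt.differentiableWithinAt

end SeveralVariables

/-! ## Mean values across thin sets -/

/-- The mean value property for a bounded function which is holomorphic off the zeros of a
holomorphic function. -/
theorem circleAverage_of_bounded_off_zeros {O : Set ℂ} (hO : IsOpen O) (hOc : IsPreconnected O)
    {r : ℝ} (hr : 0 < r) (hrO : Metric.closedBall (0 : ℂ) r ⊆ O) {D f : ℂ → ℂ}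
    (hD : DifferentiableOn ℂ D O) (h0 : D 0 ≠ 0) (hs : ∀ w ∈ Metric.sphere (0 : ℂ) r, D w ≠ 0)
    (hf : ∀ w ∈ O, D w ≠ 0 → DifferentiableAt ℂ f w) {C : ℝ}
    (hC : ∀ w ∈ O, D w ≠ 0 → ‖f w‖ ≤ C) :
    Real.circleAverage f 0 r = f 0 := by
  classical
  have hDa := hD.analyticOnNhd hO
  have h0O : (0 : ℂ) ∈ O := hrO (Metric.mem_closedBall_self hr.le)
  -- Since `D 0 ≠ 0` and `O` is connected, the identity theorem makes all zeros of `D` isolated.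
  have hpun : ∀ w ∈ O, ∀ᶠ y in 𝓝[≠] w, D y ≠ 0 := by
    intro w hw
    rcases (hDa w hw).eventually_eq_zero_or_eventually_ne_zero with h | h
    · exact absurd (hDa.eqOn_zero_of_preconnected_of_eventuallyEq_zero hOc hw h h0O) h0
    · exact h
  -- `g` fills in the removable singularities of `f`. It agrees with `f` at the centre and on the
  -- circle, where `D` does not vanish.
  set g : ℂ → ℂ := fun w => if D w = 0 then limUnder (𝓝[≠] w) f else f w with hg
  have hgd : ∀ w ∈ O, DifferentiableAt ℂ g w := by
    intro w hw
    have hp := hpun w hw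
    rw [eventually_nhdsWithin_iff] at hp
    obtain ⟨ε, hε, hball⟩ := Metric.mem_nhds_iff.1 (Filter.inter_mem hp (hO.mem_nhds hw))
    have hpt : ∀ y ∈ Metric.ball w ε \ {w}, y ∈ O ∧ D y ≠ 0 := fun y hy =>
      ⟨(hball hy.1).2, (hball hy.1).1 hy.2⟩
    by_cases hDw : D w = 0
    · have := Complex.differentiableOn_update_limUnder_of_bddAbove (f := f)
        (Metric.ball_mem_nhds w hε)
        (fun y hy => (hf y (hpt y hy).1 (hpt y hy).2).differentiableWithinAt)
        ⟨C, by rintro _ ⟨y, hy, rfl⟩; exact hC y (hpt y hy).1 (hpt y hy).2⟩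
      refine (this.differentiableAt (Metric.ball_mem_nhds w hε)).congr_of_eventuallyEq ?_
      filter_upwards [Metric.ball_mem_nhds w hε] with y hy
      by_cases hyw : y = w
      · subst hyw; simp [hg, hDw]
      · simp [hg, (hpt y ⟨hy, hyw⟩).2, Function.update_of_ne hyw]
    · refine (hf w hw hDw).congr_of_eventuallyEq ?_
      filter_upwards [(hD.differentiableAt (hO.mem_nhds hw)).continuousAt.eventually_ne hDw]
        with y hy
      simp [hg, hy]
  have hr' : |r| = r := abs_of_pos hr
  have hmean : Real.circleAverage g 0 r = g 0 := by
    apply DiffContOnCl.circleAverage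
    rw [hr']
    refine DifferentiableOn.diffContOnCl fun w hw => (hgd w (hrO ?_)).differentiableWithinAt
    rwa [closure_ball _ hr.ne'] at hw
  have hg0 : g 0 = f 0 := by simp [hg, h0]
  rw [← hg0, ← hmean]
  refine Real.circleAverage_congr_sphere fun w hw => ?_
  rw [hr'] at hw
  simp [hg, hs w hw]

/-! ## The sub-mean value inequality on polydiscs -/

lemma measurePreserving_smul_of_norm_eq_one {m : ℕ} {c : ℂ} (hc : ‖c‖ = 1) :
    MeasurePreserving (fun u : Model m => c • u) volume volume := by
  have h1 : MeasurePreserving (fun z : ℂ => c * z) volume volume := by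
    have h2 := (rotation (⟨c, mem_sphere_zero_iff_norm.2 hc⟩ : Circle)).measurePreserving
    simpa [rotation_apply] using! h2
  exact volume_preserving_pi (fun _ : Fin m => h1)

/-- For each `u` in the ball at the origin, the mean value property of `c ↦ f(w + c u)²` on the unit
circle bounds `|f(w)|²`. Integrating over `u` and exchanging integrals gives the claim, because
multiplication by a unit scalar preserves the polydisc and Lebesgue measure; no polar coordinates
are needed. -/
theorem enorm_sq_mul_volume_ball_le {m : ℕ} {f : Model m → ℂ} {w : Model m} {r R : ℝ}
    (hrR : r < R) (hf : DifferentiableOn ℂ f (Metric.ball w R)) :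
    ‖f w‖ₑ ^ 2 * volume (Metric.ball (0 : Model m) r) ≤
      ∫⁻ u in Metric.ball w r, ‖f u‖ₑ ^ 2 := by
  set B := Metric.ball (0 : Model m) r with hB
  set I := Set.Ioc (0 : ℝ) (2 * Real.pi) with hI
  have hmaps : ∀ (c : ℂ), ‖c‖ ≤ 1 → ∀ u ∈ B, w + c • u ∈ Metric.ball w R := by
    intro c hc u hu
    rw [mem_ball_zero_iff] at hu
    rw [mem_ball_iff_norm, add_sub_cancel_left, norm_smul]
    calc ‖c‖ * ‖u‖ ≤ 1 * ‖u‖ := by gcongr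
      _ < R := by linarith
  have hmean : ∀ u ∈ B, ‖f w‖ₑ ^ 2 * volume I ≤
      ∫⁻ θ in I, ‖f (w + circleMap 0 1 θ • u)‖ₑ ^ 2 := by
    intro u hu
    have hd : ∀ c ∈ Metric.closedBall (0 : ℂ) 1,
        DifferentiableAt ℂ (fun c : ℂ => f (w + c • u) ^ 2) c := by
      intro c hc
      have h1 := hf.differentiableAt (Metric.isOpen_ball.mem_nhds
        (hmaps c (by simpa using hc) u hu))
      have h2 : DifferentiableAt ℂ (fun c : ℂ => w + c • u) c := by fun_prop
      exact (h1.comp c h2).pow 2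
    have hm : Real.circleAverage (fun c : ℂ => f (w + c • u) ^ 2) 0 1 = f w ^ 2 := by
      have := DiffContOnCl.circleAverage (f := fun c : ℂ => f (w + c • u) ^ 2) (c := 0) (R := 1)
        (by
          rw [abs_one]
          refine DifferentiableOn.diffContOnCl fun c hc => (hd c ?_).differentiableWithinAt
          rwa [closure_ball _ one_ne_zero] at hc)
      simpa using this
    rw [Real.circleAverage_def, intervalIntegral.integral_of_le (by positivity)] at hm
    have h3 : ‖f w ^ 2‖ₑ ≤ ENNReal.ofReal (2 * Real.pi)⁻¹ *
        ∫⁻ θ in I, ‖f (w + circleMap 0 1 θ • u) ^ 2‖ₑ := by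
      rw [← hm, enorm_smul]
      refine mul_le_mul' ?_ (enorm_integral_le_lintegral_enorm _)
      rw [Real.enorm_of_nonneg (by positivity)]
    have hvol : volume I = ENNReal.ofReal (2 * Real.pi) := by simp [hI]
    have h4 : ENNReal.ofReal (2 * Real.pi)⁻¹ * ENNReal.ofReal (2 * Real.pi) = 1 := by
      rw [← ENNReal.ofReal_mul (by positivity), inv_mul_cancel₀ (by positivity),
        ENNReal.ofReal_one]
    simp only [enorm_pow] at h3
    calc ‖f w‖ₑ ^ 2 * volume I ≤ (ENNReal.ofReal (2 * Real.pi)⁻¹ *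
        ∫⁻ θ in I, ‖f (w + circleMap 0 1 θ • u)‖ₑ ^ 2) * ENNReal.ofReal (2 * Real.pi) := by
          rw [hvol]; gcongr
      _ = _ := by rw [mul_right_comm, h4, one_mul]
  have hint : ‖f w‖ₑ ^ 2 * volume I * volume B ≤
      ∫⁻ u in B, ∫⁻ θ in I, ‖f (w + circleMap 0 1 θ • u)‖ₑ ^ 2 := by
    rw [← setLIntegral_const]
    exact setLIntegral_mono' measurableSet_ball hmean
  have hswap : ∫⁻ u in B, ∫⁻ θ in I, ‖f (w + circleMap 0 1 θ • u)‖ₑ ^ 2 =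
      ∫⁻ θ in I, ∫⁻ u in B, ‖f (w + circleMap 0 1 θ • u)‖ₑ ^ 2 := by
    apply lintegral_lintegral_swap
    rw [Measure.prod_restrict]
    refine ContinuousOn.aemeasurable ?_ (measurableSet_ball.prod measurableSet_Ioc)
    have : ContinuousOn (fun q : Model m × ℝ => f (w + circleMap 0 1 q.2 • q.1)) (B ×ˢ I) := by
      refine hf.continuousOn.comp ?_ fun q hq => hmaps _ (by simp [circleMap]) _ hq.1
      have : Continuous (circleMap 0 1) := continuous_circleMap 0 1
      fun_prop
    exact (ENNReal.continuous_pow 2).comp_continuousOn this.enorm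
  have hinv : ∀ θ : ℝ, ∫⁻ u in B, ‖f (w + circleMap 0 1 θ • u)‖ₑ ^ 2 =
      ∫⁻ u in Metric.ball w r, ‖f u‖ₑ ^ 2 := by
    intro θ
    have hc : ‖circleMap 0 1 θ‖ = 1 := by simp [circleMap]
    have hc0 : circleMap 0 1 θ ≠ 0 := fun h => by simp [h] at hc
    have hmp : MeasurePreserving (fun u : Model m => w + circleMap 0 1 θ • u) volume volume :=
      (measurePreserving_add_left volume w).comp (measurePreserving_smul_of_norm_eq_one hc)
    have hemb : MeasurableEmbedding (fun u : Model m => w + circleMap 0 1 θ • u) :=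
      (measurableEmbedding_addLeft w).comp
        (Homeomorph.smulOfNeZero _ hc0).toMeasurableEquiv.measurableEmbedding
    have hpre : (fun u : Model m => w + circleMap 0 1 θ • u) ⁻¹' Metric.ball w r = B := by
      ext u
      simp [hB, norm_smul, hc]
    rw [← hpre]
    exact hmp.setLIntegral_comp_preimage_emb hemb (fun u => ‖f u‖ₑ ^ 2) _
  rw [hswap] at hint
  simp only [hinv, setLIntegral_const] at hint
  have hv0 : volume I ≠ 0 := by simp [hI, Real.pi_pos]
  have hvt : volume I ≠ ⊤ := by rw [hI]; exact measure_Ioc_lt_top.ne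
  rw [mul_right_comm] at hint
  exact (ENNReal.mul_le_mul_iff_left hv0 hvt).1 hint

/-! ## The complex Hessian -/

section Hessian

variable {m : ℕ}

lemma fderiv_fderiv_apply_comm {𝕜 E F : Type*} [NontriviallyNormedField 𝕜]
    [NormedAddCommGroup E] [NormedSpace 𝕜 E] [NormedAddCommGroup F] [NormedSpace 𝕜 F]
    {g : E → F} {y : E} (hg : DifferentiableAt 𝕜 (fderiv 𝕜 g) y) (a b : E) :
    fderiv 𝕜 (fun q => fderiv 𝕜 g q a) y b = fderiv 𝕜 (fderiv 𝕜 g) y b a := by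
  have h := hg.hasFDerivAt.clm_apply (hasFDerivAt_const a y)
  rw [h.fderiv]
  simp

lemma differentiableAt_fderiv_of_contDiffAt {𝕜 E F : Type*} [NontriviallyNormedField 𝕜]
    [NormedAddCommGroup E] [NormedSpace 𝕜 E] [NormedAddCommGroup F] [NormedSpace 𝕜 F]
    {g : E → F} {y : E} (hg : ContDiffAt 𝕜 2 g y) : DifferentiableAt 𝕜 (fderiv 𝕜 g) y :=
  (hg.fderiv_right (m := 1) (by norm_num)).differentiableAt (by norm_num)

/-- The terms beyond the pulled back Hessian contain the complex second derivatives of `Φ` and `κ`,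
which are complex bilinear in `(a, b)`; this is what makes them disappear from `complexHessian`. -/
lemma fderiv_fderiv_comp_add_re {g G : Model m → ℝ} {Φ : Model m → Model m} {κ : Model m → ℂ}
    {y : Model m} (hg : ContDiffAt ℝ 2 g (Φ y)) (hΦ : ContDiffAt ℂ 2 Φ y)
    (hκ : ContDiffAt ℂ 2 κ y) (hG : G =ᶠ[𝓝 y] fun q => g (Φ q) + (κ q).re) (a b : Model m) :
    fderiv ℝ (fun q => fderiv ℝ G q a) y b =
      fderiv ℝ (fun q => fderiv ℝ g q (fderiv ℂ Φ y a)) (Φ y) (fderiv ℂ Φ y b) +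
        (fderiv ℝ g (Φ y) (fderiv ℂ (fderiv ℂ Φ) y b a) +
          (fderiv ℂ (fderiv ℂ κ) y b a).re) := by
  have hΦc : ContinuousAt Φ y := hΦ.continuousAt
  have h1 : (fun q => fderiv ℝ G q a) =ᶠ[𝓝 y]
      fun q => fderiv ℝ g (Φ q) (fderiv ℂ Φ q a) + (fderiv ℂ κ q a).re := by
    have e1 := hΦc.eventually (hg.eventually (by simp))
    have e2 := hΦ.eventually (by simp)
    have e3 := hκ.eventually (by simp)
    filter_upwards [hG.eventuallyEq_nhds, e1, e2, e3] with q hq hgq hΦq hκq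
    have d1 := (hgq.differentiableAt (by norm_num)).hasFDerivAt
    have d2 := (hΦq.differentiableAt (by norm_num)).hasFDerivAt.restrictScalars ℝ
    have d3 := (hκq.differentiableAt (by norm_num)).hasFDerivAt.restrictScalars ℝ
    have d4 := (Complex.reCLM.hasFDerivAt (x := κ q)).comp q d3
    have d5 : HasFDerivAt (fun q => g (Φ q) + (κ q).re) _ q := (d1.comp q d2).add d4
    rw [hq.fderiv_eq, d5.fderiv]
    rfl
  rw [h1.fderiv_eq]
  have dg := (differentiableAt_fderiv_of_contDiffAt hg)
  have dΦ := (differentiableAt_fderiv_of_contDiffAt hΦ)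
  have dκ := (differentiableAt_fderiv_of_contDiffAt hκ)
  have k1 : HasFDerivAt (fun q => fderiv ℝ g (Φ q)) _ y :=
    dg.hasFDerivAt.comp y ((hΦ.differentiableAt (by norm_num)).hasFDerivAt.restrictScalars ℝ)
  have k2 : HasFDerivAt (fun q => fderiv ℂ Φ q a) _ y :=
    ((dΦ.hasFDerivAt.clm_apply (hasFDerivAt_const a y)).restrictScalars ℝ)
  have k3 : HasFDerivAt (fun q => fderiv ℂ κ q a) _ y :=
    ((dκ.hasFDerivAt.clm_apply (hasFDerivAt_const a y)).restrictScalars ℝ)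
  have k4 := (Complex.reCLM.hasFDerivAt (x := fderiv ℂ κ y a)).comp y k3
  have k5 : HasFDerivAt (fun q => fderiv ℝ g (Φ q) (fderiv ℂ Φ q a) + (fderiv ℂ κ q a).re) _ y :=
    (k1.clm_apply k2).add k4
  rw [k5.fderiv, fderiv_fderiv_apply_comm dg]
  simp
  ring

/-- A correction term `Q` built from a complex bilinear form satisfies `Q(iv, iw) = -Q(v, w)` and
`Q(v, iw) = Q(iv, w)`, so it cancels in both brackets. Thus real parts of holomorphic functions
contribute nothing, and the Hessian is a tensor under holomorphic changes of coordinates. -/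
theorem complexHessian_comp_add_re {g G : Model m → ℝ} {Φ : Model m → Model m} {κ : Model m → ℂ}
    {y : Model m} (hg : ContDiffAt ℝ 2 g (Φ y)) (hΦ : ContDiffAt ℂ 2 Φ y)
    (hκ : ContDiffAt ℂ 2 κ y) (hG : G =ᶠ[𝓝 y] fun q => g (Φ q) + (κ q).re) (v w : Model m) :
    complexHessian G y v w = complexHessian g (Φ y) (fderiv ℂ Φ y v) (fderiv ℂ Φ y w) := by
  have key := fderiv_fderiv_comp_add_re hg hΦ hκ hG
  simp only [complexHessian, key, map_smul, FunLike.coe_smul, Pi.smul_apply,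
    smul_smul, Complex.I_mul_I, neg_smul, one_smul, map_neg, smul_eq_mul]
  congr 2
  · congr 1
    simp
    ring
  · congr 2
    ring

variable {g : Model m → ℝ} {y : Model m}

lemma complexHessian_eq (hg : ContDiffAt ℝ 2 g y) (v w : Model m) :
    complexHessian g y v w = (1 / 4 : ℂ) *
      (((fderiv ℝ (fderiv ℝ g) y w v + fderiv ℝ (fderiv ℝ g) y (Complex.I • w) (Complex.I • v) : ℝ)
        : ℂ) + Complex.I * ((fderiv ℝ (fderiv ℝ g) y (Complex.I • w) v -
          fderiv ℝ (fderiv ℝ g) y w (Complex.I • v) : ℝ) : ℂ)) := by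
  simp only [complexHessian, fderiv_fderiv_apply_comm (differentiableAt_fderiv_of_contDiffAt hg)]

lemma complexHessian_conj (hg : ContDiffAt ℝ 2 g y) (v w : Model m) :
    conj (complexHessian g y v w) = complexHessian g y w v := by
  have hs : IsSymmSndFDerivAt ℝ g y := hg.isSymmSndFDerivAt (by simp)
  rw [complexHessian_eq hg, complexHessian_eq hg, hs.eq w v, hs.eq (Complex.I • w) (Complex.I • v),
    hs.eq (Complex.I • w) v, hs.eq w (Complex.I • v)]
  simp only [map_mul, map_add, Complex.conj_ofReal, Complex.conj_I, map_div₀, map_one,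
    Complex.conj_ofNat]
  push_cast
  ring

lemma complexHessian_add_left (hg : ContDiffAt ℝ 2 g y) (v v' w : Model m) :
    complexHessian g y (v + v') w = complexHessian g y v w + complexHessian g y v' w := by
  simp only [complexHessian_eq hg, smul_add, map_add]
  push_cast
  ring

lemma complexHessian_smul_left (hg : ContDiffAt ℝ 2 g y) (c : ℂ) (v w : Model m) :
    complexHessian g y (c • v) w = c * complexHessian g y v w := by
  have hc : c • v = c.re • v + c.im • (Complex.I • v) := by
    ext j
    simp only [Pi.smul_apply, Pi.add_apply, smul_eq_mul, Complex.real_smul]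
    conv_lhs => rw [← Complex.re_add_im c]
    ring
  have hI : complexHessian g y (Complex.I • v) w = Complex.I * complexHessian g y v w := by
    simp only [complexHessian_eq hg, smul_smul, Complex.I_mul_I, neg_smul, one_smul, map_neg]
    push_cast
    linear_combination (-(fderiv ℝ (fderiv ℝ g) y (Complex.I • w) v : ℂ) / 4 +
      (fderiv ℝ (fderiv ℝ g) y w) (Complex.I • v) / 4) * Complex.I_mul_I
  have hr : ∀ (t : ℝ) (u : Model m), complexHessian g y (t • u) w = t * complexHessian g y u w := by
    intro t u
    simp only [complexHessian_eq hg, smul_comm Complex.I t, map_smul, smul_eq_mul]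
    push_cast
    ring
  rw [hc, complexHessian_add_left hg, hr, hr, hI]
  conv_rhs => rw [← Complex.re_add_im c]
  ring

lemma complexHessian_add_right (hg : ContDiffAt ℝ 2 g y) (v w w' : Model m) :
    complexHessian g y v (w + w') = complexHessian g y v w + complexHessian g y v w' := by
  rw [← complexHessian_conj hg, complexHessian_add_left hg, map_add, complexHessian_conj hg,
    complexHessian_conj hg]

lemma complexHessian_smul_right (hg : ContDiffAt ℝ 2 g y) (c : ℂ) (v w : Model m) :
    complexHessian g y v (c • w) = conj c * complexHessian g y v w := by
  rw [← complexHessian_conj hg, complexHessian_smul_left hg, map_mul, complexHessian_conj hg]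

lemma complexHessian_eq_sum (hg : ContDiffAt ℝ 2 g y) (v w : Model m) :
    complexHessian g y v w = ∑ j, ∑ k, v j * complexHessianMatrix g y j k * conj (w k) := by
  let S : Model m →ₗ[ℂ] Model m →ₗ⋆[ℂ] ℂ := LinearMap.mk₂'ₛₗ (RingHom.id ℂ) (starRingEnd ℂ)
    (complexHessian g y) (complexHessian_add_left hg)
    (fun c v w => by simpa using complexHessian_smul_left hg c v w) (complexHessian_add_right hg)
    (fun c v w => by simpa using complexHessian_smul_right hg c v w)
  have hS : ∀ v w, complexHessian g y v w = S v w := fun _ _ => rfl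
  rw [hS]
  conv_lhs => rw [pi_eq_sum_univ' v, pi_eq_sum_univ' w]
  simp only [map_sum, map_smul, LinearMap.sum_apply, LinearMap.smul_apply, LinearMap.map_smulₛₗ,
    smul_eq_mul]
  conv_rhs => rw [Finset.sum_comm]
  refine Finset.sum_congr rfl fun j _ => ?_
  rw [Finset.mul_sum]
  refine Finset.sum_congr rfl fun k _ => ?_
  simp only [← hS, complexHessianMatrix, Matrix.of_apply]
  ring

/-- The matrices are related by `Jᵀ H J̄`. The factor `|det J|²` is also the real Jacobian of `Φ`,
which is why `ω^m / m!` is independent of charts. -/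
theorem det_complexHessianMatrix_comp_add_re {g G : Model m → ℝ} {Φ : Model m → Model m}
    {κ : Model m → ℂ} {y : Model m} (hg : ContDiffAt ℝ 2 g (Φ y)) (hΦ : ContDiffAt ℂ 2 Φ y)
    (hκ : ContDiffAt ℂ 2 κ y) (hG : G =ᶠ[𝓝 y] fun q => g (Φ q) + (κ q).re) :
    (complexHessianMatrix G y).det.re =
      ‖(LinearMap.toMatrix' (fderiv ℂ Φ y : Model m →ₗ[ℂ] Model m)).det‖ ^ 2 *
        (complexHessianMatrix g (Φ y)).det.re := by
  set J := LinearMap.toMatrix' (fderiv ℂ Φ y : Model m →ₗ[ℂ] Model m) with hJ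
  have h : complexHessianMatrix G y =
      J.transpose * complexHessianMatrix g (Φ y) * J.map (starRingEnd ℂ) := by
    ext j k
    simp only [complexHessianMatrix, Matrix.of_apply]
    rw [complexHessian_comp_add_re hg hΦ hκ hG, complexHessian_eq_sum hg]
    simp only [Matrix.mul_apply, Matrix.transpose_apply, Matrix.map_apply, Finset.sum_mul]
    rw [Finset.sum_comm]
    refine Finset.sum_congr rfl fun b _ => Finset.sum_congr rfl fun a _ => ?_
    simp [hJ, LinearMap.toMatrix'_apply, complexHessianMatrix]
  have h2 : (J.map (starRingEnd ℂ)).det = conj J.det := (RingHom.map_det (starRingEnd ℂ) J).symm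
  rw [h, Matrix.det_mul, Matrix.det_mul, Matrix.det_transpose, h2]
  have h3 : J.det * (complexHessianMatrix g (Φ y)).det * conj J.det =
      ((‖J.det‖ ^ 2 : ℝ) : ℂ) * (complexHessianMatrix g (Φ y)).det := by
    rw [← Complex.normSq_eq_norm_sq, Complex.normSq_eq_conj_mul_self]
    ring
  rw [h3, Complex.re_ofReal_mul]

open scoped ComplexOrder in
theorem det_complexHessianMatrix_pos (hg : ContDiffAt ℝ 2 g y)
    (hpos : ∀ v, v ≠ 0 → 0 < (complexHessian g y v v).re) :
    0 < (complexHessianMatrix g y).det.re := by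
  have hH : (complexHessianMatrix g y).IsHermitian := by
    ext j k
    simp only [complexHessianMatrix, Matrix.conjTranspose_apply, Matrix.of_apply]
    exact complexHessian_conj hg _ _
  have hP : (complexHessianMatrix g y).PosDef := by
    refine Matrix.PosDef.of_dotProduct_mulVec_pos hH fun x hx => ?_
    -- The matrix is linear in its row index and conjugate linear in its column index, so its
    -- quadratic form at `x` is the Hessian at the conjugate vector.
    have e : star x ⬝ᵥ (complexHessianMatrix g y).mulVec x = complexHessian g y (star x) (star x) := by
      rw [complexHessian_eq_sum hg]
      simp only [dotProduct, Matrix.mulVec, Finset.mul_sum]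
      refine Finset.sum_congr rfl fun j _ => Finset.sum_congr rfl fun k _ => ?_
      simp
      ring
    rw [e]
    have h0 := hpos (star x) (by simpa using hx)
    have him : (complexHessian g y (star x) (star x)).im = 0 :=
      Complex.conj_eq_iff_im.1 (complexHessian_conj hg _ _)
    rw [Complex.lt_def]
    exact ⟨by simpa using h0, by simp [him]⟩
  have := hP.det_pos
  rw [Complex.lt_def] at this
  simpa using this.1

end Hessian

lemma det_restrictScalars_real {m : ℕ} (A : Model m →L[ℂ] Model m) :
    (A.restrictScalars ℝ).det = ‖(LinearMap.toMatrix' (A : Model m →ₗ[ℂ] Model m)).det‖ ^ 2 := by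
  have h := LinearMap.det_restrictScalars (R := ℝ) (S := ℂ) (A := Model m) (f := (A : Model m →ₗ[ℂ] Model m))
  rw [LinearMap.det_toMatrix']
  rw [ContinuousLinearMap.det]
  refine h.trans ?_
  rw [Algebra.norm_complex_apply, Complex.normSq_eq_norm_sq]

/-! ## Charts -/

section Charts

variable {m : ℕ} {M : Type*} [TopologicalSpace M] [ChartedSpace (Model m) M]

instance isManifold_real [IsManifold 𝓘(ℂ, Model m) ω M] : IsManifold 𝓘(ℝ, Model m) ∞ M := by
  refine isManifold_of_contDiffOn _ _ _ fun e e' he he' => ?_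
  have h := StructureGroupoid.compatible (contDiffGroupoid ω 𝓘(ℂ, Model m)) he he'
  rw [contDiffGroupoid, mem_groupoid_of_pregroupoid] at h
  have h1 : ContDiffOn ℂ ω (e.symm ≫ₕ e') (e.symm ≫ₕ e').source := by
    simpa [contDiffPregroupoid] using h.1
  simpa using (h1.restrict_scalars ℝ).of_le le_top

lemma isOpen_chart_preimage (x : M) {U : Set M} (hU : IsOpen U) :
    IsOpen ((chartAt (Model m) x).target ∩ (chartAt (Model m) x).symm ⁻¹' U) :=
  (chartAt (Model m) x).isOpen_inter_preimage_symm hU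

variable [IsManifold 𝓘(ℂ, Model m) ω M]

lemma contDiffOn_comp_chart_symm {F : Type*} [NormedAddCommGroup F] [NormedSpace ℂ F]
    {f : M → F} {U : Set M} (hf : ContMDiffOn 𝓘(ℂ, Model m) 𝓘(ℂ, F) ω f U) (x : M) :
    ContDiffOn ℂ ω (fun w => f ((chartAt (Model m) x).symm w))
      ((chartAt (Model m) x).target ∩ (chartAt (Model m) x).symm ⁻¹' U) := by
  rw [← contMDiffOn_iff_contDiffOn]
  exact hf.comp' ((contMDiffOn_chart_symm (n := ω) (x := x)).mono subset_rfl)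

lemma contDiffOn_real_comp_chart_symm {F : Type*} [NormedAddCommGroup F] [NormedSpace ℝ F]
    {f : M → F} {U : Set M} (hf : ContMDiffOn 𝓘(ℝ, Model m) 𝓘(ℝ, F) ∞ f U) (x : M) :
    ContDiffOn ℝ ∞ (fun w => f ((chartAt (Model m) x).symm w))
      ((chartAt (Model m) x).target ∩ (chartAt (Model m) x).symm ⁻¹' U) := by
  rw [← contMDiffOn_iff_contDiffOn]
  exact hf.comp' ((contMDiffOn_chart_symm (n := ∞) (x := x)).mono subset_rfl)

lemma differentiableOn_comp_chart_symm {f : M → ℂ} {U : Set M}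
    (hf : MDifferentiableOn 𝓘(ℂ, Model m) 𝓘(ℂ, ℂ) f U) (x : M) :
    DifferentiableOn ℂ (fun w => f ((chartAt (Model m) x).symm w))
      ((chartAt (Model m) x).target ∩ (chartAt (Model m) x).symm ⁻¹' U) := by
  rw [← mdifferentiableOn_iff_differentiableOn]
  have h : MDifferentiableOn 𝓘(ℂ, Model m) 𝓘(ℂ, Model m) (chartAt (Model m) x).symm
      (chartAt (Model m) x).target :=
    (contMDiffOn_chart_symm (n := ω) (x := x)).mdifferentiableOn (by simp)
  exact hf.comp (h.mono inter_subset_left) fun w hw => hw.2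

lemma mdifferentiableAt_of_comp_chart_symm {f : M → ℂ} {x p : M}
    (hp : p ∈ (chartAt (Model m) x).source)
    (hf : DifferentiableAt ℂ (fun w => f ((chartAt (Model m) x).symm w)) (chartAt (Model m) x p)) :
    MDifferentiableAt 𝓘(ℂ, Model m) 𝓘(ℂ, ℂ) f p := by
  have h : MDifferentiableAt 𝓘(ℂ, Model m) 𝓘(ℂ, Model m) (chartAt (Model m) x) p :=
    ((contMDiffOn_chart (n := ω) (x := x)).contMDiffAt
      ((chartAt (Model m) x).open_source.mem_nhds hp)).mdifferentiableAt (by simp)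
  refine ((mdifferentiableAt_iff_differentiableAt.2 hf).comp p h).congr_of_eventuallyEq ?_
  filter_upwards [(chartAt (Model m) x).open_source.mem_nhds hp] with q hq
  simp [(chartAt (Model m) x).left_inv hq]

end Charts

/-! ## Line bundles and their tensor powers -/

section Frame

variable {M : Type*} [TopologicalSpace M]
  {L : M → Type*} [TopologicalSpace (TotalSpace ℂ L)] [∀ p, AddCommGroup (L p)]
  [∀ p, Module ℂ (L p)] [∀ p, TopologicalSpace (L p)] [FiberBundle ℂ L] [VectorBundle ℂ ℂ L]

lemma localFrame_ne_zero {x p : M} (hp : p ∈ (trivializationAt ℂ L x).baseSet) :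
    localFrame L x p ≠ 0 := by
  intro h0
  have h1 : (trivializationAt ℂ L x).linearMapAt ℂ p (localFrame L x p) = 1 :=
    (trivializationAt ℂ L x).linearMapAt_symm hp 1
  rw [h0, map_zero] at h1
  exact zero_ne_one h1

lemma linearMapAt_smul_localFrame {x p : M}
    (hp : p ∈ (trivializationAt ℂ L x).baseSet) (v : L p) :
    (trivializationAt ℂ L x).linearMapAt ℂ p v • localFrame L x p = v := by
  have h2 := (trivializationAt ℂ L x).symmₗ_linearMapAt (R := ℂ) hp v
  conv_rhs => rw [← h2]
  rw [localFrame, ← (trivializationAt ℂ L x).symmₗ_apply (R := ℂ) hp,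
    ← map_smul, smul_eq_mul, mul_one]

lemma exists_eq_smul {p : M} {e : L p} (he : e ≠ 0) (v : L p) :
    ∃ a : ℂ, v = a • e := by
  have hp : p ∈ (trivializationAt ℂ L p).baseSet := mem_baseSet_trivializationAt ℂ L p
  set l := (trivializationAt ℂ L p).linearMapAt ℂ p
  have h1 := linearMapAt_smul_localFrame hp e
  have h2 := linearMapAt_smul_localFrame hp v
  have h3 : l e ≠ 0 := fun h0 => he (by rw [← h1]; simp [l, h0])
  refine ⟨l v * (l e)⁻¹, ?_⟩
  have h4 : (l v * (l e)⁻¹) • l e • localFrame L p p = v := by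
    rw [smul_smul, mul_assoc, inv_mul_cancel₀ h3, mul_one, h2]
  rw [h1] at h4
  exact h4.symm

end Frame

/-! ### Hermitian metrics on tensor powers and the lifted action -/

section LineBundle

variable {m : ℕ} {M : Type*} [TopologicalSpace M] [ChartedSpace (Model m) M]
  {L : M → Type*} [TopologicalSpace (TotalSpace ℂ L)] [∀ p, AddCommGroup (L p)]
  [∀ p, Module ℂ (L p)] [∀ p, TopologicalSpace (L p)] [FiberBundle ℂ L]

namespace HermitianMetric

variable (h : HermitianMetric L m)

lemma inner_self {p : M} (v : L p) : h.inner p v v = (h.normSq v : ℂ) :=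
  (Complex.conj_eq_iff_re.1 (h.conj_symm p v v)).symm

lemma normSq_pos {p : M} {v : L p} (hv : v ≠ 0) : 0 < h.normSq v := h.pos p v hv

lemma normSq_smul {p : M} (c : ℂ) (v : L p) : h.normSq (c • v) = ‖c‖ ^ 2 * h.normSq v := by
  have : h.inner p (c • v) (c • v) = ((‖c‖ ^ 2 * h.normSq v : ℝ) : ℂ) := by
    simp only [LinearMap.map_smulₛₗ, LinearMap.smul_apply, inner_self, ← Complex.normSq_eq_norm_sq]
    push_cast
    rw [Complex.normSq_eq_conj_mul_self]
    simp
    ring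
  rw [normSq, this, Complex.ofReal_re]

lemma coeff_tprod_smul {N : ℕ} {p : M} {e : L p} (he : e ≠ 0) (a : Fin N → ℂ) :
    h.coeff e (PiTensorProduct.tprod ℂ fun i => a i • e) = ∏ i, a i := by
  have h0 : h.inner p e e ≠ 0 := by
    rw [inner_self]; exact_mod_cast (h.normSq_pos he).ne'
  simp [coeff, h0]

lemma coeff_tprod {N : ℕ} {p : M} {e : L p} (he : e ≠ 0) :
    h.coeff e (PiTensorProduct.tprod ℂ fun _ : Fin N => e) = 1 := by
  simpa using h.coeff_tprod_smul he (N := N) (fun _ => 1)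

variable [VectorBundle ℂ ℂ L]

/-- The fibre is a line, so every pure tensor is a multiple of `e^{⊗N}`; hence `coeff` is a full
coordinate on the fibre of `L^N`. -/
lemma coeff_smul_tprod {N : ℕ} {p : M} {e : L p} (he : e ≠ 0) (S : ⨂[ℂ]^N (L p)) :
    h.coeff e S • (PiTensorProduct.tprod ℂ fun _ : Fin N => e) = S := by
  have : ((h.coeff e).smulRight (PiTensorProduct.tprod ℂ fun _ : Fin N => e) :
      (⨂[ℂ]^N (L p)) →ₗ[ℂ] ⨂[ℂ]^N (L p)) = LinearMap.id := by
    apply PiTensorProduct.ext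
    ext v
    choose a ha using fun i => exists_eq_smul he (v i)
    obtain rfl : v = fun i => a i • e := funext ha
    simp only [LinearMap.compMultilinearMap_apply, LinearMap.smulRight_apply, LinearMap.id_apply]
    rw [coeff_tprod_smul h he, MultilinearMap.map_smul_univ]
  exact LinearMap.congr_fun this S

lemma coeff_injective {N : ℕ} {p : M} {e : L p} (he : e ≠ 0) :
    Function.Injective (h.coeff (N := N) e) := fun S T hST => by
  rw [← h.coeff_smul_tprod he S, ← h.coeff_smul_tprod he T, hST]

/-- Any linear functional taking the value `1` on `e^{⊗N}` is the coefficient. -/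
lemma eq_coeff {N : ℕ} {p : M} {e : L p} (he : e ≠ 0) {l : (⨂[ℂ]^N (L p)) →ₗ[ℂ] ℂ}
    (hl : l (PiTensorProduct.tprod ℂ fun _ : Fin N => e) = 1) (S : ⨂[ℂ]^N (L p)) :
    l S = h.coeff e S := by
  conv_lhs => rw [← h.coeff_smul_tprod he S]
  rw [map_smul, hl, smul_eq_mul, mul_one]

/-- Change of frame. -/
lemma coeff_eq_pow_mul {N : ℕ} {p : M} {e : L p} {k : ℂ} (he : e ≠ 0) (hk : k ≠ 0)
    (S : ⨂[ℂ]^N (L p)) : h.coeff e S = k ^ N * h.coeff (k • e) S := by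
  have hke : k • e ≠ 0 := smul_ne_zero hk he
  conv_lhs => rw [← h.coeff_smul_tprod hke S]
  rw [map_smul, h.coeff_tprod_smul he (fun _ => k), smul_eq_mul, mul_comm]
  simp

/-- `innerPow` is defined through the preferred frame at `p`. Under `e = k e'` the two coefficients
produce `|k|^{2N}`, which cancels against the change of `‖e‖^{2N}`, so any nonzero vector may be
used. -/
lemma innerPow_eq {N : ℕ} {p : M} {e : L p} (he : e ≠ 0) (S T : ⨂[ℂ]^N (L p)) :
    h.innerPow S T = h.coeff e S * conj (h.coeff e T) * ((h.normSq e ^ N : ℝ) : ℂ) := by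
  have h0 : localFrame L p p ≠ 0 := localFrame_ne_zero (mem_baseSet_trivializationAt ℂ L p)
  obtain ⟨k, hk⟩ := exists_eq_smul h0 e
  have hk0 : k ≠ 0 := by rintro rfl; exact he (by simpa using hk)
  rw [innerPow, h.coeff_eq_pow_mul h0 hk0 S, h.coeff_eq_pow_mul h0 hk0 T, hk, normSq_smul,
    map_mul, map_pow, mul_pow]
  push_cast
  rw [← pow_mul, mul_comm 2 N, pow_mul', ← Complex.conj_mul', mul_pow]
  ring

lemma innerPow_self {N : ℕ} {p : M} {e : L p} (he : e ≠ 0) (S : ⨂[ℂ]^N (L p)) :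
    h.innerPow S S = ((‖h.coeff e S‖ ^ 2 * h.normSq e ^ N : ℝ) : ℂ) := by
  rw [h.innerPow_eq he, Complex.mul_conj']
  push_cast
  rfl

end HermitianMetric

variable [MulAction (Torus m) M] {h : HermitianMetric L m} (A : ToricLift h)

namespace ToricLift

lemma normSq_act (t : Torus m) (p : M) (v : L p) : h.normSq (A.act t p v) = h.normSq v := by
  simp [HermitianMetric.normSq, A.isometry]

lemma act_ne_zero {t : Torus m} {p : M} {v : L p} (hv : v ≠ 0) : A.act t p v ≠ 0 := by
  intro h0
  have h1 := h.normSq_pos hv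
  rw [← A.normSq_act t p v, h0] at h1
  simp [HermitianMetric.normSq] at h1

variable [VectorBundle ℂ ℂ L]

lemma coeff_act_map {N : ℕ} {t : Torus m} {p : M} {e : L p} (he : e ≠ 0) (S : ⨂[ℂ]^N (L p)) :
    h.coeff (A.act t p e) (PiTensorProduct.map (fun _ => A.act t p) S) = h.coeff e S := by
  refine h.eq_coeff he (l := (h.coeff (A.act t p e)).comp
    (PiTensorProduct.map fun _ => A.act t p)) ?_ S
  simp only [LinearMap.comp_apply, PiTensorProduct.map_tprod]
  exact h.coeff_tprod (A.act_ne_zero he)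

end ToricLift

end LineBundle

/-! ## Holomorphic frames and sections -/

section Frames

variable {m : ℕ} {M : Type*} [TopologicalSpace M] [ChartedSpace (Model m) M]
  [IsManifold 𝓘(ℂ, Model m) ω M]
  {L : M → Type*} [TopologicalSpace (TotalSpace ℂ L)] [∀ p, AddCommGroup (L p)]
  [∀ p, Module ℂ (L p)] [∀ p, TopologicalSpace (L p)] [FiberBundle ℂ L] [VectorBundle ℂ ℂ L]
  [ContMDiffVectorBundle ω ℂ L 𝓘(ℂ, Model m)]

/-- The coordinate of a vector in the local frame near `x`. -/
def frameCoord (x p : M) (v : L p) : ℂ := (trivializationAt ℂ L x).linearMapAt ℂ p v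

lemma frameCoord_smul_localFrame {x p : M} (hp : p ∈ (trivializationAt ℂ L x).baseSet) (v : L p) :
    frameCoord x p v • localFrame L x p = v := linearMapAt_smul_localFrame hp v

lemma frameCoord_ne_zero {x p : M} (hp : p ∈ (trivializationAt ℂ L x).baseSet) {v : L p}
    (hv : v ≠ 0) : frameCoord x p v ≠ 0 := fun h => hv <| by
  rw [← frameCoord_smul_localFrame hp v, h, zero_smul]

lemma frameCoord_eq {x p : M} (hp : p ∈ (trivializationAt ℂ L x).baseSet) (v : L p) :
    frameCoord x p v = (trivializationAt ℂ L x ⟨p, v⟩).2 := by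
  rw [frameCoord, Trivialization.coe_linearMapAt_of_mem _ hp]

variable (L) in
lemma isHolomorphicFrame_localFrame (x : M) :
    IsHolomorphicFrame L m (localFrame L x) (trivializationAt ℂ L x).baseSet where
  isOpen := (trivializationAt ℂ L x).open_baseSet
  holomorphic := by
    refine ((trivializationAt ℂ L x).contMDiffOn_section_baseSet_iff (n := ω)
      (IB := 𝓘(ℂ, Model m)) (s := localFrame L x)).2 ?_
    refine (contMDiffOn_const (c := (1 : ℂ))).congr fun p hp => ?_
    rw [localFrame, (trivializationAt ℂ L x).apply_mk_symm hp]
  ne_zero := fun _ hp => localFrame_ne_zero hp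

lemma IsHolomorphicFrame.contMDiffOn_frameCoord {e : ∀ p, L p} {U : Set M}
    (he : IsHolomorphicFrame L m e U) (x : M) :
    ContMDiffOn 𝓘(ℂ, Model m) 𝓘(ℂ, ℂ) ω (fun p => frameCoord x p (e p))
      (U ∩ (trivializationAt ℂ L x).baseSet) := by
  have h1 := ((trivializationAt ℂ L x).contMDiffOn_section_iff (n := ω) (IB := 𝓘(ℂ, Model m))
    (s := e) (he.isOpen.inter (trivializationAt ℂ L x).open_baseSet) inter_subset_right).1
    (he.holomorphic.mono inter_subset_left)
  exact h1.congr fun p hp => frameCoord_eq hp.2 _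

namespace HermitianMetric

variable (h : HermitianMetric L m)

lemma contDiffOn_normSq_frame {e : ∀ p, L p} {U : Set M} (he : IsHolomorphicFrame L m e U)
    (x : M) : ContDiffOn ℝ ∞ (fun w => h.normSq (e ((chartAt (Model m) x).symm w)))
      ((chartAt (Model m) x).target ∩ (chartAt (Model m) x).symm ⁻¹' U) := by
  intro w hw
  set p := (chartAt (Model m) x).symm w with hp
  have hpb : p ∈ (trivializationAt ℂ L p).baseSet := mem_baseSet_trivializationAt ℂ L p
  have ho := isOpen_chart_preimage (m := m) x (he.isOpen.inter (trivializationAt ℂ L p).open_baseSet)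
  have ho' := isOpen_chart_preimage (m := m) x (trivializationAt ℂ L p).open_baseSet
  have h1 := ((contDiffOn_comp_chart_symm (he.contMDiffOn_frameCoord p) x).contDiffAt
    (ho.mem_nhds (x := w) ⟨hw.1, hw.2, hpb⟩))
  have h2 : ContDiffAt ℝ ∞ _ w := (h1.restrict_scalars ℝ).of_le le_top
  have h3 := (contDiffOn_real_comp_chart_symm (h.smooth p) x).contDiffAt
    (ho'.mem_nhds (x := w) ⟨hw.1, hpb⟩)
  refine ContDiffAt.contDiffWithinAt ?_
  refine ((h2.norm_sq ℝ).mul h3).congr_of_eventuallyEq ?_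
  filter_upwards [ho'.mem_nhds (x := w) ⟨hw.1, hpb⟩] with w' hw'
  rw [← HermitianMetric.normSq, ← h.normSq_smul, frameCoord_smul_localFrame hw'.2]

variable {h}

lemma IsHolomorphicSection.differentiableOn {N : ℕ} {s : ∀ p, ⨂[ℂ]^N (L p)}
    (hs : h.IsHolomorphicSection s) {e : ∀ p, L p} {U : Set M} (he : IsHolomorphicFrame L m e U)
    (x : M) : DifferentiableOn ℂ (fun w => h.coeff (e ((chartAt (Model m) x).symm w))
      (s ((chartAt (Model m) x).symm w)))
      ((chartAt (Model m) x).target ∩ (chartAt (Model m) x).symm ⁻¹' U) :=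
  differentiableOn_comp_chart_symm (hs e U he) x

/-- Holomorphy of a section may be checked at each point in the preferred frame there. -/
lemma isHolomorphicSection_of_localFrame {N : ℕ} {s : ∀ p, ⨂[ℂ]^N (L p)}
    (hs : ∀ x : M, MDifferentiableAt 𝓘(ℂ, Model m) 𝓘(ℂ, ℂ)
      (fun p => h.coeff (localFrame L x p) (s p)) x) : h.IsHolomorphicSection s := by
  intro e U he x hx
  have hxb : x ∈ (trivializationAt ℂ L x).baseSet := mem_baseSet_trivializationAt ℂ L x
  have ho : U ∩ (trivializationAt ℂ L x).baseSet ∈ 𝓝 x :=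
    (he.isOpen.inter (trivializationAt ℂ L x).open_baseSet).mem_nhds ⟨hx, hxb⟩
  have h1 : MDifferentiableAt 𝓘(ℂ, Model m) 𝓘(ℂ, ℂ) (fun p => frameCoord x p (e p)) x :=
    ((he.contMDiffOn_frameCoord x).contMDiffAt ho).mdifferentiableAt (by simp)
  have h2 : DifferentiableAt ℂ (fun z : ℂ => (z ^ N)⁻¹) (frameCoord x x (e x)) :=
    (differentiableAt_id.pow N).inv (pow_ne_zero _ (frameCoord_ne_zero hxb (he.ne_zero x hx)))
  have h3 := (mdifferentiableAt_iff_differentiableAt.2 h2).comp x h1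
  refine ((h3.mul (hs x)).congr_of_eventuallyEq ?_).mdifferentiableWithinAt
  filter_upwards [ho] with p hp
  have hk := frameCoord_ne_zero hp.2 (he.ne_zero p hp.1)
  rw [Pi.mul_apply, h.coeff_eq_pow_mul (localFrame_ne_zero hp.2) hk,
    frameCoord_smul_localFrame hp.2, Function.comp_apply, inv_mul_cancel_left₀ (pow_ne_zero _ hk)]

lemma IsHolomorphicSection.continuous_innerPow {N : ℕ} {s t : ∀ p, ⨂[ℂ]^N (L p)}
    (hs : h.IsHolomorphicSection s) (ht : h.IsHolomorphicSection t) :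
    Continuous fun p => h.innerPow (s p) (t p) := by
  rw [continuous_iff_continuousAt]
  intro x
  have hxb : (trivializationAt ℂ L x).baseSet ∈ 𝓝 x :=
    (trivializationAt ℂ L x).open_baseSet.mem_nhds (mem_baseSet_trivializationAt ℂ L x)
  have hf := isHolomorphicFrame_localFrame (m := m) L x
  have h1 := ((hs _ _ hf).continuousOn).continuousAt hxb
  have h2 := ((ht _ _ hf).continuousOn).continuousAt hxb
  have h3 : ContinuousAt (fun p => h.normSq (localFrame L x p)) x :=
    (h.smooth x).continuousOn.continuousAt hxb
  have h4 : ContinuousAt (fun p => h.coeff (localFrame L x p) (s p) *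
      conj (h.coeff (localFrame L x p) (t p)) *
        ((h.normSq (localFrame L x p) ^ N : ℝ) : ℂ)) x :=
    (h1.mul (Complex.continuous_conj.continuousAt.comp h2)).mul
      (Complex.continuous_ofReal.continuousAt.comp (h3.pow N))
  refine h4.congr ?_
  filter_upwards [hxb] with p hp
  rw [h.innerPow_eq (localFrame_ne_zero hp)]

variable (h)

lemma contDiffAt_localPotential {x y : M} {w : Model m} (hw : w ∈ (chartAt (Model m) y).target)
    (hb : (chartAt (Model m) y).symm w ∈ (trivializationAt ℂ L x).baseSet) :
    ContDiffAt ℝ ∞ (fun q => h.localPotential x ((chartAt (Model m) y).symm q)) w := by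
  have hf := isHolomorphicFrame_localFrame (m := m) L x
  have h1 := (h.contDiffOn_normSq_frame hf y).contDiffAt
    ((isOpen_chart_preimage y hf.isOpen).mem_nhds ⟨hw, hb⟩)
  exact (h1.log (h.normSq_pos (hf.ne_zero _ hb)).ne').neg

end HermitianMetric

end Frames

/-! ## The lifted action in local frames -/

section Lift

variable {m : ℕ} {M : Type*} [TopologicalSpace M] [ChartedSpace (Model m) M]
  [IsManifold 𝓘(ℂ, Model m) ω M] [MulAction (Torus m) M]
  {L : M → Type*} [TopologicalSpace (TotalSpace ℂ L)] [∀ p, AddCommGroup (L p)]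
  [∀ p, Module ℂ (L p)] [∀ p, TopologicalSpace (L p)] [FiberBundle ℂ L] [VectorBundle ℂ ℂ L]
  [ContMDiffVectorBundle ω ℂ L 𝓘(ℂ, Model m)]

lemma IsToricAction.continuous_smul (hact : IsToricAction m M) (t : Torus m) :
    Continuous fun p : M => t • p := (hact.holomorphic t).continuous

/-- `IsToricAction` gives regularity in the angles `θ`; joint continuity over the torus itself is
read off from the lift along the zero section. -/
lemma ToricLift.continuous_smul {h : HermitianMetric L m} (A : ToricLift h) :
    Continuous fun x : Torus m × M => x.1 • x.2 := by
  have h1 : Continuous fun x : Torus m × M => (x.1, (⟨x.2, 0⟩ : TotalSpace ℂ L)) :=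
    continuous_fst.prodMk ((Bundle.Trivialization.continuous_zeroSection (R := ℂ) (F := ℂ) (E := L)).comp continuous_snd)
  exact (FiberBundle.continuous_proj ℂ L).comp (A.continuous_act.comp h1)

lemma ToricLift.contMDiffOn_frameCoord_act {h : HermitianMetric L m} (A : ToricLift h)
    (t : Torus m) (x y : M) :
    ContMDiffOn 𝓘(ℂ, Model m) 𝓘(ℂ, ℂ) ω
      (fun p => frameCoord y (t • p) (A.act t p (localFrame L x p)))
      ((trivializationAt ℂ L x).baseSet ∩
        {p | t • p ∈ (trivializationAt ℂ L y).baseSet}) := by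
  have h1 := (A.holomorphic_act t).comp_contMDiffOn
    ((isHolomorphicFrame_localFrame (m := m) L x).holomorphic.mono
      (inter_subset_left (t := {p | t • p ∈ (trivializationAt ℂ L y).baseSet})))
  have h2 := ((trivializationAt ℂ L y).contMDiffOn_iff (n := ω) (IB := 𝓘(ℂ, Model m))
    (IM := 𝓘(ℂ, Model m)) (by
      intro p hp
      rw [Trivialization.mem_source]
      exact hp.2)).1 h1
  exact h2.2.congr fun p hp => frameCoord_eq hp.2 _

/-- The local potentials at `x` and `y`, compared through the action of `t`. -/
lemma ToricLift.localPotential_eq {h : HermitianMetric L m} (A : ToricLift h)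
    (t : Torus m) {x y p : M} (hx : p ∈ (trivializationAt ℂ L x).baseSet)
    (hy : t • p ∈ (trivializationAt ℂ L y).baseSet) :
    h.localPotential x p = h.localPotential y (t • p) -
      Real.log (‖frameCoord y (t • p) (A.act t p (localFrame L x p))‖ ^ 2) := by
  have h0 := A.act_ne_zero (t := t) (localFrame_ne_zero hx)
  have hk := frameCoord_ne_zero hy h0
  have h1 := A.normSq_act t p (localFrame L x p)
  rw [← frameCoord_smul_localFrame hy (A.act t p (localFrame L x p)), h.normSq_smul] at h1
  rw [HermitianMetric.localPotential, HermitianMetric.localPotential, ← h1,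
    Real.log_mul (by positivity) (h.normSq_pos (localFrame_ne_zero hy)).ne']
  ring

/-- Dividing by `k w` brings the values near `1`, away from the branch cut, so that the principal
logarithm is holomorphic there. -/
lemma exists_log_norm_sq_eq_re {k : Model m → ℂ} {w : Model m} (hk : ContDiffAt ℂ ω k w)
    (h0 : k w ≠ 0) : ∃ κ : Model m → ℂ, ContDiffAt ℂ 2 κ w ∧
      ∀ᶠ q in 𝓝 w, Real.log (‖k q‖ ^ 2) = (κ q).re := by
  refine ⟨fun q => 2 * Complex.log (k q / k w) + (Real.log (‖k w‖ ^ 2) : ℂ), ?_, ?_⟩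
  · have h1 : ContDiffAt ℂ 2 (fun q => k q / k w) w := (hk.of_le le_top).div_const _
    refine (contDiffAt_const.mul (ContDiffAt.comp w (Complex.contDiffAt_log (by
      simp [div_self h0])) h1)).add contDiffAt_const
  · filter_upwards [hk.continuousAt.eventually_ne h0] with q hq
    have h1 : (2 * Complex.log (k q / k w)).re = Real.log (‖k q / k w‖ ^ 2) := by
      rw [show (2 : ℂ) = ((2 : ℝ) : ℂ) by simp, Complex.re_ofReal_mul, Complex.log_re, Real.log_pow]
      simp
    rw [Complex.add_re, h1, Complex.ofReal_re, norm_div, div_pow,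
      Real.log_div (by positivity) (by positivity)]
    ring

end Lift

/-! ## The Kähler volume -/

section Volume

variable {m : ℕ} {M : Type*} [TopologicalSpace M] [ChartedSpace (Model m) M]
  [IsManifold 𝓘(ℂ, Model m) ω M] [MulAction (Torus m) M]
  {L : M → Type*} [TopologicalSpace (TotalSpace ℂ L)] [∀ p, AddCommGroup (L p)]
  [∀ p, Module ℂ (L p)] [∀ p, TopologicalSpace (L p)] [FiberBundle ℂ L] [VectorBundle ℂ ℂ L]
  [ContMDiffVectorBundle ω ℂ L 𝓘(ℂ, Model m)]

/-- The action of `t` in the charts at `x` and `y`. -/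
def actionInCharts (t : Torus m) (x y : M) (w : Model m) : Model m :=
  chartAt (Model m) y (t • (chartAt (Model m) x).symm w)

/-- The domain of `actionInCharts`. -/
def actionDomain (t : Torus m) (x y : M) : Set (Model m) :=
  (chartAt (Model m) x).target ∩
    (chartAt (Model m) x).symm ⁻¹' {p | t • p ∈ (chartAt (Model m) y).source}

lemma IsToricAction.isOpen_actionDomain (hact : IsToricAction m M) (t : Torus m) (x y : M) :
    IsOpen (actionDomain t x y) :=
  isOpen_chart_preimage x ((chartAt (Model m) y).open_source.preimage (hact.continuous_smul t))

lemma IsToricAction.contDiffOn_actionInCharts (hact : IsToricAction m M) (t : Torus m) (x y : M) :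
    ContDiffOn ℂ ω (actionInCharts t x y) (actionDomain t x y) := by
  refine contDiffOn_comp_chart_symm (f := fun p => chartAt (Model m) y (t • p)) ?_ x
  exact ((contMDiffOn_chart (n := ω) (x := y)).comp' (hact.holomorphic t).contMDiffOn).mono
    (fun p hp => ⟨trivial, hp⟩)

lemma injOn_actionInCharts (t : Torus m) (x y : M) :
    InjOn (actionInCharts t x y) (actionDomain t x y) := by
  intro w hw w' hw' heq
  have h1 := (chartAt (Model m) y).injOn hw.2 hw'.2 heq
  have h2 := MulAction.injective t h1
  exact (chartAt (Model m) x).symm.injOn hw.1 hw'.1 h2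

variable (h : HermitianMetric L m)

/-- The determinant `det (g_{j k̄})` in the chart at `x`, for the local potential at `a`. -/
def potentialDet (a x : M) (w : Model m) : ℝ :=
  (complexHessianMatrix (fun q => h.localPotential a ((chartAt (Model m) x).symm q)) w).det.re

variable {h}

/-- The lift is isometric and holomorphic, so the two potentials differ by `log |k|²` with `k`
holomorphic, the real part of a holomorphic function. The case `t = 1` gives independence of charts
and frames. -/
lemma ToricLift.potentialDet_eq (A : ToricLift h) (hact : IsToricAction m M) (t : Torus m)
    {x y a b : M}
    {w : Model m} (hw : w ∈ actionDomain t x y)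
    (ha : (chartAt (Model m) x).symm w ∈ (trivializationAt ℂ L a).baseSet)
    (hb : t • (chartAt (Model m) x).symm w ∈ (trivializationAt ℂ L b).baseSet) :
    potentialDet h a x w =
      ‖(LinearMap.toMatrix' (fderiv ℂ (actionInCharts t x y) w : Model m →ₗ[ℂ] Model m)).det‖ ^ 2 *
        potentialDet h b y (actionInCharts t x y w) := by
  have hD := hact.isOpen_actionDomain t x y
  set k : Model m → ℂ := fun q => frameCoord b (t • (chartAt (Model m) x).symm q)
    (A.act t _ (localFrame L a ((chartAt (Model m) x).symm q))) with hk
  have ho : IsOpen ((trivializationAt ℂ L a).baseSet ∩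
        {p | t • p ∈ (trivializationAt ℂ L b).baseSet}) :=
    (trivializationAt ℂ L a).open_baseSet.inter
      ((trivializationAt ℂ L b).open_baseSet.preimage (hact.continuous_smul t))
  have hmem := (isOpen_chart_preimage (m := m) x ho).mem_nhds (x := w) ⟨hw.1, ha, hb⟩
  have hkc : ContDiffAt ℂ ω k w :=
    (contDiffOn_comp_chart_symm (A.contMDiffOn_frameCoord_act t a b) x).contDiffAt hmem
  have hk0 : k w ≠ 0 := frameCoord_ne_zero hb (A.act_ne_zero (localFrame_ne_zero ha))
  obtain ⟨κ, hκ, hκe⟩ := exists_log_norm_sq_eq_re hkc hk0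
  refine det_complexHessianMatrix_comp_add_re (κ := fun q => -κ q)
    (g := fun q => h.localPotential b ((chartAt (Model m) y).symm q)) ?_
    (((hact.contDiffOn_actionInCharts t x y).contDiffAt (hD.mem_nhds hw)).of_le le_top) hκ.neg ?_
  · refine (h.contDiffAt_localPotential ((chartAt (Model m) y).map_source hw.2) ?_).of_le
      ENat.LEInfty.out
    rw [(chartAt (Model m) y).left_inv hw.2]
    exact hb
  · filter_upwards [hκe, hmem, hD.mem_nhds hw] with q hq hqm hqD
    rw [A.localPotential_eq t hqm.2.1 hqm.2.2, actionInCharts,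
      (chartAt (Model m) y).left_inv hqD.2, hq, Complex.neg_re, sub_eq_add_neg]

lemma mem_actionDomain_one {x y : M} {w : Model m} (hw : w ∈ (chartAt (Model m) x).target)
    (hy : (chartAt (Model m) x).symm w ∈ (chartAt (Model m) y).source) :
    w ∈ actionDomain (1 : Torus m) x y := ⟨hw, by simpa using hy⟩

/-- Positivity is assumed only at the centre of each chart; the transformation rule with `t = 1`
carries it to an arbitrary chart and frame around the point. -/
lemma ToricLift.potentialDet_pos (A : ToricLift h) (hact : IsToricAction m M)
    (hpos : h.IsPositive) {x a : M}
    {w : Model m} (hw : w ∈ (chartAt (Model m) x).target)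
    (ha : (chartAt (Model m) x).symm w ∈ (trivializationAt ℂ L a).baseSet) :
    0 < potentialDet h a x w := by
  set p := (chartAt (Model m) x).symm w with hp
  have hps : p ∈ (chartAt (Model m) p).source := mem_chart_source _ p
  have hpb : p ∈ (trivializationAt ℂ L p).baseSet := mem_baseSet_trivializationAt ℂ L p
  have hpx : p ∈ (chartAt (Model m) x).source := (chartAt (Model m) x).map_target hw
  have h1 : 0 < potentialDet h p p (chartAt (Model m) p p) := by
    refine det_complexHessianMatrix_pos ((h.contDiffAt_localPotential
      ((chartAt (Model m) p).map_source hps) ?_).of_le ENat.LEInfty.out) fun v hv => ?_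
    · rw [(chartAt (Model m) p).left_inv hps]; exact hpb
    · have := hpos p v hv
      rwa [HermitianMetric.curvature, (chartAt (Model m) p).left_inv hps] at this
  have hsy := (chartAt (Model m) p).left_inv hps
  have h2 := A.potentialDet_eq hact 1 (x := p) (y := x) (a := p) (b := a)
    (w := chartAt (Model m) p p)
    (mem_actionDomain_one ((chartAt (Model m) p).map_source hps) (by rw [hsy]; exact hpx))
    (by rw [hsy]; exact hpb) (by rw [hsy, one_smul]; exact ha)
  have h3 : actionInCharts 1 p x (chartAt (Model m) p p) = w := by
    rw [actionInCharts, hsy, one_smul, hp, (chartAt (Model m) x).right_inv hw]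
  rw [h3] at h2
  rw [h2] at h1
  exact pos_of_mul_pos_right h1 (by positivity)

/-- The determinant does not depend on the local frame. -/
lemma ToricLift.potentialDet_frame (A : ToricLift h) (hact : IsToricAction m M) {x a b : M}
    {w : Model m}
    (hw : w ∈ (chartAt (Model m) x).target)
    (ha : (chartAt (Model m) x).symm w ∈ (trivializationAt ℂ L a).baseSet)
    (hb : (chartAt (Model m) x).symm w ∈ (trivializationAt ℂ L b).baseSet) :
    potentialDet h a x w = potentialDet h b x w := by
  have h1 := A.potentialDet_eq hact 1 (x := x) (y := x) (a := a) (b := b)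
    (mem_actionDomain_one hw ((chartAt (Model m) x).map_target hw)) ha (by rwa [one_smul])
  have h2 : actionInCharts (1 : Torus m) x x =ᶠ[𝓝 w] id := by
    filter_upwards [(chartAt (Model m) x).open_target.mem_nhds hw] with q hq
    simp [actionInCharts, (chartAt (Model m) x).right_inv hq]
  rw [h1, h2.fderiv_eq, h2.self_of_nhds, fderiv_id]
  simp

lemma continuousAt_potentialDet {x a : M} {w : Model m} (hw : w ∈ (chartAt (Model m) x).target)
    (ha : (chartAt (Model m) x).symm w ∈ (trivializationAt ℂ L a).baseSet) :
    ContinuousAt (potentialDet h a x) w := by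
  have hg := h.contDiffAt_localPotential hw ha
  set g : Model m → ℝ := fun q => h.localPotential a ((chartAt (Model m) x).symm q)
  have h1 : ContinuousAt (fderiv ℝ (fderiv ℝ g)) w :=
    ((hg.fderiv_right (m := 1) (by norm_cast)).fderiv_right (m := 0) (by norm_num)).continuousAt
  have h2 : ∀ᶠ q in 𝓝 w, ContDiffAt ℝ 2 g q :=
    (hg.of_le (m := 2) ENat.LEInfty.out).eventually (by simp)
  have h3 : ContinuousAt (complexHessianMatrix g) w := by
    refine continuousAt_pi.2 fun j => continuousAt_pi.2 fun k => ?_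
    have h4 : ∀ u v : Model m, ContinuousAt (fun q => fderiv ℝ (fderiv ℝ g) q u v) w :=
      fun u v => (h1.clm_apply continuousAt_const).clm_apply continuousAt_const
    refine ContinuousAt.congr (f := fun q => (1 / 4 : ℂ) * _) ?_ (h2.mono fun q hq =>
      (complexHessian_eq hq (Pi.single j 1) (Pi.single k 1)).symm)
    exact continuousAt_const.mul ((Complex.continuous_ofReal.continuousAt.comp
      ((h4 _ _).add (h4 _ _))).add (continuousAt_const.mul
        (Complex.continuous_ofReal.continuousAt.comp ((h4 _ _).sub (h4 _ _)))))
  exact Complex.continuous_re.continuousAt.comp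
    ((Continuous.matrix_det continuous_id).continuousAt.comp h3)

variable [MeasurableSpace M] [BorelSpace M]

lemma measurableSet_chart_preimage (x : M) {S : Set M} (hS : MeasurableSet S) :
    MeasurableSet ((chartAt (Model m) x).target ∩ (chartAt (Model m) x).symm ⁻¹' S) := by
  have h1 := MeasurableSet.subtype_image (chartAt (Model m) x).open_target.measurableSet
    ((continuousOn_iff_continuous_domRestrict.1
      (chartAt (Model m) x).continuousOn_symm).measurable hS)
  convert h1 using 1
  ext w
  simp [and_comm]

variable (h) in
-- The frame defining the density moves with the point of evaluation `w`.
lemma chartVolume_apply (x : M) {S : Set M} (hS : MeasurableSet S) :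
    h.chartVolume x S = ∫⁻ w in (chartAt (Model m) x).target ∩ (chartAt (Model m) x).symm ⁻¹' S,
      ENNReal.ofReal (potentialDet h ((chartAt (Model m) x).symm w) x w) := by
  have hm : AEMeasurable (chartAt (Model m) x).symm
      (volume.restrict (chartAt (Model m) x).target) :=
    (chartAt (Model m) x).continuousOn_symm.aemeasurable
      (chartAt (Model m) x).open_target.measurableSet
  have hnull : NullMeasurableSet ((chartAt (Model m) x).symm ⁻¹' S)
      (volume.restrict (chartAt (Model m) x).target) := hm.nullMeasurableSet_preimage hS
  rw [HermitianMetric.chartVolume, Measure.map_apply_of_aemeasurable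
    (hm.mono_ac (withDensity_absolutelyContinuous _ _)) hS, withDensity_apply₀ _ hnull,
    Measure.restrict_restrict₀ hnull, inter_comm]
  rfl

/-- Change of variables. Only an inequality holds in general, because the chart at `x` need not
cover the whole preimage of `S`. -/
lemma ToricLift.chartVolume_preimage_le (A : ToricLift h) (hact : IsToricAction m M) (t : Torus m)
    (x y : M)
    {S : Set M} (hS : MeasurableSet S) (hSy : S ⊆ (chartAt (Model m) y).source) :
    h.chartVolume x ((fun p => t • p) ⁻¹' S) ≤ h.chartVolume y S := by
  have hpre : MeasurableSet ((fun p : M => t • p) ⁻¹' S) :=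
    (hact.continuous_smul t).measurable hS
  rw [chartVolume_apply h x hpre, chartVolume_apply h y hS]
  set B := (chartAt (Model m) x).target ∩
    (chartAt (Model m) x).symm ⁻¹' ((fun p => t • p) ⁻¹' S) with hB
  have hBD : B ⊆ actionDomain t x y := fun w hw => ⟨hw.1, hSy hw.2⟩
  have hBm : MeasurableSet B := measurableSet_chart_preimage x hpre
  have hD := hact.isOpen_actionDomain t x y
  set Φ := actionInCharts t x y with hΦ
  have hder : ∀ w ∈ B, HasFDerivWithinAt Φ ((fderiv ℂ Φ w).restrictScalars ℝ) B w := fun w hw =>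
    ((((hact.contDiffOn_actionInCharts t x y).contDiffAt
      (hD.mem_nhds (hBD hw))).differentiableAt (by simp)).hasFDerivAt.restrictScalars
        ℝ).hasFDerivWithinAt
  have himg := lintegral_image_eq_lintegral_abs_det_fderiv_mul volume hBm hder
    ((injOn_actionInCharts t x y).mono hBD)
    (fun w => ENNReal.ofReal (potentialDet h ((chartAt (Model m) y).symm w) y w))
  calc _ = ∫⁻ w in Φ '' B, ENNReal.ofReal (potentialDet h ((chartAt (Model m) y).symm w) y w) := by
        rw [himg]
        refine setLIntegral_congr_fun hBm fun w hw => ?_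
        have hl : (chartAt (Model m) y).symm (Φ w) = t • (chartAt (Model m) x).symm w :=
          (chartAt (Model m) y).left_inv (hBD hw).2
        have h1 := A.potentialDet_eq hact t (hBD hw)
          (mem_baseSet_trivializationAt ℂ L ((chartAt (Model m) x).symm w))
          (b := t • (chartAt (Model m) x).symm w)
          (mem_baseSet_trivializationAt ℂ L (t • (chartAt (Model m) x).symm w))
        simp only [hl]
        rw [h1, det_restrictScalars_real, abs_of_nonneg (by positivity),
          ENNReal.ofReal_mul (by positivity)]
    _ ≤ _ := by
        refine lintegral_mono_set ?_
        rintro _ ⟨w, hw, rfl⟩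
        have hl : (chartAt (Model m) y).symm (Φ w) = t • (chartAt (Model m) x).symm w :=
          (chartAt (Model m) y).left_inv (hBD hw).2
        refine ⟨(chartAt (Model m) y).map_source (hBD hw).2, ?_⟩
        rw [mem_preimage, hl]
        exact hw.2

variable [SecondCountableTopology M]

variable (m M) in
lemma exists_countable_charts [Nonempty M] :
    ∃ y : ℕ → M, ⋃ n, (chartAt (Model m) (y n)).source = univ := by
  obtain ⟨s, hs, hu⟩ := TopologicalSpace.countable_cover_nhds
    (fun x : M => (chartAt (Model m) x).open_source.mem_nhds (mem_chart_source (Model m) x))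
  have hne : s.Nonempty := by
    rw [nonempty_iff_ne_empty]
    rintro rfl
    rw [biUnion_empty] at hu
    exact empty_ne_univ hu
  obtain ⟨y, rfl⟩ := hs.exists_eq_range hne
  exact ⟨y, by simpa using hu⟩

/-- The comparison of chart volumes needs a set inside one chart domain, so the set is cut along a
countable disjoint cover by pieces of chart domains. -/
lemma ToricLift.map_chartVolume_le (A : ToricLift h) (hact : IsToricAction m M) [Nonempty M]
    (t : Torus m) (x : M) :
    (h.chartVolume x).map (fun p => t • p) ≤ h.kahlerVolume := by
  obtain ⟨y, hy⟩ := exists_countable_charts m M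
  have hsm : ∀ n, MeasurableSet ((chartAt (Model m) (y n)).source) := fun n =>
    (chartAt (Model m) (y n)).open_source.measurableSet
  set D := disjointed fun n => (chartAt (Model m) (y n)).source with hD
  have hDm : ∀ n, MeasurableSet (D n) := MeasurableSet.disjointed hsm
  have hDu : ⋃ n, D n = univ := by rw [hD, iUnion_disjointed, hy]
  have ht : Measurable fun p : M => t • p := (hact.continuous_smul t).measurable
  have hsplit : ∀ (ν : Measure M) {S : Set M}, MeasurableSet S → ν S = ∑' n, ν (S ∩ D n) := by
    intro ν S hS
    rw [← measure_iUnion (fun i j hij => ((disjoint_disjointed _ hij).mono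
      inter_subset_right inter_subset_right)) (fun n => hS.inter (hDm n)), ← inter_iUnion, hDu,
      inter_univ]
  refine Measure.le_iff.2 fun S hS => ?_
  rw [hsplit _ hS, hsplit h.kahlerVolume hS]
  refine ENNReal.tsum_le_tsum fun n => ?_
  rw [Measure.map_apply ht (hS.inter (hDm n))]
  refine (A.chartVolume_preimage_le hact t x (y n) (hS.inter (hDm n))
    (inter_subset_right.trans (disjointed_subset _ n))).trans ?_
  exact le_iSup (fun x => h.chartVolume x) (y n) _

/-- One inequality for every group element suffices: applied to `t⁻¹` it gives the reverse
inequality. -/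
theorem ToricLift.map_kahlerVolume (A : ToricLift h) (hact : IsToricAction m M) [Nonempty M]
    (t : Torus m) :
    h.kahlerVolume.map (fun p => t • p) = h.kahlerVolume := by
  have ht : ∀ t : Torus m, Measurable fun p : M => t • p :=
    fun t => (hact.continuous_smul t).measurable
  have hle : ∀ t : Torus m, h.kahlerVolume ≤ h.kahlerVolume.map (fun p => t • p) := by
    intro t
    refine iSup_le fun x => Measure.le_iff.2 fun S hS => ?_
    have h1 := A.map_chartVolume_le hact t⁻¹ x ((fun p => t • p) ⁻¹' S)
    rw [Measure.map_apply (ht _) (ht t hS), preimage_preimage] at h1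
    rw [Measure.map_apply (ht t) hS]
    simpa using h1
  refine le_antisymm (Measure.le_iff.2 fun S hS => ?_) (hle t)
  have h1 := hle t⁻¹ ((fun p => t • p) ⁻¹' S)
  rw [Measure.map_apply (ht t) hS]
  rw [Measure.map_apply (ht _) (ht t hS), preimage_preimage] at h1
  simpa using h1

/-- Inside one chart domain that chart's volume dominates all the others (the case `t = 1` of the
comparison), so there the supremum of measures is an explicit measure. This gives σ-finiteness
properties and null sets. -/
theorem ToricLift.kahlerVolume_eq_sum (A : ToricLift h) (hact : IsToricAction m M) [Nonempty M] :
    ∃ (y : ℕ → M) (D : ℕ → Set M),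
      h.kahlerVolume = Measure.sum fun n => (h.chartVolume (y n)).restrict (D n) := by
  obtain ⟨y, hy⟩ := exists_countable_charts m M
  have hsm : ∀ n, MeasurableSet ((chartAt (Model m) (y n)).source) := fun n =>
    (chartAt (Model m) (y n)).open_source.measurableSet
  set D := disjointed fun n => (chartAt (Model m) (y n)).source with hD
  have hDm : ∀ n, MeasurableSet (D n) := MeasurableSet.disjointed hsm
  have hDu : ⋃ n, D n = univ := by rw [hD, iUnion_disjointed, hy]
  have hsplit : ∀ (ν : Measure M) {S : Set M}, MeasurableSet S → ν S = ∑' n, ν (S ∩ D n) := by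
    intro ν S hS
    rw [← measure_iUnion (fun i j hij => ((disjoint_disjointed _ hij).mono
      inter_subset_right inter_subset_right)) (fun n => hS.inter (hDm n)), ← inter_iUnion, hDu,
      inter_univ]
  refine ⟨y, D, le_antisymm (iSup_le fun x => Measure.le_iff.2 fun S hS => ?_)
    (Measure.le_iff.2 fun S hS => ?_)⟩
  · rw [Measure.sum_apply _ hS, hsplit _ hS]
    refine ENNReal.tsum_le_tsum fun n => ?_
    rw [Measure.restrict_apply hS]
    have h1 := A.chartVolume_preimage_le hact 1 x (y n) (hS.inter (hDm n))
      (inter_subset_right.trans (disjointed_subset _ n))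
    simpa using h1
  · rw [Measure.sum_apply _ hS, hsplit h.kahlerVolume hS]
    refine ENNReal.tsum_le_tsum fun n => ?_
    rw [Measure.restrict_apply hS]
    exact le_iSup (fun x => h.chartVolume x) (y n) _

theorem ToricLift.sFinite_kahlerVolume (A : ToricLift h) (hact : IsToricAction m M) [Nonempty M] :
    SFinite h.kahlerVolume := by
  obtain ⟨y, D, hK⟩ := A.kahlerVolume_eq_sum hact
  have : ∀ n, SFinite (h.chartVolume (y n)) := fun n => by
    rw [HermitianMetric.chartVolume]; infer_instance
  rw [hK]
  infer_instance

theorem ToricLift.kahlerVolume_eq_zero (A : ToricLift h) (hact : IsToricAction m M) [Nonempty M]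
    {S : Set M}
    (hS : MeasurableSet S) (h0 : ∀ x : M, volume ((chartAt (Model m) x).target ∩
      (chartAt (Model m) x).symm ⁻¹' S) = 0) : h.kahlerVolume S = 0 := by
  obtain ⟨y, D, hK⟩ := A.kahlerVolume_eq_sum hact
  rw [hK, Measure.sum_apply _ hS, ENNReal.tsum_eq_zero]
  intro n
  have h1 : h.chartVolume (y n) S = 0 := by
    rw [chartVolume_apply h _ hS]
    exact setLIntegral_measure_zero _ _ (h0 (y n))
  exact le_antisymm ((Measure.restrict_apply_le _ _).trans h1.le) bot_le

end Volume

/-! ## The generators of the action -/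

section Generators

variable {m : ℕ} {M : Type*} [TopologicalSpace M] [ChartedSpace (Model m) M]
  [IsManifold 𝓘(ℂ, Model m) ω M] [MulAction (Torus m) M]

lemma expTorus_zero : expTorus (0 : Fin m → ℝ) = 1 := by
  ext j; simp [expTorus]

/-- The differential at `θ = 0` of `θ ↦ e^{iθ} p`, in the chart at `x`, for `p` with coordinates
`w`. -/
def generatorField (x : M) (w : Model m) : (Fin m → ℝ) →L[ℝ] Model m :=
  fderiv ℝ (fun θ => actionInCharts (expTorus θ) x x w) 0

/-- The complex determinant of the generators of the action. -/
def generatorDet (x : M) (w : Model m) : ℂ :=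
  (Matrix.of fun j k : Fin m => generatorField x w (Pi.single k 1) j).det

lemma actionInCharts_one {x : M} {w : Model m} (hw : w ∈ (chartAt (Model m) x).target) :
    actionInCharts (1 : Torus m) x x w = w := by
  rw [actionInCharts, one_smul, (chartAt (Model m) x).right_inv hw]

lemma chart_symm_actionInCharts {t : Torus m} {x y : M} {w : Model m}
    (hw : w ∈ actionDomain t x y) : (chartAt (Model m) y).symm (actionInCharts t x y w) =
      t • (chartAt (Model m) x).symm w := (chartAt (Model m) y).left_inv hw.2

lemma generatorField_apply (x : M) (w : Model m) (v : Fin m → ℝ) :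
    generatorField x w v = ∑ k, (v k : ℂ) • generatorField x w (Pi.single k 1) := by
  conv_lhs => rw [pi_eq_sum_univ' v, map_sum]
  refine Finset.sum_congr rfl fun k _ => ?_
  rw [map_smul]
  ext j
  simp

namespace IsToricAction

lemma contDiffAt_uncurry (hact : IsToricAction m M) {x : M} {θ : Fin m → ℝ} {w : Model m}
    (hw : w ∈ actionDomain (expTorus θ) x x) :
    ContDiffAt ℝ ∞ (fun q : (Fin m → ℝ) × Model m => actionInCharts (expTorus q.1) x x q.2)
      (θ, w) := by
  rw [← contMDiffAt_iff_contDiffAt]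
  have hf : ContMDiffAt 𝓘(ℝ, (Fin m → ℝ) × Model m) 𝓘(ℝ, Fin m → ℝ) ∞
      (fun q : (Fin m → ℝ) × Model m => q.1) (θ, w) := contDiff_fst.contMDiff.contMDiffAt
  have hs : ContMDiffAt 𝓘(ℝ, (Fin m → ℝ) × Model m) 𝓘(ℝ, Model m) ∞
      (fun q : (Fin m → ℝ) × Model m => q.2) (θ, w) := contDiff_snd.contMDiff.contMDiffAt
  have h1 : ContMDiffAt 𝓘(ℝ, (Fin m → ℝ) × Model m) 𝓘(ℝ, Model m) ∞
      (fun q : (Fin m → ℝ) × Model m => (chartAt (Model m) x).symm q.2) (θ, w) :=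
    ((contMDiffOn_chart_symm (n := ∞) (x := x)).contMDiffAt
      ((chartAt (Model m) x).open_target.mem_nhds hw.1)).comp (θ, w) hs
  have h2 : ContMDiffAt 𝓘(ℝ, (Fin m → ℝ) × Model m) 𝓘(ℝ, Model m) ∞
      (fun q : (Fin m → ℝ) × Model m => expTorus q.1 • (chartAt (Model m) x).symm q.2) (θ, w) :=
    hact.smooth.contMDiffAt.comp (θ, w) (hf.prodMk h1)
  exact ((contMDiffOn_chart (n := ∞) (x := x)).contMDiffAt
    ((chartAt (Model m) x).open_source.mem_nhds hw.2)).comp (θ, w) h2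

lemma mem_actionDomain_zero (_ : IsToricAction m M) {x : M} {w : Model m}
    (hw : w ∈ (chartAt (Model m) x).target) :
    w ∈ actionDomain (expTorus (0 : Fin m → ℝ)) x x := by
  rw [expTorus_zero]
  exact mem_actionDomain_one hw ((chartAt (Model m) x).map_target hw)

lemma continuous_expTorus_smul (hact : IsToricAction m M) (p : M) :
    Continuous fun θ : Fin m → ℝ => expTorus θ • p :=
  hact.smooth.continuous.comp (continuous_id.prodMk continuous_const)

lemma eventually_mem_actionDomain (hact : IsToricAction m M) {x : M} {w : Model m}
    (hw : w ∈ (chartAt (Model m) x).target) :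
    ∀ᶠ θ : Fin m → ℝ in 𝓝 0, w ∈ actionDomain (expTorus θ) x x := by
  have h1 := (hact.continuous_expTorus_smul ((chartAt (Model m) x).symm w)).continuousAt
    (x := 0) |>.preimage_mem_nhds (t := (chartAt (Model m) x).source)
    ((chartAt (Model m) x).open_source.mem_nhds (hact.mem_actionDomain_zero hw).2)
  filter_upwards [h1] with θ hθ using ⟨hw, hθ⟩

lemma hasFDerivAt_generatorField (hact : IsToricAction m M) {x : M} {w : Model m}
    (hw : w ∈ (chartAt (Model m) x).target) :
    HasFDerivAt (fun θ => actionInCharts (expTorus θ) x x w) (generatorField x w) 0 := by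
  have h1 := (hact.contDiffAt_uncurry (hact.mem_actionDomain_zero hw)).differentiableAt (by simp)
  have h2 : DifferentiableAt ℝ (fun θ : Fin m → ℝ => (θ, w)) 0 := by fun_prop
  exact (DifferentiableAt.comp (0 : Fin m → ℝ) h1 h2).hasFDerivAt

lemma generator_eq (hact : IsToricAction m M) (k : Fin m) (p : M) :
    generator k p = generatorField p (chartAt (Model m) p p) (Pi.single k 1) := by
  have hp : p ∈ (chartAt (Model m) p).source := mem_chart_source _ p
  have h1 := hact.hasFDerivAt_generatorField ((chartAt (Model m) p).map_source hp)
  have h2 : HasDerivAt (fun t : ℝ => (Pi.single k t : Fin m → ℝ)) (Pi.single k 1) 0 := by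
    have := ((ContinuousLinearMap.single ℝ (fun _ : Fin m => ℝ) k).hasDerivAt (x := (0 : ℝ)))
    simpa using this
  have h3 := HasFDerivAt.comp_hasDerivAt (0 : ℝ) (f := fun t : ℝ => (Pi.single k t : Fin m → ℝ))
    (l := fun θ => actionInCharts (expTorus θ) p p (chartAt (Model m) p p))
    (by simpa using h1) h2
  rw [generator, ← h3.deriv]
  congr 1
  ext t : 1
  simp [actionInCharts, (chartAt (Model m) p).left_inv hp]

/-- The real derivative of the field in `w` is a mixed second derivative of the action. By symmetry
it is also the derivative in `θ` of the differentials of the maps `e^{iθ}`, which are complex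
linear; so it is complex linear itself. -/
lemma differentiableOn_generatorField (hact : IsToricAction m M) (x : M) (v : Fin m → ℝ) :
    DifferentiableOn ℂ (fun w => generatorField x w v) (chartAt (Model m) x).target := by
  intro w₀ hw₀
  set Ψ : (Fin m → ℝ) × Model m → Model m :=
    fun q => actionInCharts (expTorus q.1) x x q.2 with hΨ
  have hΨc : ContDiffAt ℝ ∞ Ψ (0, w₀) := hact.contDiffAt_uncurry (hact.mem_actionDomain_zero hw₀)
  have hΨ2 : ContDiffAt ℝ 2 Ψ (0, w₀) := hΨc.of_le ENat.LEInfty.out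
  have hd2 := differentiableAt_fderiv_of_contDiffAt hΨ2
  set T := fderiv ℝ (fderiv ℝ Ψ) (0, w₀) with hT
  have hfield : ∀ w ∈ (chartAt (Model m) x).target, generatorField x w v = fderiv ℝ Ψ (0, w) (v, 0) := by
    intro w hw
    have h1 := ((hact.contDiffAt_uncurry (hact.mem_actionDomain_zero hw)).differentiableAt
      (by simp)).hasFDerivAt
    have h2 : HasFDerivAt (fun θ : Fin m → ℝ => (θ, w))
      (ContinuousLinearMap.inl ℝ (Fin m → ℝ) (Model m)) 0 := hasFDerivAt_prodMk_left 0 w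
    have h3 := HasFDerivAt.comp (g := Ψ) (0 : Fin m → ℝ) h1 h2
    rw [← HasFDerivAt.unique h3 (hact.hasFDerivAt_generatorField hw)]
    rfl
  have hreal : HasFDerivAt (fun w => generatorField x w v)
      ((((ContinuousLinearMap.apply ℝ (Model m) ((v, 0) : (Fin m → ℝ) × Model m)).comp T).comp
        (ContinuousLinearMap.inr ℝ (Fin m → ℝ) (Model m)))) w₀ := by
    have h2 : HasFDerivAt (fun w : Model m => ((0 : Fin m → ℝ), w))
      (ContinuousLinearMap.inr ℝ (Fin m → ℝ) (Model m)) w₀ := hasFDerivAt_prodMk_right 0 w₀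
    have h3 := ((ContinuousLinearMap.apply ℝ (Model m)
      ((v, 0) : (Fin m → ℝ) × Model m)).hasFDerivAt.comp _ hd2.hasFDerivAt).comp w₀ h2
    refine h3.congr_of_eventuallyEq ?_
    filter_upwards [(chartAt (Model m) x).open_target.mem_nhds hw₀] with w hw using hfield w hw
  have hI : ∀ a : Model m, T (0, Complex.I • a) (v, 0) = Complex.I • T (0, a) (v, 0) := by
    intro a
    have hsymm : IsSymmSndFDerivAt ℝ Ψ (0, w₀) := hΨ2.isSymmSndFDerivAt (by simp)
    rw [hsymm.eq (0, Complex.I • a), hsymm.eq (0, a)]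
    have hcurve : HasDerivAt (fun s : ℝ => ((s • v, w₀) : (Fin m → ℝ) × Model m)) (v, 0) 0 := by
      have h1 : HasDerivAt (fun s : ℝ => s • v) v 0 := by
        simpa using (hasDerivAt_id (0 : ℝ)).smul_const v
      exact h1.prodMk (hasDerivAt_const _ _)
    have hk : ∀ a : Model m, HasDerivAt (fun s : ℝ => fderiv ℝ Ψ (s • v, w₀) (0, a))
        (T (v, 0) (0, a)) 0 := by
      intro a
      have h0 : HasFDerivAt (fderiv ℝ Ψ) T ((0 : ℝ) • v, w₀) := by
        rw [zero_smul]; exact hd2.hasFDerivAt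
      have h1 := h0.comp_hasDerivAt (0 : ℝ) hcurve
      exact (ContinuousLinearMap.apply ℝ (Model m)
        ((0, a) : (Fin m → ℝ) × Model m)).hasFDerivAt.comp_hasDerivAt (0 : ℝ) h1
    refine (hk (Complex.I • a)).unique (((hk a).const_smul Complex.I).congr_of_eventuallyEq ?_)
    have hsv : Tendsto (fun s : ℝ => s • v) (𝓝 0) (𝓝 0) := by
      have : Continuous fun s : ℝ => s • v := by fun_prop
      simpa using this.tendsto 0
    filter_upwards [hsv.eventually (hact.eventually_mem_actionDomain hw₀)] with s hs
    have h1 := ((hact.contDiffAt_uncurry hs).differentiableAt (by simp)).hasFDerivAt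
    have h2 : HasFDerivAt (fun w : Model m => (s • v, w))
      (ContinuousLinearMap.inr ℝ (Fin m → ℝ) (Model m)) w₀ := hasFDerivAt_prodMk_right (s • v) w₀
    have h3 := h1.comp w₀ h2
    have h4 := (((hact.contDiffOn_actionInCharts (expTorus (s • v)) x x).contDiffAt
      ((hact.isOpen_actionDomain _ x x).mem_nhds hs)).differentiableAt
        (by simp)).hasFDerivAt.restrictScalars ℝ
    have h5 := h3.unique h4
    have h6 : ∀ b : Model m, fderiv ℝ Ψ (s • v, w₀) (0, b) =
        fderiv ℂ (actionInCharts (expTorus (s • v)) x x) w₀ b := fun b => by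
      have := DFunLike.congr_fun h5 b
      simpa using this
    rw [Pi.smul_apply, h6, h6, map_smul]
  let T' : Model m →ₗ[ℂ] Model m :=
    { toFun := fun a => T (0, a) (v, 0)
      map_add' := fun a b => by
        rw [show ((0 : Fin m → ℝ), a + b) = (0, a) + (0, b) by simp, map_add]; rfl
      map_smul' := fun c a => by
        have hc : ((0 : Fin m → ℝ), c • a) = c.re • (0, a) + c.im • (0, Complex.I • a) := by
          ext j
          · simp
          · simp only [Prod.snd_add, Prod.smul_snd, Pi.add_apply, Pi.smul_apply, smul_eq_mul,
              Complex.real_smul]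
            conv_lhs => rw [← Complex.re_add_im c]
            ring
        rw [hc, map_add, map_smul, map_smul]
        simp only [FunLike.coe_add, FunLike.coe_smul, Pi.add_apply, Pi.smul_apply, hI]
        ext j
        simp only [Pi.add_apply, Pi.smul_apply, smul_eq_mul, Complex.real_smul, RingHom.id_apply]
        conv_rhs => rw [← Complex.re_add_im c]
        ring }
  exact (hasFDerivAt_of_restrictScalars ℝ (f' := T'.toContinuousLinearMap) hreal
    (by ext a; rfl)).differentiableAt.differentiableWithinAt

lemma differentiableOn_generatorDet (hact : IsToricAction m M) (x : M) :
    DifferentiableOn ℂ (generatorDet (m := m) x) (chartAt (Model m) x).target := by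
  have h1 : ∀ j k : Fin m, DifferentiableOn ℂ
      (fun w => generatorField x w (Pi.single k 1) j) (chartAt (Model m) x).target := fun j k =>
    differentiableOn_pi.1 (hact.differentiableOn_generatorField x (Pi.single k 1)) j
  have h2 : generatorDet (m := m) x = fun w => ∑ σ : Equiv.Perm (Fin m),
      ((Equiv.Perm.sign σ : ℤ) : ℂ) * ∏ i, generatorField x w (Pi.single i 1) (σ i) := by
    ext w
    rw [generatorDet, Matrix.det_apply']
    rfl
  rw [h2]
  refine DifferentiableOn.fun_sum fun σ _ => DifferentiableOn.const_mul ?_ _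
  exact fun w hw => (HasFDerivWithinAt.finsetProd
    fun i _ => (h1 (σ i) i w hw).hasFDerivWithinAt).differentiableWithinAt

end IsToricAction

lemma generatorField_injective {x : M} {w : Model m} (hD : generatorDet x w ≠ 0) :
    Function.Injective (generatorField x w) := by
  rw [injective_iff_map_eq_zero]
  intro v hv
  have h1 : (Matrix.of fun j k : Fin m => generatorField x w (Pi.single k 1) j).mulVec
      (fun k => (v k : ℂ)) = 0 := by
    rw [← hv, generatorField_apply x w v]
    ext j
    simp [Matrix.mulVec, dotProduct, mul_comm]
  have h2 := Matrix.eq_zero_of_mulVec_eq_zero hD h1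
  ext k
  have := congrFun h2 k
  simpa using this

/-- A nonzero determinant makes the generators a complex basis of the tangent space. -/
lemma clm_eq_of_generatorField {F : Type*} [NormedAddCommGroup F] [NormedSpace ℂ F]
    {x : M} {w : Model m} (hD : generatorDet x w ≠ 0) {S T : Model m →L[ℂ] F}
    (h : ∀ v, S (generatorField x w v) = T (generatorField x w v)) : S = T := by
  ext1 u
  set X := Matrix.of fun j k : Fin m => generatorField x w (Pi.single k 1) j with hX
  have hu : u = X.mulVec (X⁻¹.mulVec u) := by
    rw [Matrix.mulVec_mulVec, Matrix.mul_nonsing_inv _ (isUnit_iff_ne_zero.2 hD), Matrix.one_mulVec]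
  have hu2 : u = ∑ k, (X⁻¹.mulVec u) k • generatorField x w (Pi.single k 1) := by
    conv_lhs => rw [hu]
    ext j
    simp [Matrix.mulVec, dotProduct, hX, mul_comm]
  rw [hu2, map_sum, map_sum]
  exact Finset.sum_congr rfl fun k _ => by rw [map_smul, map_smul, h]

end Generators

/-! ## The open orbit in charts -/

section OpenOrbit

variable {m : ℕ} {M : Type*} [TopologicalSpace M] [ChartedSpace (Model m) M]
  [IsManifold 𝓘(ℂ, Model m) ω M] [MulAction (Torus m) M]

lemma eventually_expTorus_arg : ∀ᶠ t : Torus m in 𝓝 1,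
    expTorus (fun j => Complex.arg (t j : ℂ)) = t := by
  refine Eventually.of_forall fun t => ?_
  funext j
  simp [expTorus]

lemma tendsto_arg_nhds_one :
    Tendsto (fun t : Torus m => fun j => Complex.arg (t j : ℂ)) (𝓝 1) (𝓝 0) := by
  rw [tendsto_pi_nhds]
  intro j
  have h1 : ContinuousAt Complex.arg 1 := Complex.continuousAt_arg (by simp)
  have h2 : Tendsto (fun t : Torus m => (t j : ℂ)) (𝓝 1) (𝓝 1) := by
    have : Continuous fun t : Torus m => (t j : ℂ) := by fun_prop
    simpa using this.tendsto 1
  have h3 := h1.tendsto.comp h2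
  simpa [Function.comp_def] using h3

/-- The orbit map has injective differential at the identity, so the stabilizer is discrete. -/
lemma IsToricAction.eventually_smul_ne (hact : IsToricAction m M) {x : M} {w : Model m}
    (hw : w ∈ (chartAt (Model m) x).target) (hD : generatorDet x w ≠ 0) :
    ∀ᶠ t : Torus m in 𝓝 1, t • (chartAt (Model m) x).symm w = (chartAt (Model m) x).symm w →
      t = 1 := by
  have h1 := hact.hasFDerivAt_generatorField hw
  obtain ⟨K, hK, hanti⟩ := (generatorField x w).toLinearMap.exists_antilipschitzWith
    (LinearMap.ker_eq_bot.2 (generatorField_injective hD))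
  have h2 : ∀ᶠ θ in 𝓝[≠] (0 : Fin m → ℝ), actionInCharts (expTorus θ) x x w ≠ w :=
    h1.eventually_ne ⟨K, hanti⟩
  rw [eventually_nhdsWithin_iff] at h2
  filter_upwards [tendsto_arg_nhds_one.eventually h2, eventually_expTorus_arg] with t h3 h4 h5
  by_contra hne
  refine h3 (fun h0 => hne ?_) ?_
  · rw [← h4, h0, expTorus_zero]
  · rw [h4, actionInCharts, h5, (chartAt (Model m) x).right_inv hw]

/-- Since the torus is commutative, `t` maps the orbit curves through its fixed point to themselves;
its differential therefore fixes all generators, and these span. -/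
lemma IsToricAction.fderiv_actionInCharts_of_fixed (hact : IsToricAction m M) {x : M}
    {w : Model m} (hw : w ∈ (chartAt (Model m) x).target) (hD : generatorDet x w ≠ 0)
    {t : Torus m} (ht : t • (chartAt (Model m) x).symm w = (chartAt (Model m) x).symm w) :
    HasStrictFDerivAt (actionInCharts t x x) (ContinuousLinearMap.id ℂ (Model m)) w := by
  have hdom : w ∈ actionDomain t x x :=
    ⟨hw, by
      change t • (chartAt (Model m) x).symm w ∈ (chartAt (Model m) x).source
      rw [ht]; exact (chartAt (Model m) x).map_target hw⟩
  have h1 : ContDiffAt ℂ ω (actionInCharts t x x) w :=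
    (hact.contDiffOn_actionInCharts t x x).contDiffAt ((hact.isOpen_actionDomain t x x).mem_nhds hdom)
  have h2 := h1.hasStrictFDerivAt (by simp)
  have h3 : fderiv ℂ (actionInCharts t x x) w = ContinuousLinearMap.id ℂ (Model m) := by
    refine clm_eq_of_generatorField hD fun v => ?_
    have h4 := hact.hasFDerivAt_generatorField hw
    have h5 : actionInCharts (expTorus 0) x x w = w := by
      rw [expTorus_zero, actionInCharts_one hw]
    have h6 := HasFDerivAt.comp (g := actionInCharts t x x) (0 : Fin m → ℝ)
      (by rw [h5]; exact h2.hasFDerivAt.restrictScalars ℝ) h4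
    have h7 : (actionInCharts t x x ∘ fun θ => actionInCharts (expTorus θ) x x w) =ᶠ[𝓝 0]
        fun θ => actionInCharts (expTorus θ) x x w := by
      filter_upwards [hact.eventually_mem_actionDomain hw] with θ hθ
      rw [Function.comp, actionInCharts, chart_symm_actionInCharts hθ, smul_comm, ht]
      rfl
    have h8 := (h4.congr_of_eventuallyEq h7).unique h6
    have := DFunLike.congr_fun h8 v
    simpa using this.symm
  rwa [h3] at h2

/-- Where the generators are independent over `ℂ`, the torus acts freely. -/
theorem IsToricAction.mem_openOrbit (hact : IsToricAction m M)
    (hdense : Dense (openOrbit m M)) {x : M}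
    {w : Model m} (hw : w ∈ (chartAt (Model m) x).target) (hD : generatorDet x w ≠ 0) :
    (chartAt (Model m) x).symm w ∈ openOrbit m M := by
  intro t ht
  set c := chartAt (Model m) x with hc
  set p := c.symm w with hp
  have hps : p ∈ c.source := c.map_target hw
  have hfix : ∀ i : ℕ, t ^ i • p = p := by
    intro i
    induction i with
    | zero => simp
    | succ i ih => rw [pow_succ, mul_smul, ht, ih]
  -- In a compact group the powers of `t` accumulate at `1`; all of them fix `p`, whose stabilizer
  -- is discrete, so `t` has finite order.
  obtain ⟨n, hn1, hn⟩ : ∃ n : ℕ, 1 ≤ n ∧ t ^ n = 1 := by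
    have h1 := (mapClusterPt_one_atTop_pow t).frequently (hact.eventually_smul_ne hw hD)
    obtain ⟨n, hn, hn1⟩ := (h1.and_eventually (eventually_ge_atTop 1)).exists
    exact ⟨n, hn1, hn (hfix n)⟩
  -- The chart averaged over the cyclic group of `t` is `t`-invariant and has the identity as
  -- derivative at `p`, so it is injective near `p`. Hence `t` fixes a neighbourhood of `p`, which
  -- contains a point with a free orbit.
  set G : M → Model m := fun q => (n : ℂ)⁻¹ • ∑ i ∈ Finset.range n, c (t ^ i • q) with hG
  have hGt : ∀ q, G (t • q) = G q := by
    intro q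
    simp only [hG]
    congr 1
    have h1 := Finset.sum_range_succ' (fun i => c (t ^ i • q)) n
    rw [Finset.sum_range_succ, hn, pow_zero] at h1
    rw [← add_right_cancel h1.symm]
    exact Finset.sum_congr rfl fun i _ => by rw [pow_succ, mul_smul]
  have hn0 : (n : ℂ) ≠ 0 := by exact_mod_cast (by lia : n ≠ 0)
  have hGd : HasStrictFDerivAt (fun q => G (c.symm q))
      ((ContinuousLinearEquiv.refl ℂ (Model m) : Model m ≃L[ℂ] Model m) : Model m →L[ℂ] Model m)
      w := by
    have h1 := (HasStrictFDerivAt.fun_sum fun i (_ : i ∈ Finset.range n) =>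
      hact.fderiv_actionInCharts_of_fixed hw hD (hfix i)).const_smul (n : ℂ)⁻¹
    refine h1.congr_fderiv ?_
    ext1 u
    simp [hn0, ← Nat.cast_smul_eq_nsmul ℂ]
  have hinj := hGd.eventually_left_inverse
  have hct : ContinuousAt (fun q : M => t • q) p := (hact.continuous_smul t).continuousAt
  have hcp : ContinuousAt c p := c.continuousAt hps
  have hcw : c p = w := c.right_inv hw
  have e1 : ∀ᶠ q in 𝓝 p, q ∈ c.source := c.open_source.mem_nhds hps
  have e2 : ∀ᶠ q in 𝓝 p, t • q ∈ c.source := by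
    exact hct.eventually (by simpa only [ht] using e1)
  have e3 := hcp.eventually (by rw [hcw]; exact hinj)
  have e4 : ∀ᶠ q in 𝓝 p, _ := hct.eventually (by simpa only [ht] using e3)
  obtain ⟨q, hq, h1, h2, h3, h4⟩ := hdense.inter_nhds_nonempty (e1.and (e2.and (e3.and e4)))
  refine hq t ?_
  rw [c.left_inv h1] at h3
  rw [c.left_inv h2, hGt, h3] at h4
  exact c.injOn h2 h1 h4.symm

end OpenOrbit

/-! ### The complement of the open orbit as the zero set of a holomorphic determinant -/

section Thin

variable {m : ℕ} {M : Type*} [TopologicalSpace M] [ChartedSpace (Model m) M]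
  [IsManifold 𝓘(ℂ, Model m) ω M] [MulAction (Torus m) M]
  {L : M → Type*} [TopologicalSpace (TotalSpace ℂ L)] [∀ p, AddCommGroup (L p)]
  [∀ p, Module ℂ (L p)] [∀ p, TopologicalSpace (L p)] [FiberBundle ℂ L]
  {h : HermitianMetric L m} {A : ToricLift h} {μ : M → Fin m → ℝ}

lemma smul_mem_openOrbit {p : M} (hp : p ∈ openOrbit m M) (t : Torus m) :
    t • p ∈ openOrbit m M := fun s hs => hp s <| by
  rw [smul_comm] at hs
  exact (MulAction.injective t) hs

lemma LogCoordinates.z_ne_zero (C : LogCoordinates h A μ) {p : M} (hp : p ∈ openOrbit m M)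
    (j : Fin m) : C.z p j ≠ 0 := by
  have : C.z p ∈ C.z '' openOrbit m M := mem_image_of_mem _ hp
  rw [C.image_z] at this
  exact this.1 j

lemma LogCoordinates.rho_mem (C : LogCoordinates h A μ) {p : M} (hp : p ∈ openOrbit m M) :
    C.rho p ∈ C.Ω := by
  have : C.z p ∈ C.z '' openOrbit m M := mem_image_of_mem _ hp
  rw [C.image_z] at this
  exact this.2

/-- This is the equivariance `z(e^{isv} p) = e^{isv} z(p)` differentiated at `s = 0`. -/
lemma LogCoordinates.fderiv_z_generatorField (C : LogCoordinates h A μ) (hact : IsToricAction m M)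
    {x : M} {w : Model m} (hw : w ∈ (chartAt (Model m) x).target)
    (hM : (chartAt (Model m) x).symm w ∈ openOrbit m M) (v : Fin m → ℝ) :
    fderiv ℂ (fun u => C.z ((chartAt (Model m) x).symm u)) w (generatorField x w v) =
      fun j => Complex.I * v j * C.z ((chartAt (Model m) x).symm w) j := by
  set Z : Model m → Model m := fun u => C.z ((chartAt (Model m) x).symm u) with hZ
  have h1 : ContDiffAt ℂ ω Z w := (contDiffOn_comp_chart_symm C.holomorphic_z x).contDiffAt
    ((isOpen_chart_preimage x C.isOpen_orbit).mem_nhds ⟨hw, hM⟩)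
  have h4 := hact.hasFDerivAt_generatorField hw
  have h5 : actionInCharts (expTorus 0) x x w = w := by rw [expTorus_zero, actionInCharts_one hw]
  have h6 := HasFDerivAt.comp (g := Z) (0 : Fin m → ℝ)
    (by rw [h5]; exact (h1.differentiableAt (by simp)).hasFDerivAt.restrictScalars ℝ) h4
  ext j
  have h7 := (hasFDerivAt_pi'.1 h6 j)
  have h8 : HasDerivAt (fun s : ℝ => s • v) v 0 := by
    simpa using (hasDerivAt_id (0 : ℝ)).smul_const v
  have h9 := HasFDerivAt.comp_hasDerivAt (0 : ℝ) (f := fun s : ℝ => s • v)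
    (by simpa only [zero_smul] using h7) h8
  have h10 : HasDerivAt (fun s : ℝ => Complex.exp ((s : ℂ) * (v j * Complex.I)) *
      C.z ((chartAt (Model m) x).symm w) j) (Complex.I * v j *
        C.z ((chartAt (Model m) x).symm w) j) 0 := by
    have := (((Complex.ofRealCLM.hasDerivAt (x := (0 : ℝ))).mul_const
      ((v j : ℂ) * Complex.I)).cexp).mul_const (C.z ((chartAt (Model m) x).symm w) j)
    simpa [mul_comm] using this
  refine h9.unique (h10.congr_of_eventuallyEq ?_)
  have hsv : Tendsto (fun s : ℝ => s • v) (𝓝 0) (𝓝 0) := by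
    have : Continuous fun s : ℝ => s • v := by fun_prop
    simpa using this.tendsto 0
  filter_upwards [hsv.eventually (hact.eventually_mem_actionDomain hw)] with s hs
  simp only [Function.comp, hZ]
  rw [chart_symm_actionInCharts hs, C.equivariant_z _ _ hM]
  simp [expTorus, Circle.coe_exp, mul_assoc]

/-- The open orbit is where the generators are independent over `ℂ`. -/
theorem LogCoordinates.generatorDet_ne_zero_iff (C : LogCoordinates h A μ)
    (hact : IsToricAction m M) {x : M} {w : Model m} (hw : w ∈ (chartAt (Model m) x).target) :
    generatorDet x w ≠ 0 ↔ (chartAt (Model m) x).symm w ∈ openOrbit m M := by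
  refine ⟨hact.mem_openOrbit C.dense_orbit hw, fun hM h0 => ?_⟩
  obtain ⟨u, hu, hu0⟩ := Matrix.exists_mulVec_eq_zero_iff.2 h0
  apply hu
  have h1 : ∑ k, u k • generatorField x w (Pi.single k 1) = 0 := by
    rw [← hu0]
    ext j
    simp [Matrix.mulVec, dotProduct, mul_comm]
  -- Applying `dz` turns a complex relation `∑ u_k X_k = 0` into `i u_j z_j = 0` for each `j`, and
  -- `z_j ≠ 0` on the open orbit.
  have h2 := congrArg (fderiv ℂ (fun u => C.z ((chartAt (Model m) x).symm u)) w) h1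
  rw [map_sum, map_zero] at h2
  ext j
  have h3 := congrFun h2 j
  simp only [map_smul, C.fderiv_z_generatorField hact hw hM, Finset.sum_apply, Pi.smul_apply,
    smul_eq_mul, Pi.zero_apply] at h3
  rw [Finset.sum_eq_single j] at h3
  · simpa [C.z_ne_zero hM j] using h3
  · intro k _ hk
    simp [hk.symm]
  · simp

end Thin

/-! ## Zero sets of holomorphic functions -/

section ThinSets

variable {E : Type*} [NormedAddCommGroup E] [NormedSpace ℂ E]

/-- Near a point of `W` there are discs, in a fixed direction, whose boundary circles avoid the zeros
of `D`. -/
theorem exists_disc_ne_zero {W : Set E} (hW : IsOpen W) {D : E → ℂ} (hD : DifferentiableOn ℂ D W)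
    {w₀ : E} (hw₀ : w₀ ∈ W) (hne : ∃ᶠ u in 𝓝 w₀, D u ≠ 0) :
    ∃ (v : E) (r : ℝ) (U : Set E), 0 < r ∧ r < 1 ∧ IsOpen U ∧ w₀ ∈ U ∧
      (∀ u ∈ U, ∀ ζ ∈ Metric.ball (0 : ℂ) 1, u + ζ • v ∈ W) ∧
      ∀ u ∈ U, ∀ ζ ∈ Metric.sphere (0 : ℂ) r, D (u + ζ • v) ≠ 0 := by
  obtain ⟨ε, hε, hεW⟩ := Metric.isOpen_iff.1 hW w₀ hw₀
  obtain ⟨p, hp, hpb⟩ := (hne.and_eventually (Metric.ball_mem_nhds w₀ (half_pos hε))).exists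
  -- The direction points to some `p` with `D p ≠ 0`, reached at `ζ = 1`, so `D` is not identically
  -- zero on the line through `w₀` and its zero at `ζ = 0`, if any, is isolated.
  set v := p - w₀ with hv
  have hvn : ‖v‖ < ε / 2 := by rwa [dist_eq_norm] at hpb
  have hmem : ∀ u ∈ Metric.ball w₀ (ε / 2), ∀ ζ ∈ Metric.ball (0 : ℂ) 1, u + ζ • v ∈ W := by
    intro u hu ζ hζ
    apply hεW
    rw [Metric.mem_ball, dist_eq_norm] at hu ⊢
    rw [mem_ball_zero_iff] at hζ
    calc ‖u + ζ • v - w₀‖ = ‖(u - w₀) + ζ • v‖ := by congr 1; abel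
      _ ≤ ‖u - w₀‖ + ‖ζ‖ * ‖v‖ := (norm_add_le _ _).trans (by rw [norm_smul])
      _ < ε / 2 + ε / 2 := by nlinarith [norm_nonneg ζ, norm_nonneg v]
      _ = ε := add_halves ε
  have hg : DifferentiableOn ℂ (fun ζ : ℂ => D (w₀ + ζ • v)) (Metric.ball 0 2) := by
    refine hD.comp (by fun_prop) fun ζ hζ => hεW ?_
    rw [Metric.mem_ball, dist_eq_norm, add_sub_cancel_left, norm_smul]
    rw [mem_ball_zero_iff] at hζ
    nlinarith [norm_nonneg ζ, norm_nonneg v]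
  have hga := hg.analyticOnNhd Metric.isOpen_ball
  have hpunct : ∀ᶠ ζ in 𝓝[≠] (0 : ℂ), D (w₀ + ζ • v) ≠ 0 := by
    rcases (hga 0 (by simp)).eventually_eq_zero_or_eventually_ne_zero with h0 | h0
    · have := hga.eqOn_zero_of_preconnected_of_eventuallyEq_zero
        (convex_ball _ _).isPreconnected (by simp) h0 (show (1 : ℂ) ∈ Metric.ball 0 2 by simp)
      simp only [one_smul, hv, add_sub_cancel, Pi.zero_apply] at this
      exact absurd this hp
    · exact h0
  rw [eventually_nhdsWithin_iff, Metric.eventually_nhds_iff] at hpunct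
  obtain ⟨δ, hδ, hδ'⟩ := hpunct
  set r := min (δ / 2) (1 / 2) with hr
  have hr0 : 0 < r := by positivity
  have hr1 : r < 1 := (min_le_right _ _).trans_lt (by norm_num)
  have hrδ : r < δ := (min_le_left _ _).trans_lt (by linarith)
  have hW2 : Metric.ball w₀ (ε / 2) ∈ 𝓝 w₀ := Metric.ball_mem_nhds _ (half_pos hε)
  -- The circle through `w₀` avoids the zeros of `D`; by its compactness so do the parallel circles
  -- around nearby `u`.
  have hcirc : ∀ᶠ u in 𝓝 w₀, ∀ ζ ∈ Metric.sphere (0 : ℂ) r, D (u + ζ • v) ≠ 0 := by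
    refine (isCompact_sphere (0 : ℂ) r).eventually_forall_of_forall_eventually fun ζ hζ => ?_
    rw [mem_sphere_zero_iff_norm] at hζ
    have h1 : w₀ + ζ • v ∈ W :=
      hmem w₀ (Metric.mem_ball_self (half_pos hε)) ζ (by rw [mem_ball_zero_iff, hζ]; exact hr1)
    have h2 : D (w₀ + ζ • v) ≠ 0 := hδ' (by rw [dist_zero_right, hζ]; exact hrδ)
      (fun h => by simp only [mem_singleton_iff] at h; rw [h, norm_zero] at hζ; exact hr0.ne hζ)
    have h3 : ContinuousAt (fun q : E × ℂ => D (q.1 + q.2 • v)) (w₀, ζ) :=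
      ContinuousAt.comp (g := D) (f := fun q : E × ℂ => q.1 + q.2 • v)
        ((hD _ h1).differentiableAt (hW.mem_nhds h1)).continuousAt (by fun_prop)
    exact h3.eventually_ne h2
  obtain ⟨U, hU, hUo, hw⟩ := mem_nhds_iff.1 (inter_mem hW2 hcirc)
  exact ⟨v, r, U, hr0, hr1, hUo, hw, fun u hu => hmem u (hU hu).1, fun u hu => (hU hu).2⟩

section

variable {W : Set E} {D : E → ℂ} {v : E} {r : ℝ} {u : E}

lemma circleAverage_eq_of_disc (hW : IsOpen W) (hD : DifferentiableOn ℂ D W) (hr : 0 < r)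
    (hr1 : r < 1) (hu : ∀ ζ ∈ Metric.ball (0 : ℂ) 1, u + ζ • v ∈ W)
    (hc : ∀ ζ ∈ Metric.sphere (0 : ℂ) r, D (u + ζ • v) ≠ 0) (hu0 : D u ≠ 0) {f : E → ℂ}
    (hf : DifferentiableOn ℂ f (W ∩ {u | D u ≠ 0})) {C : ℝ}
    (hC : ∀ u ∈ W, D u ≠ 0 → ‖f u‖ ≤ C) :
    Real.circleAverage (fun ζ => f (u + ζ • v)) 0 r = f u := by
  have hWD : IsOpen (W ∩ {u | D u ≠ 0}) :=
    hD.continuousOn.isOpen_inter_preimage hW isOpen_ne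
  have h1 := circleAverage_of_bounded_off_zeros (D := fun ζ : ℂ => D (u + ζ • v))
    (f := fun ζ => f (u + ζ • v)) Metric.isOpen_ball
    (convex_ball (0 : ℂ) 1).isPreconnected hr (Metric.closedBall_subset_ball hr1)
    (hD.comp (by fun_prop) hu) (by simpa using hu0) hc
    (fun ζ hζ hζ0 => by
      have : DifferentiableAt ℂ f (u + ζ • v) :=
        (hf _ ⟨hu ζ hζ, hζ0⟩).differentiableAt (hWD.mem_nhds ⟨hu ζ hζ, hζ0⟩)
      exact DifferentiableAt.comp (g := f) (f := fun ζ : ℂ => u + ζ • v) ζ this (by fun_prop))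
    (fun ζ hζ hζ0 => hC _ (hu ζ hζ) hζ0)
  simpa using h1

end

lemma norm_circleAverage_le {f : ℂ → ℂ} {r C : ℝ} (hr : 0 < r)
    (h : ∀ ζ ∈ Metric.sphere (0 : ℂ) r, ‖f ζ‖ ≤ C) : ‖Real.circleAverage f 0 r‖ ≤ C := by
  have hpi : (0 : ℝ) < 2 * Real.pi := by positivity
  rw [Real.circleAverage_def, norm_smul, norm_inv, Real.norm_of_nonneg hpi.le,
    inv_mul_le_iff₀ hpi]
  have := intervalIntegral.norm_integral_le_of_norm_le_const (a := 0) (b := 2 * Real.pi)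
    (f := fun θ => f (circleMap 0 r θ)) (C := C)
    (fun θ _ => h _ (circleMap_mem_sphere 0 hr.le θ))
  rwa [sub_zero, abs_of_pos hpi, mul_comm C] at this

/-- Bounded holomorphic functions extend across the zeros of `D`. -/
theorem exists_holomorphic_extension [FiniteDimensional ℂ E] {W : Set E} (hW : IsOpen W)
    {D : E → ℂ} (hD : DifferentiableOn ℂ D W)
    {w₀ : E} (hw₀ : w₀ ∈ W) (hne : ∃ᶠ u in 𝓝 w₀, D u ≠ 0) {f : E → ℂ}
    (hf : DifferentiableOn ℂ f (W ∩ {u | D u ≠ 0})) {C : ℝ}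
    (hC : ∀ u ∈ W, D u ≠ 0 → ‖f u‖ ≤ C) :
    ∃ F : E → ℂ, ∃ U, IsOpen U ∧ w₀ ∈ U ∧ U ⊆ W ∧ DifferentiableOn ℂ F U ∧
      ∀ u ∈ U, D u ≠ 0 → F u = f u := by
  obtain ⟨v, r, U, hr, hr1, hU, hw, hUW, hcirc⟩ := exists_disc_ne_zero hW hD hw₀ hne
  have hWD : IsOpen (W ∩ {u | D u ≠ 0}) :=
    hD.continuousOn.isOpen_inter_preimage hW isOpen_ne
  have hmem : ∀ u ∈ U, ∀ θ : ℝ, u + circleMap 0 r θ • v ∈ W ∩ {u | D u ≠ 0} := fun u hu θ =>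
    ⟨hUW u hu _ (Metric.sphere_subset_ball hr1 (circleMap_mem_sphere 0 hr.le θ)),
      hcirc u hu _ (circleMap_mem_sphere 0 hr.le θ)⟩
  -- The average only involves circles on which `f` is holomorphic, so it is holomorphic in the
  -- centre `u` even where `D u = 0`; the mean value property identifies it with `f` elsewhere.
  refine ⟨fun u => Real.circleAverage (fun ζ => f (u + ζ • v)) 0 r, U, hU, hw,
    fun u hu => by simpa using hUW u hu 0 (by simp), ?_,
    fun u hu hu0 => circleAverage_eq_of_disc hW hD hr hr1 (hUW u hu) (hcirc u hu) hu0 hf hC⟩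
  have h1 : DifferentiableOn ℂ
      (fun u => ∫ θ in Icc 0 (2 * Real.pi), f (u + circleMap 0 r θ • v)) U := by
    refine differentiableOn_integral_param (F := fun (θ : ℝ) u => f (u + circleMap 0 r θ • v))
      isCompact_Icc measurableSet_Icc hU ?_ ?_
    · refine hf.continuousOn.comp (Continuous.continuousOn ?_) fun q hq => hmem q.2 hq.2 q.1
      have := continuous_circleMap 0 r
      fun_prop
    · exact fun θ _ => hf.comp (by fun_prop) fun u hu => hmem u hu θ
  have h2 : (fun u => Real.circleAverage (fun ζ => f (u + ζ • v)) 0 r) = fun u =>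
      (2 * Real.pi)⁻¹ • ∫ θ in Icc 0 (2 * Real.pi), f (u + circleMap 0 r θ • v) := by
    ext u
    rw [Real.circleAverage_def, intervalIntegral.integral_of_le (by positivity),
      integral_Icc_eq_integral_Ioc]
  rw [h2]
  exact h1.fun_const_smul ((2 * Real.pi)⁻¹ : ℝ)

/-- Locally, by Fubini in the direction `v` of `exists_disc_ne_zero`, it is enough that each real
line parallel to `v` meets the zero set in a null set. Each zero on such a line is isolated, since
`D` does not vanish on the boundary circle of the complex disc around it, and a discrete subset of
the line is countable. -/
theorem volume_zeros_eq_zero {m : ℕ} {W : Set (Model m)} (hW : IsOpen W) {D : Model m → ℂ}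
    (hD : DifferentiableOn ℂ D W) (hne : ∀ w ∈ W, ∃ᶠ u in 𝓝 w, D u ≠ 0) :
    volume (W ∩ {u | D u = 0}) = 0 := by
  refine measure_null_of_locally_null _ fun w hw => ?_
  obtain ⟨v, r, U, hr, hr1, hU, hwU, hUW, hcirc⟩ := exists_disc_ne_zero hW hD hw.1 (hne w hw.1)
  refine ⟨U ∩ (W ∩ {u | D u = 0}), inter_mem (nhdsWithin_le_nhds (hU.mem_nhds hwU))
    self_mem_nhdsWithin, ?_⟩
  have hmeas : MeasurableSet (U ∩ (W ∩ {u | D u = 0})) := by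
    have h1 : U ∩ (W ∩ {u | D u = 0}) = U ∩ (W \ (W ∩ {u | D u ≠ 0})) := by
      ext u; simp only [mem_inter_iff, mem_ofPred_eq, Set.mem_sdiff]; tauto
    rw [h1]
    exact hU.measurableSet.inter (hW.measurableSet.diff
      (hD.continuousOn.isOpen_inter_preimage hW isOpen_ne).measurableSet)
  have h2 := ae_mem_of_ae_add_linearMap_mem ((LinearMap.id : ℝ →ₗ[ℝ] ℝ).smulRight v)
    volume volume hmeas.compl (fun y => ?_)
  · rw [ae_iff] at h2
    simpa only [mem_compl_iff, not_not, ofPred_mem_eq] using h2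
  set S : Set ℝ := {s | y + s • v ∈ U ∩ (W ∩ {u | D u = 0})} with hS
  suffices hc : S.Countable by
    have := hc.ae_notMem volume
    filter_upwards [this] with s hs using hs
  have hpunct : ∀ s ∈ S, ∀ᶠ s' in 𝓝[≠] s, s' ∉ S := by
    intro s hs
    set u := y + s • v with hu
    have hg : DifferentiableOn ℂ (fun ζ : ℂ => D (u + ζ • v)) (Metric.ball 0 1) :=
      hD.comp (by fun_prop) (hUW u hs.1)
    have hga := hg.analyticOnNhd Metric.isOpen_ball
    have hp : ∀ᶠ ζ in 𝓝[≠] (0 : ℂ), D (u + ζ • v) ≠ 0 := by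
      rcases (hga 0 (by simp)).eventually_eq_zero_or_eventually_ne_zero with h0 | h0
      · have hrs : (r : ℂ) ∈ Metric.sphere (0 : ℂ) r := by simp [abs_of_pos hr]
        exact absurd (hga.eqOn_zero_of_preconnected_of_eventuallyEq_zero
          (convex_ball _ _).isPreconnected (by simp) h0 (Metric.sphere_subset_ball hr1 hrs))
          (hcirc u hs.1 _ hrs)
      · exact h0
    have ht : Tendsto (fun s' : ℝ => ((s' - s : ℝ) : ℂ)) (𝓝[≠] s) (𝓝[≠] 0) := by
      refine tendsto_nhdsWithin_iff.2 ⟨?_, ?_⟩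
      · have : Continuous fun s' : ℝ => ((s' - s : ℝ) : ℂ) := by fun_prop
        simpa using (this.tendsto s).mono_left nhdsWithin_le_nhds
      · filter_upwards [self_mem_nhdsWithin] with s' hs'
        simpa [sub_eq_zero] using hs'
    filter_upwards [ht.eventually hp] with s' hs' hs''
    apply hs'
    have h3 : u + ((s' - s : ℝ) : ℂ) • v = y + s' • v := by
      rw [hu, Complex.coe_smul, sub_smul]; abel
    rw [h3]
    exact hs''.2.2
  have : IsDiscrete S := by
    rw [isDiscrete_iff_nhdsNE]
    intro s hs
    rw [← disjoint_iff, disjoint_principal_right]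
    exact hpunct s hs
  exact (HereditarilyLindelofSpace.isLindelof S).countable_of_isDiscrete this

end ThinSets

/-! ## Logarithmic coordinates -/

section LogCoordinates

variable {m : ℕ} {M : Type*} [TopologicalSpace M] [ChartedSpace (Model m) M]
  [IsManifold 𝓘(ℂ, Model m) ω M] [MulAction (Torus m) M]
  {L : M → Type*} [TopologicalSpace (TotalSpace ℂ L)] [∀ p, AddCommGroup (L p)]
  [∀ p, Module ℂ (L p)] [∀ p, TopologicalSpace (L p)] [FiberBundle ℂ L]
  {h : HermitianMetric L m} {A : ToricLift h} {μ : M → Fin m → ℝ}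

namespace LogCoordinates

lemma frequently_generatorDet_ne_zero (C : LogCoordinates h A μ) (hact : IsToricAction m M)
    {x : M} {w : Model m} (hw : w ∈ (chartAt (Model m) x).target) :
    ∃ᶠ u in 𝓝 w, generatorDet x u ≠ 0 := by
  set c := chartAt (Model m) x
  have h1 : ∃ᶠ p in 𝓝 (c.symm w), p ∈ openOrbit m M :=
    mem_closure_iff_frequently.1 (C.dense_orbit _)
  have h2 := (h1.and_eventually (c.open_source.mem_nhds (c.map_target hw)))
  have h3 : Tendsto c (𝓝 (c.symm w)) (𝓝 w) := by
    have := (c.continuousAt (c.map_target hw)).tendsto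
    rwa [c.right_inv hw] at this
  refine h3.frequently (h2.mono fun p hp => ?_)
  exact (C.generatorDet_ne_zero_iff hact (c.map_source hp.2)).2 (by rw [c.left_inv hp.2]; exact hp.1)

/-- The tube domain `{ζ | 2 Re ζ ∈ Ω}` of the logarithm of `z`. -/
def tube (C : LogCoordinates h A μ) : Set (Model m) := {ζ | (fun j => 2 * (ζ j).re) ∈ C.Ω}

variable [Nonempty M]

/-- The point of the open orbit with `z = e^ζ`. -/
def point (C : LogCoordinates h A μ) (ζ : Model m) : M :=
  Function.invFunOn C.z (openOrbit m M) fun j => Complex.exp (ζ j)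

variable (C : LogCoordinates h A μ)

lemma isOpen_tube : IsOpen C.tube :=
  C.isOpen_Ω.preimage (f := fun ζ : Model m => fun j => 2 * (ζ j).re) (by fun_prop)

lemma convex_tube : Convex ℝ C.tube := by
  intro a ha b hb s t hs ht hst
  have := C.convex_Ω ha hb hs ht hst
  simp only [tube, mem_ofPred_eq]
  convert this using 1
  ext j
  simp
  ring

lemma log_norm_exp (ζ : ℂ) : Real.log (‖Complex.exp ζ‖ ^ 2) = 2 * ζ.re := by
  rw [Real.log_pow, Complex.norm_exp, Real.log_exp]; norm_num

lemma exp_mem_image {ζ : Model m} (hζ : ζ ∈ C.tube) :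
    (fun j => Complex.exp (ζ j)) ∈ C.z '' openOrbit m M := by
  rw [C.image_z]
  refine ⟨fun j => Complex.exp_ne_zero _, ?_⟩
  simp only [log_norm_exp]
  exact hζ

lemma point_mem {ζ : Model m} (hζ : ζ ∈ C.tube) : C.point ζ ∈ openOrbit m M :=
  Function.invFunOn_mem (C.exp_mem_image hζ)

lemma z_point {ζ : Model m} (hζ : ζ ∈ C.tube) : C.z (C.point ζ) = fun j => Complex.exp (ζ j) :=
  Function.invFunOn_eq (C.exp_mem_image hζ)

lemma point_eq {ζ : Model m} {p : M} (hp : p ∈ openOrbit m M)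
    (hz : C.z p = fun j => Complex.exp (ζ j)) : C.point ζ = p := by
  have h1 : (fun j => Complex.exp (ζ j)) ∈ C.z '' openOrbit m M := ⟨p, hp, hz⟩
  exact C.injOn_z (Function.invFunOn_mem h1) hp ((Function.invFunOn_eq h1).trans hz.symm)

lemma rho_point {ζ : Model m} (hζ : ζ ∈ C.tube) : C.rho (C.point ζ) = fun j => 2 * (ζ j).re := by
  ext j
  rw [rho, C.z_point hζ, log_norm_exp]

lemma exists_point_eq {p : M} (hp : p ∈ openOrbit m M) : ∃ ζ ∈ C.tube, C.point ζ = p := by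
  have h1 : C.z p = fun j => Complex.exp (Complex.log (C.z p j)) :=
    funext fun j => (Complex.exp_log (C.z_ne_zero hp j)).symm
  refine ⟨fun j => Complex.log (C.z p j), ?_, C.point_eq hp h1⟩
  have h2 := C.rho_mem hp
  simp only [tube, mem_ofPred_eq]
  convert h2 using 1
  ext j
  rw [rho, ← log_norm_exp, Complex.exp_log (C.z_ne_zero hp j)]

lemma add_I_mem_tube {ζ : Model m} (hζ : ζ ∈ C.tube) (θ : Fin m → ℝ) :
    (fun j => ζ j + Complex.I * θ j) ∈ C.tube := by
  simpa [tube] using hζ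

lemma point_add_I {ζ : Model m} (hζ : ζ ∈ C.tube) (θ : Fin m → ℝ) :
    C.point (fun j => ζ j + Complex.I * θ j) = expTorus θ • C.point ζ := by
  refine C.point_eq (smul_mem_openOrbit (C.point_mem hζ) _) ?_
  ext j
  rw [C.equivariant_z _ _ (C.point_mem hζ), C.z_point hζ, Complex.exp_add, mul_comm,
    mul_comm Complex.I]
  rfl

/-- The map `ζ ↦ point ζ` is holomorphic. -/
theorem contDiffAt_point (hact : IsToricAction m M) {ζ : Model m} (hζ : ζ ∈ C.tube) {x : M}
    (hx : C.point ζ ∈ (chartAt (Model m) x).source) :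
    ContDiffAt ℂ ω (fun ζ => chartAt (Model m) x (C.point ζ)) ζ ∧ ContinuousAt C.point ζ := by
  set c := chartAt (Model m) x with hc
  set w := c (C.point ζ) with hw
  have hwt : w ∈ c.target := c.map_source hx
  have hcw : c.symm w = C.point ζ := c.left_inv hx
  have hM : c.symm w ∈ openOrbit m M := by rw [hcw]; exact C.point_mem hζ
  set Z : Model m → Model m := fun u => C.z (c.symm u) with hZ
  have hZw : Z w = fun j => Complex.exp (ζ j) := by rw [hZ]; simp only [hcw]; exact C.z_point hζ
  have hdom := (isOpen_chart_preimage x C.isOpen_orbit).mem_nhds ⟨hwt, hM⟩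
  have h1 : ContDiffAt ℂ ω Z w :=
    (contDiffOn_comp_chart_symm C.holomorphic_z x).contDiffAt hdom
  have hfd : ∀ v, fderiv ℂ Z w (generatorField x w v) =
      fun j => Complex.I * v j * C.z (c.symm w) j := C.fderiv_z_generatorField hact hwt hM
  -- `dz` sends `X_k` to `i z_k` times the `k`-th basis vector, so it is invertible; `point` is then
  -- the local inverse of `z` composed with the exponential.
  have hsurj : Function.Surjective (fderiv ℂ Z w) := by
    intro y
    refine ⟨∑ k, (y k / (Complex.I * C.z (c.symm w) k)) • generatorField x w (Pi.single k 1), ?_⟩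
    ext j
    simp only [map_sum, map_smul, hfd, Finset.sum_apply, Pi.smul_apply, smul_eq_mul]
    rw [Finset.sum_eq_single j]
    · have := C.z_ne_zero hM j
      simp only [Pi.single_eq_same, Complex.ofReal_one, mul_one]
      rw [div_mul_cancel₀]
      exact mul_ne_zero Complex.I_ne_zero this
    · intro k _ hk
      simp [Pi.single_eq_of_ne' hk]
    · simp
  let Φ : Model m ≃L[ℂ] Model m := ContinuousLinearEquiv.ofBijective (fderiv ℂ Z w)
    (LinearMap.ker_eq_bot.2 (LinearMap.injective_iff_surjective.2 hsurj))
    (LinearMap.range_eq_top.2 hsurj)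
  have hΦ : HasFDerivAt Z (Φ : Model m →L[ℂ] Model m) w :=
    (h1.differentiableAt (by simp)).hasFDerivAt
  have hs := h1.hasStrictFDerivAt' hΦ (by simp)
  set g := h1.localInverse hΦ (by simp) with hg
  have hgc : ContDiffAt ℂ ω g (Z w) := h1.to_localInverse hΦ (by simp)
  have hgw : g (Z w) = w := h1.localInverse_apply_image hΦ (by simp)
  have hexp : ContDiffAt ℂ ω (fun ζ : Model m => fun j => Complex.exp (ζ j)) ζ := by
    refine contDiffAt_pi.2 fun j => ?_
    exact (contDiffAt_apply ℂ ℂ j ζ).cexp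
  rw [hZw] at hgc hgw
  have hcomp := ContDiffAt.comp (g := g) ζ hgc hexp
  have htend : Tendsto (fun ζ' : Model m => fun j => Complex.exp (ζ' j)) (𝓝 ζ) (𝓝 (Z w)) := by
    rw [hZw]; exact hexp.continuousAt
  have hev : ∀ᶠ ζ' in 𝓝 ζ, C.point ζ' = c.symm (g fun j => Complex.exp (ζ' j)) ∧
      c (C.point ζ') = g fun j => Complex.exp (ζ' j) := by
    filter_upwards [htend.eventually hs.eventually_right_inverse,
      hcomp.continuousAt.eventually (p := fun u => u ∈ c.target ∩ c.symm ⁻¹' openOrbit m M)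
        (by rw [Function.comp, hgw]; exact hdom)] with ζ' h2 h3
    have h4 := C.point_eq h3.2 h2
    exact ⟨h4, by rw [h4]; exact c.right_inv h3.1⟩
  refine ⟨hcomp.congr_of_eventuallyEq (hev.mono fun ζ' h => h.2), ?_⟩
  have h5 : ContinuousAt (fun ζ' : Model m => c.symm (g fun j => Complex.exp (ζ' j))) ζ :=
    ContinuousAt.comp (g := c.symm) (by
      show ContinuousAt c.symm (g fun j => Complex.exp (ζ j))
      rw [hgw]; exact c.continuousAt_symm hwt) hcomp.continuousAt
  exact h5.congr (hev.mono fun ζ' h => h.1.symm)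

lemma continuousAt_point (hact : IsToricAction m M) {ζ : Model m} (hζ : ζ ∈ C.tube) :
    ContinuousAt C.point ζ := (C.contDiffAt_point hact hζ (mem_chart_source _ _)).2

/-- The differential of `ζ ↦ point ζ` maps `iv` to the generator `X_v`. -/
theorem fderiv_point (hact : IsToricAction m M) {ζ : Model m} (hζ : ζ ∈ C.tube) {x : M}
    (hx : C.point ζ ∈ (chartAt (Model m) x).source) (a : Fin m → ℝ) :
    fderiv ℂ (fun ζ => chartAt (Model m) x (C.point ζ)) ζ (fun j => (a j : ℂ)) =
      -Complex.I • generatorField x (chartAt (Model m) x (C.point ζ)) a := by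
  set c := chartAt (Model m) x with hc
  have h1 := ((C.contDiffAt_point hact hζ hx).1.differentiableAt
    (by simp)).hasFDerivAt.restrictScalars ℝ
  have h2 := hact.hasFDerivAt_generatorField (c.map_source hx)
  have h3 : HasFDerivAt (fun θ : Fin m → ℝ => fun j => ζ j + Complex.I * θ j)
      (ContinuousLinearMap.pi fun j => Complex.I • (Complex.ofRealCLM.comp
        (ContinuousLinearMap.proj j))) (0 : Fin m → ℝ) := by
    refine hasFDerivAt_pi.2 fun j => ?_
    have := ((Complex.ofRealCLM.hasFDerivAt.comp (0 : Fin m → ℝ)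
      (hasFDerivAt_apply j (0 : Fin m → ℝ))).const_smul Complex.I).const_add (ζ j)
    exact this
  have h4 := HasFDerivAt.comp (g := fun ζ => c (C.point ζ)) (0 : Fin m → ℝ)
    (by simpa using h1) h3
  -- Imaginary translations in the tube are the torus action, so `iv` is sent to `X_v`; complex
  -- linearity then sends the real vector `a = -i(ia)` to `-i X_a`.
  have h5 : ((fun ζ => c (C.point ζ)) ∘ fun θ : Fin m → ℝ => fun j => ζ j + Complex.I * θ j) =
      fun θ => actionInCharts (expTorus θ) x x (c (C.point ζ)) := by
    ext1 θ
    rw [Function.comp, C.point_add_I hζ, actionInCharts, c.left_inv hx]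
  rw [h5] at h4
  have h6 := DFunLike.congr_fun (h2.unique h4) a
  have h7 : (fun j => (a j : ℂ)) = -Complex.I • fun j => Complex.I * (a j : ℂ) := by
    ext j
    simp [← mul_assoc]
  rw [h7, map_smul, h6]
  rfl

end LogCoordinates

/-- In each chart the complement lies in the zero set of `generatorDet`. It is therefore invisible
to all `L²` computations, which may be done in logarithmic coordinates. -/
lemma LogCoordinates.kahlerVolume_compl_openOrbit [VectorBundle ℂ ℂ L]
    [ContMDiffVectorBundle ω ℂ L 𝓘(ℂ, Model m)] [MeasurableSpace M] [BorelSpace M]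
    [SecondCountableTopology M] [Nonempty M] (C : LogCoordinates h A μ)
    (hact : IsToricAction m M) : h.kahlerVolume (openOrbit m M)ᶜ = 0 := by
  refine A.kahlerVolume_eq_zero hact C.isOpen_orbit.measurableSet.compl fun x => ?_
  refine measure_mono_null ?_ (volume_zeros_eq_zero (chartAt (Model m) x).open_target
    (hact.differentiableOn_generatorDet x) fun w hw => C.frequently_generatorDet_ne_zero hact hw)
  intro w hw
  refine ⟨hw.1, ?_⟩
  by_contra hD
  exact hw.2 ((C.generatorDet_ne_zero_iff hact hw.1).1 hD)

end LogCoordinates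

/-! ## The Kähler potential on the open orbit -/

section Potential

variable {m : ℕ} {M : Type*} [TopologicalSpace M] [ChartedSpace (Model m) M]
  [IsManifold 𝓘(ℂ, Model m) ω M] [MulAction (Torus m) M]
  {L : M → Type*} [TopologicalSpace (TotalSpace ℂ L)] [∀ p, AddCommGroup (L p)]
  [∀ p, Module ℂ (L p)] [∀ p, TopologicalSpace (L p)] [FiberBundle ℂ L]
  [VectorBundle ℂ ℂ L] [ContMDiffVectorBundle ω ℂ L 𝓘(ℂ, Model m)]
  {h : HermitianMetric L m} {A : ToricLift h} {μ : M → Fin m → ℝ}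

lemma contDiffAt_curvature_potential (h : HermitianMetric L m) (p : M) :
    ContDiffAt ℝ 2 (fun q => h.localPotential ((chartAt (Model m) p).symm (chartAt (Model m) p p))
      ((chartAt (Model m) p).symm q)) (chartAt (Model m) p p) :=
  (h.contDiffAt_localPotential (mem_chart_target _ p)
    (FiberBundle.mem_baseSet_trivializationAt' _)).of_le ENat.LEInfty.out

lemma IsMomentMap.differentiableAt (hμ : IsMomentMap h μ) (x : M) {w : Model m}
    (hw : w ∈ (chartAt (Model m) x).target) :
    DifferentiableAt ℝ (fun q => μ ((chartAt (Model m) x).symm q)) w := by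
  have h1 := contDiffOn_real_comp_chart_symm (contMDiffOn_univ.2 hμ.smooth) x
  rw [preimage_univ, inter_univ] at h1
  exact (h1.contDiffAt ((chartAt (Model m) x).open_target.mem_nhds hw)).differentiableAt (by simp)

/-- The derivative of `⟨μ, a⟩` along `-i X_a` is `2 ω(X_a, J X_a)`. -/
lemma IsMomentMap.sum_fderiv (hμ : IsMomentMap h μ) (hact : IsToricAction m M) (p : M)
    (a : Fin m → ℝ) :
    ∑ k, a k * fderiv ℝ (fun q => μ ((chartAt (Model m) p).symm q)) (chartAt (Model m) p p)
        (-Complex.I • generatorField p (chartAt (Model m) p p) a) k =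
      2 * (h.curvature p (chartAt (Model m) p p)
        (generatorField p (chartAt (Model m) p p) a)
        (generatorField p (chartAt (Model m) p p) a)).re := by
  set y := chartAt (Model m) p p with hy
  set X := generatorField p y a with hX
  have hg := contDiffAt_curvature_potential h p
  rw [← hy] at hg
  have hcurv : ∀ v w, h.curvature p y v w = complexHessian
      (fun q => h.localPotential ((chartAt (Model m) p).symm y) ((chartAt (Model m) p).symm q))
      y v w := fun _ _ => rfl
  -- The real form `ω` is minus the imaginary part of the hermitian form, so the normalization `2
  -- ω(·, ∂/∂θ_k)` of the moment map produces the factor `-2`.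
  have hk : ∀ k v, fderiv ℝ (fun q => μ ((chartAt (Model m) p).symm q)) y v k =
      -2 * (h.curvature p y v (generatorField p y (Pi.single k 1))).im := by
    intro k v
    have h1 := (hasFDerivAt_pi'.1 (hμ.differentiableAt p (mem_chart_target _ p)).hasFDerivAt k)
    have h2 := hμ.hamiltonian p k v
    rw [h1.fderiv, HermitianMetric.kahlerForm, hact.generator_eq] at h2
    simp only [ContinuousLinearMap.comp_apply, ContinuousLinearMap.proj_apply] at h2
    rw [h2]; ring
  have hsum : h.curvature p y (-Complex.I • X) X =
      ∑ k, (a k : ℂ) * h.curvature p y (-Complex.I • X) (generatorField p y (Pi.single k 1)) := by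
    have hlin : ∀ s : Finset (Fin m), h.curvature p y (-Complex.I • X)
        (∑ k ∈ s, (a k : ℂ) • generatorField p y (Pi.single k 1)) =
        ∑ k ∈ s, (a k : ℂ) *
          h.curvature p y (-Complex.I • X) (generatorField p y (Pi.single k 1)) := by
      intro s
      induction s using Finset.induction_on with
      | empty =>
        have := complexHessian_smul_right hg 0 (-Complex.I • X) 0
        rw [zero_smul, map_zero, zero_mul, ← hcurv] at this
        rw [Finset.sum_empty, Finset.sum_empty, this]
      | insert k s hks ih =>
        rw [Finset.sum_insert hks, Finset.sum_insert hks, ← ih]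
        simp only [hcurv]
        rw [complexHessian_add_right hg, complexHessian_smul_right hg, Complex.conj_ofReal]
    conv_lhs => rw [hX, generatorField_apply p y a]
    rw [← generatorField_apply p y a, ← hX]
    rw [← hlin Finset.univ, ← generatorField_apply p y a]
  simp only [hk]
  have h3 : (h.curvature p y (-Complex.I • X) X).im = -(h.curvature p y X X).re := by
    rw [hcurv, complexHessian_smul_left hg, ← hcurv]
    simp
  rw [hsum, Complex.im_sum] at h3
  simp only [Complex.im_ofReal_mul] at h3
  rw [← neg_eq_iff_eq_neg.2 h3, ← Finset.sum_neg_distrib, Finset.mul_sum]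
  exact Finset.sum_congr rfl fun k _ => by ring

namespace LogCoordinates

/-- The point `ρ / 2` of the tube. -/
def halfPoint (ρ : Fin m → ℝ) : Model m := fun j => ((ρ j / 2 : ℝ) : ℂ)

lemma hasFDerivAt_halfPoint (ρ : Fin m → ℝ) :
    ∃ T : (Fin m → ℝ) →L[ℝ] Model m, HasFDerivAt halfPoint T ρ ∧
      ∀ a, T a = (2⁻¹ : ℝ) • fun j => (a j : ℂ) := by
  refine ⟨ContinuousLinearMap.pi fun j => (2⁻¹ : ℝ) • (Complex.ofRealCLM.comp
        (ContinuousLinearMap.proj j)), hasFDerivAt_pi.2 fun j => ?_, fun a => by ext j; simp⟩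
  have h1 := (Complex.ofRealCLM.hasFDerivAt.comp ρ (hasFDerivAt_apply j ρ)).const_smul (2⁻¹ : ℝ)
  refine h1.congr_of_eventuallyEq (Eventually.of_forall fun x => ?_)
  simp [halfPoint, div_eq_inv_mul]

lemma contDiff_halfPoint : ContDiff ℝ ∞ (halfPoint (m := m)) := by
  refine contDiff_pi.2 fun j => ?_
  exact Complex.ofRealCLM.contDiff.comp ((contDiff_apply ℝ ℝ j).div_const 2)

variable (C : LogCoordinates h A μ)

lemma halfPoint_mem {ρ : Fin m → ℝ} (hρ : ρ ∈ C.Ω) : halfPoint ρ ∈ C.tube := by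
  simp only [tube, mem_ofPred_eq, halfPoint, Complex.ofReal_re]
  convert hρ using 1
  ext j; ring

variable [Nonempty M]

lemma rho_halfPoint {ρ : Fin m → ℝ} (hρ : ρ ∈ C.Ω) : C.rho (C.point (halfPoint ρ)) = ρ := by
  rw [C.rho_point (C.halfPoint_mem hρ)]
  ext j
  simp [halfPoint]; ring

lemma φ_eq {ρ : Fin m → ℝ} (hρ : ρ ∈ C.Ω) :
    C.φ ρ = -Real.log (h.normSq (C.e (C.point (halfPoint ρ)))) := by
  have h1 := C.normSq_e _ (C.point_mem (C.halfPoint_mem hρ))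
  have h2 := C.rho_halfPoint hρ
  unfold rho at h2
  rw [h1, h2, Real.log_exp, neg_neg]

lemma grad_φ {ρ : Fin m → ℝ} (hρ : ρ ∈ C.Ω) : grad C.φ ρ = μ (C.point (halfPoint ρ)) := by
  have h1 := C.moment_eq _ (C.point_mem (C.halfPoint_mem hρ))
  have h2 := C.rho_halfPoint hρ
  unfold rho at h2
  rw [h1, h2]

/-- The coordinates record `φ` as a bare function on `Ω`. Its smoothness comes from the metric: `φ`
is `-log ‖e‖²` along the real slice `ρ ↦ point (ρ / 2)`. -/
lemma contDiffOn_φ (hact : IsToricAction m M) : ContDiffOn ℝ ∞ C.φ C.Ω := by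
  intro ρ hρ
  refine ContDiffAt.contDiffWithinAt ?_
  set p := C.point (halfPoint ρ) with hp
  have hpM : p ∈ openOrbit m M := C.point_mem (C.halfPoint_mem hρ)
  set c := chartAt (Model m) p with hc
  have hps : p ∈ c.source := mem_chart_source _ p
  have h1 : ContDiffAt ℝ ∞ (fun ζ => c (C.point ζ)) (halfPoint ρ) :=
    ((C.contDiffAt_point hact (C.halfPoint_mem hρ) hps).1.restrict_scalars ℝ).of_le le_top
  have h2 : ContDiffAt ℝ ∞ (fun ρ => c (C.point (halfPoint ρ))) ρ :=
    h1.comp ρ contDiff_halfPoint.contDiffAt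
  have hdom : c p ∈ c.target ∩ c.symm ⁻¹' openOrbit m M :=
    ⟨c.map_source hps, by rw [mem_preimage, c.left_inv hps]; exact hpM⟩
  have h3 : ContDiffAt ℝ ∞ (fun w => h.normSq (C.e (c.symm w))) (c p) :=
    (h.contDiffOn_normSq_frame C.frame_e p).contDiffAt
      ((isOpen_chart_preimage p C.isOpen_orbit).mem_nhds hdom)
  have h4 : ContDiffAt ℝ ∞ (fun w => -Real.log (h.normSq (C.e (c.symm w)))) (c p) := by
    refine (h3.log ?_).neg
    rw [c.left_inv hps]
    exact (h.normSq_pos (C.frame_e.ne_zero p hpM)).ne'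
  have h5 := ContDiffAt.comp (g := fun w => -Real.log (h.normSq (C.e (c.symm w)))) ρ h4 h2
  refine h5.congr_of_eventuallyEq ?_
  have h6 : ContinuousAt (fun ρ => C.point (halfPoint ρ)) ρ :=
    ContinuousAt.comp (g := C.point) (C.continuousAt_point hact (C.halfPoint_mem hρ))
      contDiff_halfPoint.continuous.continuousAt
  filter_upwards [C.isOpen_Ω.mem_nhds hρ, h6.eventually (c.open_source.mem_nhds hps)]
    with ρ' hρ' hs
  rw [Function.comp, C.φ_eq hρ', c.left_inv hs]

lemma contDiffOn_grad_φ (hact : IsToricAction m M) : ContDiffOn ℝ ∞ (grad C.φ) C.Ω := by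
  have h1 := (C.contDiffOn_φ hact).fderiv_of_isOpen C.isOpen_Ω (m := ∞) (by simp)
  exact contDiffOn_pi.2 fun j => h1.clm_apply contDiffOn_const

lemma fderiv_φ_apply {ρ : Fin m → ℝ} (b : Fin m → ℝ) :
    fderiv ℝ C.φ ρ b = ∑ j, b j * grad C.φ ρ j := by
  conv_lhs => rw [pi_eq_sum_univ' b, map_sum]
  simp [grad]

/-- The Hessian of `φ` is positive definite. -/
theorem hessian_φ_pos (hact : IsToricAction m M) (hpos : h.IsPositive) (hμ : IsMomentMap h μ)
    {ρ : Fin m → ℝ} (hρ : ρ ∈ C.Ω) {a : Fin m → ℝ} (ha : a ≠ 0) :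
    0 < ∑ k, a k * fderiv ℝ (grad C.φ) ρ a k := by
  set p := C.point (halfPoint ρ) with hp
  have hpM : p ∈ openOrbit m M := C.point_mem (C.halfPoint_mem hρ)
  set c := chartAt (Model m) p with hc
  have hps : p ∈ c.source := mem_chart_source _ p
  obtain ⟨T, hT, hTa⟩ := hasFDerivAt_halfPoint ρ
  have h1 : HasFDerivAt (fun ζ => c (C.point ζ)) _ (halfPoint ρ) :=
    ((C.contDiffAt_point hact (C.halfPoint_mem hρ) hps).1.differentiableAt
    (by simp)).hasFDerivAt.restrictScalars ℝ
  have h2 := HasFDerivAt.comp (g := fun ζ => c (C.point ζ)) ρ h1 hT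
  have h3 := HasFDerivAt.comp (g := fun q => μ (c.symm q)) ρ
    (hμ.differentiableAt p (c.map_source hps)).hasFDerivAt h2
  have h6 : ContinuousAt (fun ρ => C.point (halfPoint ρ)) ρ :=
    ContinuousAt.comp (g := C.point) (C.continuousAt_point hact (C.halfPoint_mem hρ))
      contDiff_halfPoint.continuous.continuousAt
  have h4 : grad C.φ =ᶠ[𝓝 ρ] (fun q => μ (c.symm q)) ∘ (fun ζ => c (C.point ζ)) ∘ halfPoint := by
    filter_upwards [C.isOpen_Ω.mem_nhds hρ, h6.eventually (c.open_source.mem_nhds hps)]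
      with ρ' hρ' hs
    simp only [Function.comp]
    rw [C.grad_φ hρ', c.left_inv hs]
  have h5 := (h3.congr_of_eventuallyEq h4).fderiv
  have h7 := hμ.sum_fderiv hact p a
  -- Moving `ρ` by `a` moves `ζ = ρ / 2` by `a / 2`, that is, the point by `-X_a i / 2`. With
  -- `IsMomentMap.sum_fderiv` the Hessian of `φ` at `(a, a)` is the curvature form at `(X_a, X_a)`.
  have h8 : ∀ k, a k * fderiv ℝ (grad C.φ) ρ a k = 2⁻¹ * (a k *
      fderiv ℝ (fun q => μ (c.symm q)) (c p) (-Complex.I • generatorField p (c p) a) k) := by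
    intro k
    rw [h5]
    simp only [ContinuousLinearMap.comp_apply, hTa, map_smul, ContinuousLinearMap.coe_restrictScalars',
      C.fderiv_point hact (C.halfPoint_mem hρ) hps a, Pi.smul_apply, smul_eq_mul]
    ring
  rw [Finset.sum_congr rfl fun k _ => h8 k, ← Finset.mul_sum, h7]
  have hX : generatorField p (c p) a ≠ 0 := by
    have hD : generatorDet p (c p) ≠ 0 :=
      (C.generatorDet_ne_zero_iff hact (c.map_source hps)).2 (by rw [c.left_inv hps]; exact hpM)
    intro h0
    exact ha (generatorField_injective hD (h0.trans (map_zero _).symm))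
  have := hpos p _ hX
  linarith

end LogCoordinates
end Potential

/-! ## The Legendre transform -/

section Legendre

variable {m : ℕ} {M : Type*} [TopologicalSpace M] [ChartedSpace (Model m) M]
  [IsManifold 𝓘(ℂ, Model m) ω M] [MulAction (Torus m) M]
  {L : M → Type*} [TopologicalSpace (TotalSpace ℂ L)] [∀ p, AddCommGroup (L p)]
  [∀ p, Module ℂ (L p)] [∀ p, TopologicalSpace (L p)] [FiberBundle ℂ L]
  [VectorBundle ℂ ℂ L] [ContMDiffVectorBundle ω ℂ L 𝓘(ℂ, Model m)]
  {h : HermitianMetric L m} {A : ToricLift h} {μ : M → Fin m → ℝ} [Nonempty M]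

namespace LogCoordinates

variable (C : LogCoordinates h A μ)

lemma hasFDerivAt_grad (hact : IsToricAction m M) {ρ : Fin m → ℝ} (hρ : ρ ∈ C.Ω) :
    HasStrictFDerivAt (grad C.φ) (fderiv ℝ (grad C.φ) ρ) ρ :=
  ((C.contDiffOn_grad_φ hact).contDiffAt (C.isOpen_Ω.mem_nhds hρ)).hasStrictFDerivAt (by simp)

/-- The derivative along the segment is the Hessian of `φ` at `(b, b)`. Injectivity of the gradient
and the gradient inequality for `φ` both come from this. -/
lemma strictMonoOn_grad (hact : IsToricAction m M) (hpos : h.IsPositive) (hμ : IsMomentMap h μ)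
    {ρ b : Fin m → ℝ} (hb : b ≠ 0) (hseg : ∀ s ∈ Icc (0 : ℝ) 1, ρ + s • b ∈ C.Ω) :
    StrictMonoOn (fun s : ℝ => ∑ j, b j * grad C.φ (ρ + s • b) j) (Icc 0 1) := by
  have hline : ∀ s : ℝ, HasDerivAt (fun s : ℝ => ρ + s • b) b s := fun s => by
    simpa using ((hasDerivAt_id s).smul_const b).const_add ρ
  have hd : ∀ s ∈ Icc (0 : ℝ) 1, HasDerivAt (fun s : ℝ => ∑ j, b j * grad C.φ (ρ + s • b) j)
      (∑ j, b j * fderiv ℝ (grad C.φ) (ρ + s • b) b j) s := by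
    intro s hs
    have h1 := (C.hasFDerivAt_grad hact (hseg s hs)).hasFDerivAt.comp_hasDerivAt s (hline s)
    have h2 := hasDerivAt_pi.1 h1
    exact HasDerivAt.fun_sum fun j _ => (h2 j).const_mul (b j)
  refine strictMonoOn_of_deriv_pos (convex_Icc 0 1)
    (fun s hs => (hd s hs).continuousAt.continuousWithinAt) fun s hs => ?_
  rw [interior_Icc] at hs
  have hs' := Ioo_subset_Icc_self hs
  rw [(hd s hs').deriv]
  exact C.hessian_φ_pos hact hpos hμ (hseg s hs') hb

lemma segment_mem {ρ ρ' : Fin m → ℝ} (hρ : ρ ∈ C.Ω) (hρ' : ρ' ∈ C.Ω) :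
    ∀ s ∈ Icc (0 : ℝ) 1, ρ + s • (ρ' - ρ) ∈ C.Ω := fun _ hs =>
  C.convex_Ω.add_smul_sub_mem hρ hρ' hs

lemma injOn_grad (hact : IsToricAction m M) (hpos : h.IsPositive) (hμ : IsMomentMap h μ) :
    InjOn (grad C.φ) C.Ω := by
  intro ρ hρ ρ' hρ' heq
  by_contra hne
  have h1 := C.strictMonoOn_grad hact hpos hμ (sub_ne_zero.2 (Ne.symm hne)) (C.segment_mem hρ hρ')
    (show (0 : ℝ) ∈ Icc (0 : ℝ) 1 by simp) (show (1 : ℝ) ∈ Icc (0 : ℝ) 1 by simp) zero_lt_one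
  simp [heq] at h1

/-- The gradient inequality for the convex function `φ`. -/
lemma φ_add_le (hact : IsToricAction m M) (hpos : h.IsPositive) (hμ : IsMomentMap h μ)
    {ρ ρ' : Fin m → ℝ} (hρ : ρ ∈ C.Ω) (hρ' : ρ' ∈ C.Ω) :
    C.φ ρ + ∑ j, (ρ' j - ρ j) * grad C.φ ρ j ≤ C.φ ρ' := by
  rcases eq_or_ne ρ ρ' with rfl | hne
  · simp
  set b := ρ' - ρ with hb
  have hseg := C.segment_mem hρ hρ'
  have hline : ∀ s : ℝ, HasDerivAt (fun s : ℝ => ρ + s • b) b s := fun s => by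
    simpa using ((hasDerivAt_id s).smul_const b).const_add ρ
  have hd : ∀ s ∈ Icc (0 : ℝ) 1, HasDerivAt (fun s : ℝ => C.φ (ρ + s • b))
      (∑ j, b j * grad C.φ (ρ + s • b) j) s := by
    intro s hs
    rw [← C.fderiv_φ_apply]
    exact (((C.contDiffOn_φ hact).contDiffAt (C.isOpen_Ω.mem_nhds (hseg s hs))).differentiableAt
      (by simp)).hasFDerivAt.comp_hasDerivAt s (hline s)
  obtain ⟨s, hs, hs'⟩ := exists_hasDerivAt_eq_slope (fun s : ℝ => C.φ (ρ + s • b)) _ zero_lt_one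
    (fun s hs => (hd s hs).continuousAt.continuousWithinAt)
    fun s hs => hd s (Ioo_subset_Icc_self hs)
  have h1 := (C.strictMonoOn_grad hact hpos hμ (sub_ne_zero.2 hne.symm) hseg)
    (show (0 : ℝ) ∈ Icc (0 : ℝ) 1 by simp) (Ioo_subset_Icc_self hs) hs.1
  have h2 : ρ + (1 : ℝ) • b = ρ' := by simp [hb]
  rw [h2] at hs'
  simp only [zero_smul, add_zero, sub_zero, div_one] at hs' h1
  rw [hs'] at h1
  simp only [Pi.sub_apply] at h1
  linarith

/-- The differential of the gradient, as an isomorphism. -/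
lemma exists_equiv_fderiv_grad (hact : IsToricAction m M) (hpos : h.IsPositive)
    (hμ : IsMomentMap h μ) {ρ : Fin m → ℝ} (hρ : ρ ∈ C.Ω) :
    ∃ Φ : (Fin m → ℝ) ≃L[ℝ] (Fin m → ℝ),
      (Φ : (Fin m → ℝ) →L[ℝ] (Fin m → ℝ)) = fderiv ℝ (grad C.φ) ρ := by
  have hinj : Function.Injective (fderiv ℝ (grad C.φ) ρ) := by
    rw [injective_iff_map_eq_zero]
    intro a ha
    by_contra hne
    have := C.hessian_φ_pos hact hpos hμ hρ hne
    simp [ha] at this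
  exact ⟨ContinuousLinearEquiv.ofBijective (fderiv ℝ (grad C.φ) ρ) (LinearMap.ker_eq_bot.2 hinj)
    (LinearMap.range_eq_top.2 (LinearMap.injective_iff_surjective.1 hinj)),
    ContinuousLinearEquiv.coe_ofBijective _ _ _⟩

/-- By the inverse function theorem the moment map is open in the variable `ρ`; this is used to find
points with rational moment. -/
lemma map_nhds_grad (hact : IsToricAction m M) (hpos : h.IsPositive) (hμ : IsMomentMap h μ)
    {ρ : Fin m → ℝ} (hρ : ρ ∈ C.Ω) : map (grad C.φ) (𝓝 ρ) = 𝓝 (grad C.φ ρ) := by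
  obtain ⟨Φ, hΦ⟩ := C.exists_equiv_fderiv_grad hact hpos hμ hρ
  have h1 := C.hasFDerivAt_grad hact hρ
  rw [← hΦ] at h1
  exact h1.map_nhds_eq_of_equiv

lemma invFunOn_grad (hact : IsToricAction m M) (hpos : h.IsPositive) (hμ : IsMomentMap h μ)
    {ρ : Fin m → ℝ} (hρ : ρ ∈ C.Ω) : Function.invFunOn (grad C.φ) C.Ω (grad C.φ ρ) = ρ :=
  (C.injOn_grad hact hpos hμ).leftInvOn_invFunOn hρ

lemma symplecticPotential_grad (hact : IsToricAction m M) (hpos : h.IsPositive)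
    (hμ : IsMomentMap h μ) {ρ : Fin m → ℝ} (hρ : ρ ∈ C.Ω) :
    C.symplecticPotential (grad C.φ ρ) = (∑ j, grad C.φ ρ j * ρ j) - C.φ ρ := by
  rw [symplecticPotential, C.invFunOn_grad hact hpos hμ hρ]

/-- The gradient of the symplectic potential inverts the gradient of `φ`. -/
theorem grad_symplecticPotential (hact : IsToricAction m M) (hpos : h.IsPositive)
    (hμ : IsMomentMap h μ) {ρ : Fin m → ℝ} (hρ : ρ ∈ C.Ω) :
    grad C.symplecticPotential (grad C.φ ρ) = ρ := by
  obtain ⟨Φ, hΦ⟩ := C.exists_equiv_fderiv_grad hact hpos hμ hρ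
  have h1 := C.hasFDerivAt_grad hact hρ
  rw [← hΦ] at h1
  -- The chosen inverse in `symplecticPotential` carries no regularity of its own. By injectivity of
  -- the gradient, `u` is given near `∇φ(ρ)` by the same formula with the differentiable local
  -- inverse.
  set ψ := h1.localInverse (grad C.φ) Φ ρ with hψ
  have hψx : ψ (grad C.φ ρ) = ρ := h1.localInverse_apply_image
  have h2 : HasFDerivAt ψ (Φ.symm : (Fin m → ℝ) →L[ℝ] (Fin m → ℝ)) (grad C.φ ρ) :=
    h1.to_localInverse.hasFDerivAt
  have h3 : HasFDerivAt C.φ (fderiv ℝ C.φ ρ) ρ :=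
    (((C.contDiffOn_φ hact).contDiffAt (C.isOpen_Ω.mem_nhds hρ)).differentiableAt
      (by simp)).hasFDerivAt
  have h4 : ∀ᶠ x in 𝓝 (grad C.φ ρ), C.symplecticPotential x =
      (∑ j, x j * ψ x j) - C.φ (ψ x) := by
    have h5 : Tendsto ψ (𝓝 (grad C.φ ρ)) (𝓝 ρ) := by
      have := h2.continuousAt.tendsto
      rwa [hψx] at this
    filter_upwards [h1.eventually_right_inverse, h5.eventually (C.isOpen_Ω.mem_nhds hρ)]
      with x hx hxΩ
    have := C.symplecticPotential_grad hact hpos hμ hxΩ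
    rwa [show grad C.φ (ψ x) = x from hx] at this
  have h6 := HasFDerivAt.comp (g := C.φ) (grad C.φ ρ) (by rw [hψx]; exact h3) h2
  have h7 : HasFDerivAt (fun x : Fin m → ℝ => ∑ j, x j * ψ x j) _ (grad C.φ ρ) :=
    HasFDerivAt.fun_sum (u := Finset.univ) fun j _ =>
      (hasFDerivAt_apply j (grad C.φ ρ)).mul (hasFDerivAt_pi'.1 h2 j)
  -- In `d(⟨x, ψ⟩ - φ(ψ))` the terms with `dψ` cancel because `∇φ(ψ(x)) = x`; only `ψ` remains.
  have h8 := (h7.sub h6).congr_of_eventuallyEq h4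
  ext k
  rw [grad, h8.fderiv]
  simp only [FunLike.coe_sub, Pi.sub_apply, ContinuousLinearMap.comp_apply, hψx,
    C.fderiv_φ_apply, FunLike.coe_sum, Finset.sum_apply, FunLike.coe_add,
    Pi.add_apply, FunLike.coe_smul, Pi.smul_apply, smul_eq_mul, ContinuousLinearMap.proj_apply,
    Finset.sum_add_distrib]
  simp [Pi.single_apply, mul_comm]

end LogCoordinates
end Legendre

/-! ## Extension of sections from the open orbit -/

section Extension

variable {m : ℕ} {M : Type*} [TopologicalSpace M] [ChartedSpace (Model m) M]
  [IsManifold 𝓘(ℂ, Model m) ω M] [MulAction (Torus m) M]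
  {L : M → Type*} [TopologicalSpace (TotalSpace ℂ L)] [∀ p, AddCommGroup (L p)]
  [∀ p, Module ℂ (L p)] [∀ p, TopologicalSpace (L p)] [FiberBundle ℂ L]
  [VectorBundle ℂ ℂ L] [ContMDiffVectorBundle ω ℂ L 𝓘(ℂ, Model m)]
  {h : HermitianMetric L m} {A : ToricLift h} {μ : M → Fin m → ℝ}

lemma mem_baseSet_self (x : M) : x ∈ (trivializationAt ℂ L x).baseSet :=
  FiberBundle.mem_baseSet_trivializationAt' x

/-- `s` is holomorphic over `U`, in the local frames. -/
def IsHolomorphicOver (h : HermitianMetric L m) {N : ℕ} (s : ∀ p, ⨂[ℂ]^N (L p)) (U : Set M) :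
    Prop :=
  ∀ x : M, DifferentiableOn ℂ (fun w => h.coeff (localFrame L x ((chartAt (Model m) x).symm w))
      (s ((chartAt (Model m) x).symm w)))
    ((chartAt (Model m) x).target ∩
      (chartAt (Model m) x).symm ⁻¹' (U ∩ (trivializationAt ℂ L x).baseSet))

lemma coeff_localFrame_smul_tprod (h : HermitianMetric L m) {N : ℕ} {x p : M}
    (hp : p ∈ (trivializationAt ℂ L x).baseSet) (a : ℂ) (v : L p) :
    h.coeff (localFrame L x p) (a • PiTensorProduct.tprod ℂ fun _ : Fin N => v) =
      a * frameCoord x p v ^ N := by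
  have h1 := h.coeff_tprod_smul (localFrame_ne_zero hp) fun _ : Fin N => frameCoord x p v
  simp only [frameCoord_smul_localFrame hp] at h1
  rw [map_smul, h1]
  simp

lemma isHolomorphicOver_smul_tprod (h : HermitianMetric L m) (N : ℕ) {e : ∀ p, L p} {U : Set M}
    (he : IsHolomorphicFrame L m e U) {G : M → ℂ}
    (hG : MDifferentiableOn 𝓘(ℂ, Model m) 𝓘(ℂ, ℂ) G U) :
    IsHolomorphicOver h (fun p => G p • PiTensorProduct.tprod ℂ fun _ : Fin N => e p) U := by
  intro x
  have h1 := differentiableOn_comp_chart_symm (hG.mono (inter_subset_left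
    (t := (trivializationAt ℂ L x).baseSet))) x
  have h2 := (contDiffOn_comp_chart_symm (he.contMDiffOn_frameCoord x) x).differentiableOn
    (by simp)
  refine (h1.mul (h2.pow N)).congr fun w hw => ?_
  exact coeff_localFrame_smul_tprod h hw.2.2 _ _

lemma HermitianMetric.norm_innerPow_self (h : HermitianMetric L m) {N : ℕ} {p : M} {e : L p}
    (he : e ≠ 0) (S : ⨂[ℂ]^N (L p)) :
    ‖h.innerPow S S‖ = ‖h.coeff e S‖ ^ 2 * h.normSq e ^ N := by
  rw [h.innerPow_self he, Complex.norm_real, Real.norm_of_nonneg]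
  have := (h.normSq_pos he).le
  positivity

lemma continuousAt_normSq_localFrame (h : HermitianMetric L m) {x p : M}
    (hp : p ∈ (trivializationAt ℂ L x).baseSet) :
    ContinuousAt (fun p => h.normSq (localFrame L x p)) p :=
  ((h.smooth x).continuousOn).continuousAt
    ((trivializationAt ℂ L x).open_baseSet.mem_nhds hp)

lemma LogCoordinates.neBot (C : LogCoordinates h A μ) (p : M) : (𝓝[openOrbit m M] p).NeBot :=
  mem_closure_iff_nhdsWithin_neBot.1 (C.dense_orbit p)

/-- Holomorphic sections over the open orbit which are locally bounded extend. -/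
theorem LogCoordinates.exists_section_extension (C : LogCoordinates h A μ)
    (hact : IsToricAction m M) {N : ℕ} {s₀ : ∀ p, ⨂[ℂ]^N (L p)}
    (hhol : IsHolomorphicOver h s₀ (openOrbit m M))
    (hbdd : ∀ q, ∃ B, ∀ᶠ p in 𝓝[openOrbit m M] q, ‖h.innerPow (s₀ p) (s₀ p)‖ ≤ B) :
    ∃ S : ∀ p, ⨂[ℂ]^N (L p), h.IsHolomorphicSection S ∧ ∀ p ∈ openOrbit m M, S p = s₀ p := by
  -- In the frame at `x` a bound on the pointwise norm bounds the coefficient, since the norm of the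
  -- frame stays away from `0` near `x`. The coefficient then extends across the zeros of
  -- `generatorDet`.
  have hloc : ∀ x : M, ∃ F : Model m → ℂ, DifferentiableAt ℂ F (chartAt (Model m) x x) ∧
      ∀ᶠ p in 𝓝 x, ContinuousAt (fun p => F (chartAt (Model m) x p)) p ∧
        ∀ᶠ p' in 𝓝[openOrbit m M] p,
          F (chartAt (Model m) x p') = h.coeff (localFrame L x p') (s₀ p') := by
    intro x
    set c := chartAt (Model m) x with hc
    have hxs : x ∈ c.source := mem_chart_source _ x
    have hxb := mem_baseSet_self (L := L) x
    obtain ⟨B, hB⟩ := hbdd x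
    have hn0 := h.normSq_pos (localFrame_ne_zero hxb)
    rw [eventually_nhdsWithin_iff] at hB
    have hev : ∀ᶠ p in 𝓝 x, p ∈ (trivializationAt ℂ L x).baseSet ∧ (p ∈ openOrbit m M →
        ‖h.coeff (localFrame L x p) (s₀ p)‖ ≤
          1 + B / (h.normSq (localFrame L x x) / 2) ^ N) := by
      filter_upwards [hB, (trivializationAt ℂ L x).open_baseSet.mem_nhds hxb,
        (continuousAt_normSq_localFrame h hxb).eventually (lt_mem_nhds (half_lt_self hn0))]
        with p h1 h2 h3
      refine ⟨h2, fun hp => ?_⟩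
      have h4 := h1 hp
      rw [h.norm_innerPow_self (localFrame_ne_zero h2)] at h4
      have h5 : (h.normSq (localFrame L x x) / 2) ^ N ≤ h.normSq (localFrame L x p) ^ N :=
        pow_le_pow_left₀ (by positivity) h3.le N
      have h6 : ‖h.coeff (localFrame L x p) (s₀ p)‖ ^ 2 ≤
          B / (h.normSq (localFrame L x x) / 2) ^ N := by
        rw [le_div_iff₀ (by positivity)]
        exact (mul_le_mul_of_nonneg_left h5 (by positivity)).trans h4
      -- A bound on `t²` is turned into one on `t` through `t ≤ 1 + t²`.
      nlinarith [sq_nonneg (‖h.coeff (localFrame L x p) (s₀ p)‖ - 1)]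
    obtain ⟨V, hV, hVo, hxV⟩ := eventually_nhds_iff.1 hev
    have hW : IsOpen (c.target ∩ c.symm ⁻¹' V) := isOpen_chart_preimage x hVo
    have hDd : DifferentiableOn ℂ (generatorDet x) (c.target ∩ c.symm ⁻¹' V) :=
      (hact.differentiableOn_generatorDet x).mono inter_subset_left
    have hxW : c x ∈ c.target ∩ c.symm ⁻¹' V :=
      ⟨c.map_source hxs, by rw [mem_preimage, c.left_inv hxs]; exact hxV⟩
    obtain ⟨F, U, hU, hxU, hUW, hF, hFf⟩ := exists_holomorphic_extension hW hDd hxW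
      (C.frequently_generatorDet_ne_zero hact hxW.1)
      (f := fun w => h.coeff (localFrame L x (c.symm w)) (s₀ (c.symm w)))
      ((hhol x).mono fun w hw => ⟨hw.1.1, (C.generatorDet_ne_zero_iff hact hw.1.1).1 hw.2,
        (hV _ hw.1.2).1⟩)
      (C := 1 + B / (h.normSq (localFrame L x x) / 2) ^ N)
      (fun w hw hD => (hV _ hw.2).2 ((C.generatorDet_ne_zero_iff hact hw.1).1 hD))
    refine ⟨F, (hF _ hxU).differentiableAt (hU.mem_nhds hxU), ?_⟩
    have hnear : ∀ᶠ p in 𝓝 x, p ∈ c.source ∧ c p ∈ U :=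
      Eventually.and (c.open_source.mem_nhds hxs) ((c.continuousAt hxs).eventually (hU.mem_nhds hxU))
    filter_upwards [hnear.eventually_nhds] with p hp
    refine ⟨?_, ?_⟩
    · have h1 := hp.self_of_nhds
      exact ContinuousAt.comp (g := F)
        ((hF _ h1.2).differentiableAt (hU.mem_nhds h1.2)).continuousAt (c.continuousAt h1.1)
    · rw [eventually_nhdsWithin_iff]
      filter_upwards [hp] with p' hp' hM
      rw [hFf _ hp'.2 ((C.generatorDet_ne_zero_iff hact (hUW hp'.2).1).2
        (by rw [c.left_inv hp'.1]; exact hM)), c.left_inv hp'.1]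
  choose F hFd hF using hloc
  classical
  -- Off the open orbit the value at `p` is that of the local extension centred at `p` itself; near
  -- any `x` it must be compared with the extension centred at `x`.
  refine ⟨fun p => if p ∈ openOrbit m M then s₀ p else
    F p (chartAt (Model m) p p) • PiTensorProduct.tprod ℂ fun _ : Fin N => localFrame L p p, ?_,
    fun p hp => if_pos hp⟩
  refine HermitianMetric.isHolomorphicSection_of_localFrame fun x => ?_
  set c := chartAt (Model m) x with hc
  have hxs : x ∈ c.source := mem_chart_source _ x
  have hxb := mem_baseSet_self (L := L) x
  have hFx : MDifferentiableAt 𝓘(ℂ, Model m) 𝓘(ℂ, ℂ) (fun p => F x (c p)) x := by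
    refine mdifferentiableAt_of_comp_chart_symm hxs ?_
    refine (hFd x).congr_of_eventuallyEq ?_
    filter_upwards [c.open_target.mem_nhds (c.map_source hxs)] with w hw
    simp only [hc] at hw ⊢
    rw [c.right_inv hw]
  refine hFx.congr_of_eventuallyEq ?_
  filter_upwards [hF x, (trivializationAt ℂ L x).open_baseSet.mem_nhds hxb] with p hp hpb
  by_cases hpM : p ∈ openOrbit m M
  · rw [if_pos hpM]
    have := eventually_nhdsWithin_iff.1 hp.2
    exact (this.self_of_nhds hpM).symm
  · rw [if_neg hpM, coeff_localFrame_smul_tprod h hpb]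
    have hk : ContinuousAt (fun p' => frameCoord x p' (localFrame L p p')) p :=
      ((isHolomorphicFrame_localFrame (m := m) L p).contMDiffOn_frameCoord x).continuousOn.continuousAt
        (((trivializationAt ℂ L p).open_baseSet.inter
          (trivializationAt ℂ L x).open_baseSet).mem_nhds ⟨mem_baseSet_self p, hpb⟩)
    have hpp := (hF p).self_of_nhds
    have hright : ContinuousAt (fun p' => F p (chartAt (Model m) p p') *
        frameCoord x p' (localFrame L p p') ^ N) p := hpp.1.mul (hk.pow N)
    have := C.neBot p
    -- The extensions centred at `x` and at `p` both represent `s₀` on the dense open orbit, up to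
    -- the change of frame, so their limits at `p` coincide.
    refine (tendsto_nhds_unique (l := 𝓝[openOrbit m M] p) (hp.1.tendsto.mono_left nhdsWithin_le_nhds)
      ((hright.tendsto.mono_left nhdsWithin_le_nhds).congr' ?_)).symm
    filter_upwards [hp.2, hpp.2, mem_nhdsWithin_of_mem_nhds
      (((trivializationAt ℂ L p).open_baseSet.inter
          (trivializationAt ℂ L x).open_baseSet).mem_nhds ⟨mem_baseSet_self p, hpb⟩)]
      with p' h1 h2 h3
    rw [h1, h2]
    have h4 := localFrame_ne_zero h3.2
    have h5 := frameCoord_ne_zero h3.2 (localFrame_ne_zero h3.1)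
    rw [h.coeff_eq_pow_mul h4 h5, frameCoord_smul_localFrame h3.2, mul_comm]

end Extension

/-! ## Monomial sections -/

section Monomials

variable {m : ℕ} {M : Type*} [TopologicalSpace M] [ChartedSpace (Model m) M]
  [IsManifold 𝓘(ℂ, Model m) ω M] [MulAction (Torus m) M]
  {L : M → Type*} [TopologicalSpace (TotalSpace ℂ L)] [∀ p, AddCommGroup (L p)]
  [∀ p, Module ℂ (L p)] [∀ p, TopologicalSpace (L p)] [FiberBundle ℂ L]
  [VectorBundle ℂ ℂ L] [ContMDiffVectorBundle ω ℂ L 𝓘(ℂ, Model m)]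
  {h : HermitianMetric L m} {A : ToricLift h} {μ : M → Fin m → ℝ}

namespace LogCoordinates

variable (C : LogCoordinates h A μ)

/-- The monomial `z^k`. -/
def monomial (k : Fin m → ℤ) (p : M) : ℂ := ∏ j, C.z p j ^ k j

/-- The section `z^k e^{⊗N}` over the open orbit. -/
def monomialSection (N : ℕ) (k : Fin m → ℤ) (p : M) : ⨂[ℂ]^N (L p) :=
  C.monomial k p • PiTensorProduct.tprod ℂ fun _ : Fin N => C.e p

lemma monomial_ne_zero (k : Fin m → ℤ) {p : M} (hp : p ∈ openOrbit m M) : C.monomial k p ≠ 0 :=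
  Finset.prod_ne_zero_iff.2 fun j _ => zpow_ne_zero _ (C.z_ne_zero hp j)

lemma mdifferentiableOn_monomial (k : Fin m → ℤ) :
    MDifferentiableOn 𝓘(ℂ, Model m) 𝓘(ℂ, ℂ) (C.monomial k) (openOrbit m M) := by
  intro p hp
  have h1 : MDifferentiableAt 𝓘(ℂ, Model m) 𝓘(ℂ, Model m) C.z p :=
    (C.holomorphic_z.contMDiffAt (C.isOpen_orbit.mem_nhds hp)).mdifferentiableAt (by simp)
  have h2 : DifferentiableAt ℂ (fun v : Model m => ∏ j, v j ^ k j) (C.z p) := by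
    refine (HasFDerivAt.finsetProd fun j _ => DifferentiableAt.hasFDerivAt ?_).differentiableAt
    exact (differentiableAt_apply j _).zpow (Or.inl (C.z_ne_zero hp j))
  exact (h2.mdifferentiableAt.comp p h1).mdifferentiableWithinAt

lemma isHolomorphicOver_monomialSection (N : ℕ) (k : Fin m → ℤ) :
    IsHolomorphicOver h (C.monomialSection N k) (openOrbit m M) :=
  isHolomorphicOver_smul_tprod h N C.frame_e (C.mdifferentiableOn_monomial k)

lemma coeff_monomialSection (N : ℕ) (k : Fin m → ℤ) {p : M} (hp : p ∈ openOrbit m M) :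
    h.coeff (C.e p) (C.monomialSection N k p) = C.monomial k p := by
  rw [monomialSection, map_smul, h.coeff_tprod (C.frame_e.ne_zero p hp), smul_eq_mul, mul_one]

lemma normSq_e_eq {p : M} (hp : p ∈ openOrbit m M) :
    h.normSq (C.e p) = Real.exp (-C.φ (C.rho p)) := C.normSq_e p hp

lemma innerPow_monomialSection (N : ℕ) (k : Fin m → ℤ) {p : M} (hp : p ∈ openOrbit m M) :
    h.innerPow (C.monomialSection N k p) (C.monomialSection N k p) =
      (C.monomialDensity N k p : ℂ) := by
  rw [h.innerPow_self (C.frame_e.ne_zero p hp), C.coeff_monomialSection N k hp, C.normSq_e_eq hp,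
    monomialDensity, monomial, ← Real.exp_nat_mul, norm_prod, ← Finset.prod_pow, mul_neg]
  congr 2
  refine Finset.prod_congr rfl fun j _ => ?_
  rw [norm_zpow, ← zpow_natCast, ← zpow_mul, mul_comm, zpow_mul, zpow_natCast]

/-- The function `⟨y, ρ⟩ - φ(ρ)` on the open orbit. -/
def legendre (y : Fin m → ℝ) (p : M) : ℝ := (∑ j, y j * C.rho p j) - C.φ (C.rho p)

/-- The exponent is a Legendre expression in the slope `k / N`. It makes sense for every real slope,
so slopes can be varied continuously. -/
lemma monomialDensity_eq_exp {N : ℕ} (hN : 1 ≤ N) (k : Fin m → ℤ) {p : M}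
    (hp : p ∈ openOrbit m M) :
    C.monomialDensity N k p = Real.exp (N * C.legendre (latticePoint N k) p) := by
  have hN0 : (N : ℝ) ≠ 0 := by exact_mod_cast (by lia : N ≠ 0)
  rw [monomialDensity, legendre, mul_sub, sub_eq_add_neg, Real.exp_add, Finset.mul_sum,
    Real.exp_sum]
  congr 1
  refine Finset.prod_congr rfl fun j _ => ?_
  have hz : 0 < ‖C.z p j‖ ^ 2 := by have := norm_pos_iff.2 (C.z_ne_zero hp j); positivity
  rw [rho, latticePoint, ← Real.rpow_intCast, Real.rpow_def_of_pos hz]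
  congr 1
  field_simp

lemma continuousOn_rho : ContinuousOn C.rho (openOrbit m M) := by
  refine continuousOn_pi.2 fun j => ContinuousOn.log ?_ fun p hp => ?_
  · have h1 : ContinuousOn (fun p => C.z p j) (openOrbit m M) :=
      (continuous_apply j).comp_continuousOn C.holomorphic_z.continuousOn
    exact h1.norm.pow 2
  · have := norm_pos_iff.2 (C.z_ne_zero hp j); positivity

lemma continuousOn_φ_rho : ContinuousOn (fun p => C.φ (C.rho p)) (openOrbit m M) := by
  intro p hp
  set x := p
  have h1 := (h.contDiffOn_normSq_frame C.frame_e x).continuousOn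
  have hx : x ∈ (chartAt (Model m) x).source := mem_chart_source _ x
  have h2 : ContinuousAt (fun p => h.normSq (C.e p)) x := by
    have h3 : ContinuousAt (fun w => h.normSq (C.e ((chartAt (Model m) x).symm w)))
        (chartAt (Model m) x x) := h1.continuousAt
      ((isOpen_chart_preimage x C.isOpen_orbit).mem_nhds
        ⟨mem_chart_target _ x, by rw [mem_preimage, (chartAt (Model m) x).left_inv hx]; exact hp⟩)
    have h4 := ContinuousAt.comp (g := fun w => h.normSq (C.e ((chartAt (Model m) x).symm w)))
      h3 ((chartAt (Model m) x).continuousAt hx)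
    refine h4.congr ?_
    filter_upwards [(chartAt (Model m) x).open_source.mem_nhds hx] with q hq
    rw [Function.comp, (chartAt (Model m) x).left_inv hq]
  have h5 := (h2.log (h.normSq_pos (C.frame_e.ne_zero x hp)).ne').neg
  refine ContinuousAt.continuousWithinAt (h5.congr ?_)
  filter_upwards [C.isOpen_orbit.mem_nhds hp] with q hq
  simp [C.normSq_e_eq hq]

variable [Nonempty M]

/-- The concave function `ρ ↦ ⟨y, ρ⟩ - φ(ρ)` is maximal at its critical point, which is where `∇φ(ρ)
= y`. -/
lemma legendre_le (hact : IsToricAction m M) (hpos : h.IsPositive) (hμ : IsMomentMap h μ)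
    {p p' : M} (hp : p ∈ openOrbit m M) (hp' : p' ∈ openOrbit m M) :
    C.legendre (μ p') p ≤ C.legendre (μ p') p' := by
  have h1 := C.φ_add_le hact hpos hμ (C.rho_mem hp') (C.rho_mem hp)
  have h2 : μ p' = grad C.φ (C.rho p') := C.moment_eq p' hp'
  simp only [legendre, h2]
  have h3 : ∑ j, (C.rho p j - C.rho p' j) * grad C.φ (C.rho p') j =
      ∑ j, grad C.φ (C.rho p') j * C.rho p j - ∑ j, grad C.φ (C.rho p') j * C.rho p' j := by
    rw [← Finset.sum_sub_distrib]
    exact Finset.sum_congr rfl fun j _ => by ring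
  rw [h3] at h1
  linarith

/-- Rational values of the moment map are taken on a dense set of points of the open orbit. -/
lemma exists_rational_moment (C : LogCoordinates h A μ) (hact : IsToricAction m M)
    (hpos : h.IsPositive)
    (hμ : IsMomentMap h μ) (q : M) : ∃ᶠ p in 𝓝 q, p ∈ openOrbit m M ∧
      ∃ (n : ℕ) (β : Fin m → ℤ), 1 ≤ n ∧ μ p = latticePoint n β := by
  have hfreq : ∃ᶠ p in 𝓝 q, p ∈ openOrbit m M := mem_closure_iff_frequently.1 (C.dense_orbit q)
  rw [frequently_iff_forall_eventually_exists_and] at hfreq ⊢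
  intro P hP
  obtain ⟨p₁, hp₁, hP₁⟩ := hfreq hP.eventually_nhds
  obtain ⟨ζ, hζ, rfl⟩ := C.exists_point_eq hp₁
  set ρ := C.rho (C.point ζ) with hρ
  have hρΩ : ρ ∈ C.Ω := C.rho_mem hp₁
  have hζρ : ∀ j, ζ j = halfPoint ρ j + Complex.I * ((ζ j).im : ℝ) := by
    intro j
    rw [hρ, C.rho_point hζ, halfPoint]
    apply Complex.ext <;> simp
  -- The angles of the given point are kept fixed and only `ρ` varies, so that the moment map
  -- becomes the open map `∇φ`.
  set g : (Fin m → ℝ) → M := fun ρ' =>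
    C.point fun j => halfPoint ρ' j + Complex.I * ((fun j => (ζ j).im) j : ℝ) with hg
  have hgρ : g ρ = C.point ζ := congrArg C.point (funext fun j => (hζρ j).symm)
  have hgc : ContinuousAt g ρ := by
    have h1 : ContinuousAt C.point (fun j => halfPoint ρ j + Complex.I * ((ζ j).im : ℝ)) := by
      rw [← funext hζρ]; exact C.continuousAt_point hact hζ
    refine ContinuousAt.comp (g := C.point)
      (f := fun ρ' j => halfPoint ρ' j + Complex.I * ((ζ j).im : ℝ)) h1 ?_
    have h2 : Continuous (halfPoint (m := m)) := contDiff_halfPoint.continuous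
    have : Continuous fun ρ' : Fin m → ℝ => fun j => halfPoint ρ' j + Complex.I * ((ζ j).im : ℝ) :=
      continuous_pi fun j => ((continuous_apply j).comp h2).add continuous_const
    exact this.continuousAt
  have hev : ∀ᶠ ρ' in 𝓝 ρ, P (g ρ') ∧ g ρ' ∈ openOrbit m M ∧ μ (g ρ') = grad C.φ ρ' := by
    filter_upwards [hgc.eventually (by rw [hgρ]; exact hP₁), C.isOpen_Ω.mem_nhds hρΩ]
      with ρ' h1 h2
    have h3 := C.halfPoint_mem h2
    have h4 : g ρ' ∈ openOrbit m M := C.point_mem (C.add_I_mem_tube h3 _)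
    refine ⟨h1, h4, ?_⟩
    have h5 : C.rho (g ρ') = ρ' := by
      rw [C.rho_point (C.add_I_mem_tube h3 _)]
      ext j; simp [halfPoint]; ring
    have h6 := C.moment_eq _ h4
    change μ (g ρ') = grad C.φ (C.rho (g ρ')) at h6
    rw [h6, h5]
  have hev2 : {x | ∃ ρ', grad C.φ ρ' = x ∧ P (g ρ') ∧ g ρ' ∈ openOrbit m M ∧
      μ (g ρ') = grad C.φ ρ'} ∈ 𝓝 (grad C.φ ρ) := by
    rw [← C.map_nhds_grad hact hpos hμ hρΩ]
    exact mem_map.2 (hev.mono fun ρ' h1 => ⟨ρ', rfl, h1⟩)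
  have hdense : Dense (range fun a : Fin m → ℚ => fun j => (a j : ℝ)) :=
    DenseRange.piMap fun _ => Rat.denseRange_cast
  obtain ⟨x, ⟨a, rfl⟩, ρ', h1, h2, h3, h4⟩ := hdense.inter_nhds_nonempty hev2
  -- The product of all denominators serves as common denominator.
  refine ⟨g ρ', ⟨h3, ∏ j, (a j).den, fun j => (a j).num * ∏ i ∈ Finset.univ.erase j, (a i).den,
    Finset.one_le_prod' fun j _ => (a j).pos, ?_⟩, h2⟩
  rw [h4, h1]
  ext j
  have h5 : (((∏ i, (a i).den : ℕ)) : ℝ) = (a j).den * ∏ i ∈ Finset.univ.erase j, ((a i).den : ℝ) := by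
    rw [Nat.cast_prod, Finset.mul_prod_erase Finset.univ (fun i => ((a i).den : ℝ)) (Finset.mem_univ j)]
  have h6 : (∏ i ∈ Finset.univ.erase j, ((a i).den : ℝ)) ≠ 0 :=
    Finset.prod_ne_zero_iff.2 fun i _ => by exact_mod_cast (a i).den_nz
  have h7 : ((a j).den : ℝ) ≠ 0 := by exact_mod_cast (a j).den_nz
  rw [latticePoint, h5]
  push_cast
  rw [mul_div_mul_right _ _ h6]
  have h8 := congrArg (fun r : ℚ => (r : ℝ)) (Rat.num_div_den (a j))
  push_cast at h8
  exact h8.symm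

end LogCoordinates
end Monomials

/-! ## Monomial sections with exponents in the moment polytope are bounded -/

section MonomialBound

variable {m : ℕ} {M : Type*} [TopologicalSpace M] [ChartedSpace (Model m) M]
  [IsManifold 𝓘(ℂ, Model m) ω M] [MulAction (Torus m) M]
  {L : M → Type*} [TopologicalSpace (TotalSpace ℂ L)] [∀ p, AddCommGroup (L p)]
  [∀ p, Module ℂ (L p)] [∀ p, TopologicalSpace (L p)] [FiberBundle ℂ L]
  [VectorBundle ℂ ℂ L] [ContMDiffVectorBundle ω ℂ L 𝓘(ℂ, Model m)]
  {h : HermitianMetric L m} {A : ToricLift h} {μ : M → Fin m → ℝ} [Nonempty M]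

namespace LogCoordinates

variable (C : LogCoordinates h A μ)

/-- The power `n` appears only as an overall factor in the exponent; after an `n`-th root, estimates
for these sections depend only on the slope `β / n`. -/
lemma norm_coeff_monomialSection_sq {n : ℕ} (hn : 1 ≤ n) (β : Fin m → ℤ) {p : M}
    (hp : p ∈ openOrbit m M) {v : L p} (hv : v ≠ 0) :
    ‖h.coeff v (C.monomialSection n β p)‖ ^ 2 =
      Real.exp (n * (C.legendre (latticePoint n β) p - Real.log (h.normSq v))) := by
  have h1 := h.norm_innerPow_self hv (C.monomialSection n β p)
  have h0 := h.normSq_pos hv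
  rw [C.innerPow_monomialSection n β hp, Complex.norm_real,
    C.monomialDensity_eq_exp hn β hp, Real.norm_of_nonneg (Real.exp_pos _).le] at h1
  rw [mul_sub, Real.exp_sub, h1, Real.exp_nat_mul (Real.log _), Real.exp_log h0,
    mul_div_cancel_right₀ _ (by positivity)]

/-- The point `q` may lie off the open orbit, and `μ q` need not be rational. Points `p'` of the
open orbit near `q` with `μ p' = β / n` give genuine sections `z^β e^{⊗n}`, bounded over the open
orbit by `legendre_le`. The mean value property on a disc centred at `p'`, with boundary circle in a
fixed compact subset of the open orbit, bounds the section at `p'` uniformly in `n`. As `p'` is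
where the slope `μ p'` attains its maximum, this bounds `legendre (μ p')` everywhere; then `p'`
tends to `q`. -/
theorem exists_legendre_le (hact : IsToricAction m M) (hpos : h.IsPositive)
    (hμ : IsMomentMap h μ) (q : M) : ∃ B, ∀ p ∈ openOrbit m M, C.legendre (μ q) p ≤ B := by
  set c := chartAt (Model m) q with hc
  have hqs : q ∈ c.source := mem_chart_source _ q
  have hqb := mem_baseSet_self (L := L) q
  set ν : M → ℝ := fun p => h.normSq (localFrame L q p) with hν
  have hν0 : 0 < ν q := h.normSq_pos (localFrame_ne_zero hqb)
  have hνc := continuousAt_normSq_localFrame h hqb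
  obtain ⟨V, hV, hVo, hqV⟩ := eventually_nhds_iff.1
    (((trivializationAt ℂ L q).open_baseSet.eventually_mem hqb).and
      ((hνc.eventually (lt_mem_nhds (half_lt_self hν0))).and
        (hνc.eventually (gt_mem_nhds (lt_two_mul_self hν0)))))
  set W := c.target ∩ c.symm ⁻¹' V with hWdef
  have hW : IsOpen W := isOpen_chart_preimage q hVo
  have hD : DifferentiableOn ℂ (generatorDet q) W :=
    (hact.differentiableOn_generatorDet q).mono inter_subset_left
  have hDM : ∀ w ∈ W, generatorDet q w ≠ 0 ↔ c.symm w ∈ openOrbit m M := fun w hw =>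
    C.generatorDet_ne_zero_iff hact hw.1
  have hqW : c q ∈ W := ⟨c.map_source hqs, by rw [mem_preimage, c.left_inv hqs]; exact hqV⟩
  obtain ⟨v, r, U, hr, hr1, hU, hqU, hUW, hcirc⟩ := exists_disc_ne_zero hW hD hqW
    (C.frequently_generatorDet_ne_zero hact hqW.1)
  obtain ⟨δ, hδ, hδU⟩ := Metric.nhds_basis_closedBall.mem_iff.1 (hU.mem_nhds hqU)
  -- the compact set of points on the circles
  set K : Set (Model m × ℂ) := Metric.closedBall (c q) δ ×ˢ Metric.sphere (0 : ℂ) r with hK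
  have hKc : IsCompact K := (isCompact_closedBall _ _).prod (isCompact_sphere _ _)
  have hKW : ∀ a ∈ K, a.1 + a.2 • v ∈ W ∧ c.symm (a.1 + a.2 • v) ∈ openOrbit m M := by
    intro a ha
    have h1 := hUW a.1 (hδU ha.1) a.2 (Metric.sphere_subset_ball hr1 ha.2)
    exact ⟨h1, (hDM _ h1).1 (hcirc a.1 (hδU ha.1) a.2 ha.2)⟩
  have hsymm : ContinuousOn (fun a : Model m × ℂ => c.symm (a.1 + a.2 • v)) K :=
    c.continuousOn_symm.comp (by fun_prop) fun a ha => (hKW a ha).1.1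
  have hρK : ContinuousOn (fun a : Model m × ℂ => C.rho (c.symm (a.1 + a.2 • v))) K :=
    C.continuousOn_rho.comp hsymm fun a ha => (hKW a ha).2
  have hφK : ContinuousOn (fun a : Model m × ℂ => C.φ (C.rho (c.symm (a.1 + a.2 • v)))) K :=
    C.continuousOn_φ_rho.comp hsymm fun a ha => (hKW a ha).2
  have hνK : ContinuousOn (fun a : Model m × ℂ => Real.log (ν (c.symm (a.1 + a.2 • v)))) K := by
    have h1 : ContinuousOn ν V := fun p hp =>
      (continuousAt_normSq_localFrame h (hV p hp).1).continuousWithinAt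
    refine (h1.comp hsymm fun a ha => (hKW a ha).1.2).log fun a ha => ?_
    exact (h.normSq_pos (localFrame_ne_zero (hV _ (hKW a ha).1.2).1)).ne'
  -- One constant serves all circles and all slopes in the unit ball about `μ q`, hence all `n` and
  -- `β` that occur.
  obtain ⟨C₀, hC₀⟩ := ((isCompact_closedBall (μ q) 1).prod hKc).exists_bound_of_continuousOn
    (f := fun b : (Fin m → ℝ) × (Model m × ℂ) =>
      C.legendre b.1 (c.symm (b.2.1 + b.2.2 • v)) - Real.log (ν (c.symm (b.2.1 + b.2.2 • v)))) (by
    have hmaps : MapsTo (Prod.snd : (Fin m → ℝ) × (Model m × ℂ) → _)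
      (Metric.closedBall (μ q) 1 ×ˢ K) K := fun b hb => hb.2
    refine ContinuousOn.sub (ContinuousOn.sub (continuousOn_finsetSum _ fun j _ => ?_) ?_) ?_
    · exact (((continuous_apply j).comp continuous_fst).continuousOn).mul
        ((continuous_apply j).comp_continuousOn (hρK.comp continuousOn_snd hmaps))
    · exact hφK.comp continuousOn_snd hmaps
    · exact hνK.comp continuousOn_snd hmaps)
  refine ⟨C₀ + Real.log (2 * ν q), fun p hp => ?_⟩
  -- the bound at rational values of the moment map near `q`
  have hrat : ∃ᶠ p' in 𝓝 q, C.legendre (μ p') p ≤ C₀ + Real.log (2 * ν q) := by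
    have hμc : ContinuousAt μ q := hμ.smooth.continuous.continuousAt
    have hcq : ContinuousAt c q := c.continuousAt hqs
    refine ((C.exists_rational_moment hact hpos hμ q).and_eventually
      ((hVo.eventually_mem hqV).and ((c.open_source.eventually_mem hqs).and
        ((hμc.eventually (Metric.closedBall_mem_nhds _ one_pos)).and
          (hcq.eventually (Metric.closedBall_mem_nhds _ hδ)))))).mono ?_
    rintro p' ⟨⟨hp', n, β, hn, hβ⟩, hp'V, hp's, hp'μ, hp'δ⟩
    refine (C.legendre_le hact hpos hμ hp hp').trans ?_
    have hbal := hV p' hp'V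
    have hνp : 0 < ν p' := h.normSq_pos (localFrame_ne_zero hbal.1)
    suffices hs : C.legendre (μ p') p' - Real.log (ν p') ≤ C₀ by
      have := Real.log_le_log hνp hbal.2.2.le
      linarith
    have hn0 : (0 : ℝ) < n := by exact_mod_cast hn
    set f : Model m → ℂ := fun w =>
      h.coeff (localFrame L q (c.symm w)) (C.monomialSection n β (c.symm w)) with hf
    have hnorm : ∀ w ∈ W, generatorDet q w ≠ 0 → ‖f w‖ ^ 2 =
        Real.exp (n * (C.legendre (μ p') (c.symm w) - Real.log (ν (c.symm w)))) := by
      intro w hw h0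
      rw [hβ]
      exact C.norm_coeff_monomialSection_sq hn β ((hDM w hw).1 h0)
        (localFrame_ne_zero (hV _ hw.2).1)
    have hfd : DifferentiableOn ℂ f (W ∩ {u | generatorDet q u ≠ 0}) :=
      (C.isHolomorphicOver_monomialSection n β q).mono fun w hw =>
        ⟨hw.1.1, (hDM w hw.1).1 hw.2, (hV _ hw.1.2).1⟩
    -- This bound depends on `n`, which is harmless: it only serves to remove the singularities
    -- along the zeros of `generatorDet`.
    have hfb : ∀ u ∈ W, generatorDet q u ≠ 0 → ‖f u‖ ≤
        1 + Real.exp (n * (C.legendre (μ p') p' - Real.log (ν q / 2))) := by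
      intro u hu h0
      have h1 := hnorm u hu h0
      have h2 : Real.exp (n * (C.legendre (μ p') (c.symm u) - Real.log (ν (c.symm u)))) ≤
          Real.exp (n * (C.legendre (μ p') p' - Real.log (ν q / 2))) := by
        have h3 := C.legendre_le hact hpos hμ ((hDM u hu).1 h0) hp'
        have h4 := Real.log_le_log (half_pos hν0) (hV _ hu.2).2.1.le
        gcongr
      nlinarith [sq_nonneg (‖f u‖ - 1)]
    have hu : c p' ∈ U := hδU hp'δ
    have hcp : c.symm (c p') = p' := c.left_inv hp's
    have hpW : c p' ∈ W := ⟨c.map_source hp's, by rw [mem_preimage, hcp]; exact hp'V⟩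
    have hu0 : generatorDet q (c p') ≠ 0 := (hDM _ hpW).2 (by rw [hcp]; exact hp')
    have havg := circleAverage_eq_of_disc hW hD hr hr1 (hUW _ hu) (hcirc _ hu) hu0 hfd hfb
    have hle : ‖f (c p')‖ ≤ Real.exp (n * C₀ / 2) := by
      rw [← havg]
      refine norm_circleAverage_le hr fun ζ hζ => ?_
      have hK' : (c p', ζ) ∈ K := ⟨hp'δ, hζ⟩
      have h1 := hnorm _ (hKW _ hK').1 (hcirc _ hu ζ hζ)
      have h2 := (le_abs_self _).trans (hC₀ (μ p', (c p', ζ)) ⟨hp'μ, hK'⟩)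
      refine le_of_sq_le_sq ?_ (Real.exp_pos _).le
      rw [h1, ← Real.exp_nat_mul]
      refine Real.exp_le_exp.2 ?_
      simp only at h2
      have := mul_le_mul_of_nonneg_left h2 hn0.le
      push_cast
      linarith
    have h5 := hnorm _ hpW hu0
    rw [hcp] at h5
    have h6 : ‖f (c p')‖ ^ 2 ≤ Real.exp (n * C₀ / 2) ^ 2 := by gcongr
    rw [h5, ← Real.exp_nat_mul, Real.exp_le_exp] at h6
    push_cast at h6
    have h7 : n * (C.legendre (μ p') p' - Real.log (ν p')) ≤ n * C₀ := by linarith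
    exact le_of_mul_le_mul_left h7 hn0
  -- For fixed `p` the Legendre expression is affine in the slope, so the bound passes to the limit
  -- `p' → q`.
  have hcont : ContinuousAt (fun p' => C.legendre (μ p') p) q := by
    have hμc : Continuous μ := hμ.smooth.continuous
    have : Continuous fun p' => C.legendre (μ p') p := by unfold legendre; fun_prop
    exact this.continuousAt
  by_contra hlt
  push Not at hlt
  exact hrat ((hcont.eventually (lt_mem_nhds hlt)).mono fun p' h1 => not_le.2 h1)

/-- A monomial with exponent in `N P` extends to a holomorphic section over `M`. -/
theorem exists_monomial_extension (hact : IsToricAction m M) (hpos : h.IsPositive)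
    (hμ : IsMomentMap h μ) {N : ℕ} (hN : 1 ≤ N) {k : Fin m → ℤ}
    (hk : latticePoint N k ∈ range μ) :
    ∃ S : ∀ p, ⨂[ℂ]^N (L p), h.IsHolomorphicSection S ∧
      ∀ p ∈ openOrbit m M, S p = C.monomialSection N k p := by
  obtain ⟨q, hq⟩ := hk
  obtain ⟨B, hB⟩ := C.exists_legendre_le hact hpos hμ q
  refine C.exists_section_extension hact (C.isHolomorphicOver_monomialSection N k) fun q' =>
    ⟨Real.exp (N * B), ?_⟩
  filter_upwards [self_mem_nhdsWithin] with p hp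
  rw [C.innerPow_monomialSection N k hp, C.monomialDensity_eq_exp hN k hp, ← hq,
    Complex.norm_real, Real.norm_of_nonneg (Real.exp_pos _).le]
  have := hB p hp
  gcongr

end LogCoordinates
end MonomialBound

/-! ## The exponents of holomorphic monomial sections lie in the moment polytope -/

section Polytope

variable {m : ℕ} {M : Type*} [TopologicalSpace M] [ChartedSpace (Model m) M]
  [IsManifold 𝓘(ℂ, Model m) ω M] [MulAction (Torus m) M]
  {L : M → Type*} [TopologicalSpace (TotalSpace ℂ L)] [∀ p, AddCommGroup (L p)]
  [∀ p, Module ℂ (L p)] [∀ p, TopologicalSpace (L p)] [FiberBundle ℂ L]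
  [VectorBundle ℂ ℂ L] [ContMDiffVectorBundle ω ℂ L 𝓘(ℂ, Model m)]
  {h : HermitianMetric L m} {A : ToricLift h} {μ : M → Fin m → ℝ}

lemma contDiffOn_one_of_differentiableOn {U : Set (Model m)} (hU : IsOpen U) {f : Model m → ℂ}
    (hf : DifferentiableOn ℂ f U) : ContDiffOn ℂ 1 f U := by
  rw [show (1 : WithTop ℕ∞) = 0 + 1 from rfl, contDiffOn_succ_iff_fderiv_of_isOpen hU]
  exact ⟨hf, by simp, contDiffOn_zero.2 (continuousOn_fderiv_of_differentiableOn hU hf)⟩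

lemma eventually_lt_of_hasDerivAt_pos {g : ℝ → ℝ} {d x : ℝ} (hg : HasDerivAt g d x) (hd : 0 < d) :
    ∀ᶠ s in 𝓝[>] x, g x < g s := by
  have h1 := (hasDerivAt_iff_tendsto_slope.1 hg).eventually (lt_mem_nhds hd)
  filter_upwards [h1.filter_mono (nhdsWithin_mono x fun s (hs : x < s) => hs.ne'),
    self_mem_nhdsWithin] with s hs hxs
  exact (slope_pos_iff_of_le (le_of_lt hxs)).1 hs

/-- The squared norm of a holomorphic section is continuously differentiable. -/
lemma HermitianMetric.IsHolomorphicSection.contDiffAt_normSq {N : ℕ} {S : ∀ p, ⨂[ℂ]^N (L p)}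
    (hS : h.IsHolomorphicSection S) (x : M) {w : Model m}
    (hw : w ∈ (chartAt (Model m) x).target ∩
      (chartAt (Model m) x).symm ⁻¹' (trivializationAt ℂ L x).baseSet) :
    ContDiffAt ℝ 1 (fun w => (h.innerPow (S ((chartAt (Model m) x).symm w))
      (S ((chartAt (Model m) x).symm w))).re) w := by
  set c := chartAt (Model m) x
  have hV := isOpen_chart_preimage (m := m) x (trivializationAt ℂ L x).open_baseSet
  have hfr := isHolomorphicFrame_localFrame (m := m) L x
  have h1 := ((contDiffOn_one_of_differentiableOn hV (hS.differentiableOn hfr x)).contDiffAt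
    (hV.mem_nhds hw)).restrict_scalars ℝ
  have h2 : ContDiffAt ℝ 1 (fun w => h.normSq (localFrame L x (c.symm w))) w :=
    ((h.contDiffOn_normSq_frame hfr x).contDiffAt (hV.mem_nhds hw)).of_le
      ENat.LEInfty.out
  refine ((h1.norm_sq ℝ).mul (h2.pow N)).congr_of_eventuallyEq ?_
  filter_upwards [hV.mem_nhds hw] with u hu
  rw [h.innerPow_self (localFrame_ne_zero hu.2), Complex.ofReal_re]

namespace LogCoordinates

variable (C : LogCoordinates h A μ) [Nonempty M]

/-- The direction `-iX_a` is the motion `ζ + s a` in the tube, under which `ρ` moves by `2 s a`.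
There `log ‖S‖² = N(⟨k/N, ρ⟩ - φ(ρ))`, with gradient `N(k/N - μ)` in `ρ`. -/
lemma fderiv_normSq_of_mem (hact : IsToricAction m M) {N : ℕ} (hN : 1 ≤ N) {k : Fin m → ℤ}
    {S : ∀ p, ⨂[ℂ]^N (L p)} (hS : h.IsHolomorphicSection S)
    (hSk : ∀ p ∈ openOrbit m M, S p = C.monomialSection N k p) (x : M) {w : Model m}
    (hw : w ∈ (chartAt (Model m) x).target ∩
      (chartAt (Model m) x).symm ⁻¹' (trivializationAt ℂ L x).baseSet)
    (hwM : (chartAt (Model m) x).symm w ∈ openOrbit m M) (a : Fin m → ℝ) :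
    fderiv ℝ (fun w => (h.innerPow (S ((chartAt (Model m) x).symm w))
      (S ((chartAt (Model m) x).symm w))).re) w (-Complex.I • generatorField x w a) =
    2 * N * (∑ j, (latticePoint N k j - μ ((chartAt (Model m) x).symm w) j) * a j) *
      (h.innerPow (S ((chartAt (Model m) x).symm w)) (S ((chartAt (Model m) x).symm w))).re := by
  set c := chartAt (Model m) x with hc
  set G : Model m → ℝ := fun w => (h.innerPow (S (c.symm w)) (S (c.symm w))).re with hG
  obtain ⟨ζ, hζ, hζp⟩ := C.exists_point_eq hwM
  have hps : C.point ζ ∈ c.source := by rw [hζp]; exact c.map_target hw.1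
  have hcw : c (C.point ζ) = w := by rw [hζp]; exact c.right_inv hw.1
  have hnorm : ∀ p ∈ openOrbit m M, (h.innerPow (S p) (S p)).re =
      Real.exp (N * C.legendre (latticePoint N k) p) := by
    intro p hp
    rw [hSk p hp, C.innerPow_monomialSection N k hp, Complex.ofReal_re,
      C.monomialDensity_eq_exp hN k hp]
  have h1 : HasFDerivAt G (fderiv ℝ G w) (c (C.point ζ)) := by
    rw [hcw]; exact ((hS.contDiffAt_normSq x hw).differentiableAt (by simp)).hasFDerivAt
  have h2 : HasFDerivAt (fun ζ => c (C.point ζ)) _ ζ :=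
    ((C.contDiffAt_point hact hζ hps).1.differentiableAt (by simp)).hasFDerivAt.restrictScalars ℝ
  have hcurve : HasDerivAt (fun s : ℝ => ζ + s • (fun j => (a j : ℂ))) (fun j => (a j : ℂ)) 0 := by
    simpa using ((hasDerivAt_id (0 : ℝ)).smul_const (fun j => (a j : ℂ))).const_add ζ
  have h3 := HasFDerivAt.comp_hasDerivAt (l := fun ζ => c (C.point ζ)) (0 : ℝ)
    (by simpa using h2) hcurve
  have h4 := HasFDerivAt.comp_hasDerivAt (l := G) (0 : ℝ) (by simpa using h1) h3
  rw [ContinuousLinearMap.coe_restrictScalars', C.fderiv_point hact hζ hps a, hcw] at h4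
  set ρ := C.rho (C.point ζ) with hρ
  have hρΩ : ρ ∈ C.Ω := C.rho_mem (C.point_mem hζ)
  have hφ : HasDerivAt (fun s : ℝ => C.φ (ρ + s • ((2 : ℝ) • a)))
      (∑ j, ((2 : ℝ) • a) j * grad C.φ ρ j) 0 := by
    rw [← C.fderiv_φ_apply]
    have hl : HasDerivAt (fun s : ℝ => ρ + s • ((2 : ℝ) • a)) ((2 : ℝ) • a) 0 := by
      simpa using ((hasDerivAt_id (0 : ℝ)).smul_const ((2 : ℝ) • a)).const_add ρ
    have h5 : HasFDerivAt C.φ (fderiv ℝ C.φ ρ) (ρ + (0 : ℝ) • ((2 : ℝ) • a)) := by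
      rw [zero_smul, add_zero]
      exact (((C.contDiffOn_φ hact).contDiffAt (C.isOpen_Ω.mem_nhds hρΩ)).differentiableAt
        (by simp)).hasFDerivAt
    exact h5.comp_hasDerivAt (0 : ℝ) hl
  have hlin : HasDerivAt (fun s : ℝ => ∑ j, latticePoint N k j * (ρ + s • ((2 : ℝ) • a)) j)
      (∑ j, latticePoint N k j * ((2 : ℝ) • a) j) 0 := by
    refine HasDerivAt.fun_sum fun j _ => ?_
    have : HasDerivAt (fun s : ℝ => ρ j + s * (2 * a j)) (2 * a j) 0 := by
      simpa using ((hasDerivAt_id (0 : ℝ)).mul_const (2 * a j)).const_add (ρ j)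
    exact this.const_mul _
  have h6 := ((hlin.sub hφ).const_mul (N : ℝ)).exp
  have h7 : (G ∘ (fun ζ => c (C.point ζ)) ∘ fun s : ℝ => ζ + s • (fun j => (a j : ℂ))) =ᶠ[𝓝 0]
      fun s : ℝ => Real.exp (N * (((fun s : ℝ => ∑ j, latticePoint N k j *
        (ρ + s • ((2 : ℝ) • a)) j) - fun s : ℝ => C.φ (ρ + s • ((2 : ℝ) • a))) s)) := by
    have hc0 : ContinuousAt (fun s : ℝ => ζ + s • (fun j => (a j : ℂ))) 0 := hcurve.continuousAt
    have e1 : ∀ᶠ s : ℝ in 𝓝 0, ζ + s • (fun j => (a j : ℂ)) ∈ C.tube :=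
      hc0.eventually (p := fun z => z ∈ C.tube) (by
        simpa using C.isOpen_tube.eventually_mem hζ)
    have e2 : ∀ᶠ s : ℝ in 𝓝 0, C.point (ζ + s • (fun j => (a j : ℂ))) ∈ c.source := by
      have : ContinuousAt (fun s : ℝ => C.point (ζ + s • (fun j => (a j : ℂ)))) 0 :=
        ContinuousAt.comp (g := C.point) (by simpa using C.continuousAt_point hact hζ) hc0
      exact this.eventually (p := fun z => z ∈ c.source) (by
        simpa using c.open_source.eventually_mem hps)
    filter_upwards [e1, e2] with s hs1 hs2
    simp only [Function.comp, hG]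
    rw [c.left_inv hs2, hnorm _ (C.point_mem hs1), legendre]
    have h8 : C.rho (C.point (ζ + s • fun j => (a j : ℂ))) = ρ + s • ((2 : ℝ) • a) := by
      rw [C.rho_point hs1, hρ, C.rho_point hζ]
      ext j; simp; ring
    rw [h8]
    rfl
  have h9 := h4.unique (h6.congr_of_eventuallyEq h7)
  rw [h9]
  have h10 : G w = Real.exp (N * C.legendre (latticePoint N k) (C.point ζ)) := by
    simp only [hG]; rw [← hζp, hnorm _ (C.point_mem hζ)]
  have h11 : μ (c.symm w) = grad C.φ ρ := by rw [← hζp]; exact C.moment_eq _ (C.point_mem hζ)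
  change _ = _ * G w
  rw [h10, h11, legendre]
  simp only [Pi.sub_apply, zero_smul, add_zero, Pi.smul_apply, smul_eq_mul, ← hρ]
  have h12 : (∑ j, latticePoint N k j * (2 * a j)) - ∑ j, 2 * a j * grad C.φ ρ j =
      2 * ∑ j, (latticePoint N k j - grad C.φ ρ j) * a j := by
    rw [← Finset.sum_sub_distrib, Finset.mul_sum]
    exact Finset.sum_congr rfl fun j _ => by ring
  rw [h12]
  ring

/-- The derivative of `‖S‖²` along `-i X_a`, for a holomorphic section which is a monomial. -/
theorem fderiv_normSq (hact : IsToricAction m M) {N : ℕ} (hN : 1 ≤ N) {k : Fin m → ℤ}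
    {S : ∀ p, ⨂[ℂ]^N (L p)} (hS : h.IsHolomorphicSection S) (hμ : IsMomentMap h μ)
    (hSk : ∀ p ∈ openOrbit m M, S p = C.monomialSection N k p) (p : M) (a : Fin m → ℝ) :
    fderiv ℝ (fun w => (h.innerPow (S ((chartAt (Model m) p).symm w))
      (S ((chartAt (Model m) p).symm w))).re) (chartAt (Model m) p p)
        (-Complex.I • generatorField p (chartAt (Model m) p p) a) =
    2 * N * (∑ j, (latticePoint N k j - μ p j) * a j) * (h.innerPow (S p) (S p)).re := by
  set c := chartAt (Model m) p with hc
  have hps : p ∈ c.source := mem_chart_source _ p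
  have hw : c p ∈ c.target ∩ c.symm ⁻¹' (trivializationAt ℂ L p).baseSet :=
    ⟨c.map_source hps, by rw [mem_preimage, c.left_inv hps]; exact mem_baseSet_self p⟩
  set G : Model m → ℝ := fun w => (h.innerPow (S (c.symm w)) (S (c.symm w))).re with hG
  have hG1 := hS.contDiffAt_normSq p hw
  have hl : ContinuousAt (fun w => fderiv ℝ G w (-Complex.I • generatorField p w a)) (c p) := by
    have h1 : ContinuousAt (fderiv ℝ G) (c p) := hG1.continuousAt_fderiv (by simp)
    have h2 : ContinuousAt (fun w => generatorField p w a) (c p) :=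
      ((hact.differentiableOn_generatorField p a).continuousOn.continuousAt
        (c.open_target.mem_nhds hw.1))
    exact h1.clm_apply (h2.fun_const_smul _)
  have hr : ContinuousAt (fun w => 2 * N * (∑ j, (latticePoint N k j - μ (c.symm w) j) * a j) *
      G w) (c p) := by
    have h1 : ContinuousAt (fun w => μ (c.symm w)) (c p) :=
      (hμ.differentiableAt p hw.1).continuousAt
    refine ContinuousAt.mul (ContinuousAt.mul continuousAt_const (tendsto_finsetSum _
      fun j _ => ?_)) hG1.continuousAt
    exact (continuousAt_const.sub ((continuous_apply j).continuousAt.comp h1)).mul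
      continuousAt_const
  -- The identity is known on the open orbit; both sides are continuous, so density extends it to
  -- every point.
  have hfreq : ∃ᶠ w in 𝓝 (c p), fderiv ℝ G w (-Complex.I • generatorField p w a) =
      2 * N * (∑ j, (latticePoint N k j - μ (c.symm w) j) * a j) * G w := by
    refine ((C.frequently_generatorDet_ne_zero hact hw.1).and_eventually
      ((isOpen_chart_preimage p (trivializationAt ℂ L p).open_baseSet).eventually_mem hw)).mono ?_
    rintro w ⟨h1, h2⟩
    exact C.fderiv_normSq_of_mem hact hN hS hSk p h2
      ((C.generatorDet_ne_zero_iff hact h2.1).1 h1) a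
  have h3 : fderiv ℝ G (c p) (-Complex.I • generatorField p (c p) a) =
      2 * N * (∑ j, (latticePoint N k j - μ (c.symm (c p)) j) * a j) * G (c p) := by
    by_contra hne
    exact hfreq ((hl.sub hr).eventually_ne (sub_ne_zero.2 hne) |>.mono
      fun w hw => sub_ne_zero.1 hw)
  have h4 : G (c p) = (h.innerPow (S p) (S p)).re :=
    congrArg (fun q => (h.innerPow (S q) (S q)).re) (c.left_inv hps)
  rw [h3, h4, c.left_inv hps]

/-- If a monomial section is holomorphic over `M` then its exponent lies in `N P`. -/
theorem mem_range_of_monomial (hact : IsToricAction m M) (hpos : h.IsPositive)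
    (hμ : IsMomentMap h μ) (hproper : IsProperMap μ) {N : ℕ} (hN : 1 ≤ N) {k : Fin m → ℤ}
    {S : ∀ p, ⨂[ℂ]^N (L p)} (hS : h.IsHolomorphicSection S)
    (hSk : ∀ p ∈ openOrbit m M, S p = C.monomialSection N k p) :
    latticePoint N k ∈ range μ := by
  set y := latticePoint N k with hy
  obtain ⟨p₀, hp₀⟩ := C.dense_orbit.nonempty
  set E : (Fin m → ℝ) → ℝ := fun x => ∑ j, (x j - y j) ^ 2 with hE
  have hEc : Continuous E := by simp only [hE]; fun_prop
  set R := E (μ p₀) with hR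
  have hcomp : IsCompact {x | E x ≤ R} := by
    refine Metric.isCompact_of_isClosed_isBounded (isClosed_le hEc continuous_const) ?_
    refine (Metric.isBounded_closedBall (x := y) (r := 1 + R)).subset fun x hx => ?_
    have hR0 : 0 ≤ R := Finset.sum_nonneg fun j _ => sq_nonneg _
    rw [Metric.mem_closedBall, dist_pi_le_iff (by positivity)]
    intro j
    have h1 : (x j - y j) ^ 2 ≤ E x :=
      Finset.single_le_sum (f := fun j => (x j - y j) ^ 2) (fun j _ => sq_nonneg _)
        (Finset.mem_univ j)
    have h2 : E x ≤ R := hx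
    rw [Real.dist_eq, abs_le]
    constructor <;> nlinarith [sq_nonneg (x j - y j - 1), sq_nonneg (x j - y j + 1)]
  -- `‖S‖²` need not attain a maximum on `M`, so it is maximized on the compact preimage of a ball
  -- about `y`. The radius is chosen to include `p₀`, where `S` does not vanish.
  have hK : IsCompact (μ ⁻¹' {x | E x ≤ R}) := hproper.isCompact_preimage hcomp
  have hnc : Continuous fun p => (h.innerPow (S p) (S p)).re :=
    Complex.continuous_re.comp (hS.continuous_innerPow hS)
  obtain ⟨p, hpK, hpmax⟩ := hK.exists_isMaxOn ⟨p₀, le_refl R⟩ hnc.continuousOn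
  have hn0 : 0 < (h.innerPow (S p) (S p)).re := by
    refine lt_of_lt_of_le ?_ (hpmax (show p₀ ∈ _ from le_refl R))
    simp only []
    rw [hSk p₀ hp₀, C.innerPow_monomialSection N k hp₀, Complex.ofReal_re,
      C.monomialDensity_eq_exp hN k hp₀]
    exact Real.exp_pos _
  refine ⟨p, ?_⟩
  by_contra hne
  -- Along `-iX_a` the derivative of `‖S‖²` is `2N |a|² ‖S‖²`, while that of `|μ - y|²` is `-4`
  -- times the curvature form at `(X_a, X_a)`.
  set a : Fin m → ℝ := y - μ p with ha
  have ha0 : 0 < ∑ j, (y j - μ p j) * a j := by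
    have hane : a ≠ 0 := fun h0 => hne (sub_eq_zero.1 h0).symm
    obtain ⟨j, hj⟩ := Function.ne_iff.1 hane
    refine Finset.sum_pos' (fun j _ => ?_) ⟨j, Finset.mem_univ j, ?_⟩
    · exact mul_self_nonneg (a j)
    · exact mul_self_pos.2 hj
  set c := chartAt (Model m) p with hc
  have hps : p ∈ c.source := mem_chart_source _ p
  set X := generatorField p (c p) a with hX
  have hnd := C.fderiv_normSq hact hN hS hμ hSk p a
  have hndpos : 0 < fderiv ℝ (fun w => (h.innerPow (S (c.symm w)) (S (c.symm w))).re) (c p)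
      (-Complex.I • X) := by
    rw [hnd]
    have : (0 : ℝ) < N := by exact_mod_cast hN
    positivity
  have hX0 : X ≠ 0 := fun h0 => by
    rw [h0, smul_zero, map_zero] at hndpos
    exact lt_irrefl _ hndpos
  have hEd := hμ.sum_fderiv hact p a
  have hcurv := hpos p X hX0
  have hcurve : HasDerivAt (fun s : ℝ => c p + s • (-Complex.I • X)) (-Complex.I • X) 0 := by
    simpa using ((hasDerivAt_id (0 : ℝ)).smul_const (-Complex.I • X)).const_add (c p)
  have hw : c p ∈ c.target ∩ c.symm ⁻¹' (trivializationAt ℂ L p).baseSet :=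
    ⟨c.map_source hps, by rw [mem_preimage, c.left_inv hps]; exact mem_baseSet_self p⟩
  have hd1 := HasFDerivAt.comp_hasDerivAt
    (l := fun w => (h.innerPow (S (c.symm w)) (S (c.symm w))).re) (0 : ℝ)
    (by simpa using ((hS.contDiffAt_normSq p hw).differentiableAt (by simp)).hasFDerivAt) hcurve
  have hd2 := HasFDerivAt.comp_hasDerivAt (l := fun w => μ (c.symm w)) (0 : ℝ)
    (by simpa using (hμ.differentiableAt p hw.1).hasFDerivAt) hcurve
  have hd3 : HasDerivAt (fun s : ℝ => E (μ (c.symm (c p + s • (-Complex.I • X)))))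
      (∑ j, 2 * (μ p j - y j) *
        fderiv ℝ (fun w => μ (c.symm w)) (c p) (-Complex.I • X) j) 0 := by
    refine HasDerivAt.fun_sum fun j _ => ?_
    have h1 := (((hasDerivAt_pi.1 hd2) j).sub_const (y j)).fun_pow 2
    have h2 : c.symm (c p + (0 : ℝ) • (-Complex.I • X)) = p := by
      rw [zero_smul, add_zero, c.left_inv hps]
    simp only [Function.comp, h2, Nat.cast_ofNat, Nat.add_one_sub_one, pow_one] at h1
    exact h1
  have hd3neg : (∑ j, 2 * (μ p j - y j) *
        fderiv ℝ (fun w => μ (c.symm w)) (c p) (-Complex.I • X) j) < 0 := by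
    have : (∑ j, 2 * (μ p j - y j) *
        fderiv ℝ (fun w => μ (c.symm w)) (c p) (-Complex.I • X) j) =
        -2 * ∑ j, a j * fderiv ℝ (fun w => μ (c.symm w)) (c p) (-Complex.I • X) j := by
      rw [Finset.mul_sum]
      exact Finset.sum_congr rfl fun j _ => by simp only [ha, Pi.sub_apply]; ring
    rw [this, hEd]
    linarith
  have e1 := eventually_lt_of_hasDerivAt_pos hd1 hndpos
  have e2 := eventually_lt_of_hasDerivAt_pos hd3.neg (neg_pos.2 hd3neg)
  -- A small step makes `‖S‖²` larger without leaving the compact set, since `|μ - y|²` decreases.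
  -- This covers a maximum on the boundary of that set as well.
  obtain ⟨s, hs1, hs2⟩ := (e1.and e2).exists
  have h0 : c p + (0 : ℝ) • (-Complex.I • X) = c p := by rw [zero_smul, add_zero]
  have h1 : (h.innerPow (S (c.symm (c p + (0 : ℝ) • (-Complex.I • X))))
      (S (c.symm (c p + (0 : ℝ) • (-Complex.I • X))))).re = (h.innerPow (S p) (S p)).re :=
    congrArg (fun q => (h.innerPow (S q) (S q)).re) (by rw [h0, c.left_inv hps])
  simp only [Function.comp] at hs1
  rw [h1] at hs1
  simp only [Pi.neg_apply, h0, c.left_inv hps, neg_lt_neg_iff] at hs2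
  have hsK : c.symm (c p + s • (-Complex.I • X)) ∈ μ ⁻¹' {x | E x ≤ R} :=
    hs2.le.trans (show E (μ p) ≤ R from hpK)
  exact absurd (hpmax hsK) (not_le.2 hs1)

end LogCoordinates
end Polytope

/-! ## Evaluation of square integrable sections -/

section Evaluation

variable {m : ℕ} {M : Type*} [TopologicalSpace M] [ChartedSpace (Model m) M]
  [IsManifold 𝓘(ℂ, Model m) ω M] [MulAction (Torus m) M]
  {L : M → Type*} [TopologicalSpace (TotalSpace ℂ L)] [∀ p, AddCommGroup (L p)]
  [∀ p, Module ℂ (L p)] [∀ p, TopologicalSpace (L p)] [FiberBundle ℂ L]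
  [VectorBundle ℂ ℂ L] [ContMDiffVectorBundle ω ℂ L 𝓘(ℂ, Model m)]
  {h : HermitianMetric L m} [MeasurableSpace M] [BorelSpace M]

/-- Where the density of the volume is at least `d`, it dominates `d` times Lebesgue measure. -/
lemma ToricLift.smul_map_volume_le (A : ToricLift h) (hact : IsToricAction m M) {x : M}
    {B : Set (Model m)} (hB : MeasurableSet B) {d : ℝ}
    (hBt : ∀ w ∈ B, w ∈ (chartAt (Model m) x).target ∧
      (chartAt (Model m) x).symm w ∈ (trivializationAt ℂ L x).baseSet ∧
      d ≤ potentialDet h x x w) :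
    ENNReal.ofReal d • (volume.restrict B).map (chartAt (Model m) x).symm ≤ h.kahlerVolume := by
  set c := chartAt (Model m) x with hc
  refine le_trans ?_ (le_iSup h.chartVolume x)
  refine Measure.le_intro fun S hS _ => ?_
  have hm : AEMeasurable c.symm (volume.restrict B) :=
    (c.continuousOn_symm.mono fun w hw => (hBt w hw).1).aemeasurable hB
  rw [chartVolume_apply h x hS, Measure.smul_apply, Measure.map_apply_of_aemeasurable hm hS,
    Measure.restrict_apply₀ (hm.nullMeasurableSet_preimage hS), smul_eq_mul]
  have hsub : c.symm ⁻¹' S ∩ B ⊆ c.target ∩ c.symm ⁻¹' S := fun w hw => ⟨(hBt w hw.2).1, hw.1⟩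
  refine le_trans ?_ (lintegral_mono_set hsub)
  rw [← setLIntegral_const]
  have hmeas : MeasurableSet (c.symm ⁻¹' S ∩ B) := by
    have : c.symm ⁻¹' S ∩ B = (c.target ∩ c.symm ⁻¹' S) ∩ B := by
      ext w; exact ⟨fun hw => ⟨hsub hw, hw.2⟩, fun hw => ⟨hw.1.2, hw.2⟩⟩
    rw [this]
    exact (measurableSet_chart_preimage x hS).inter hB
  refine setLIntegral_mono' hmeas fun w hw => ENNReal.ofReal_le_ofReal ?_
  have h1 := hBt w hw.2
  have h2 : c.symm w ∈ (trivializationAt ℂ L (c.symm w)).baseSet := mem_baseSet_self _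
  rw [A.potentialDet_frame hact h1.1 h2 h1.2.1]
  exact h1.2.2

/-- Holomorphic sections are locally bounded by their `L²` norm. -/
theorem ToricLift.exists_coeff_bound (A : ToricLift h) (hact : IsToricAction m M)
    (hpos : h.IsPositive) (N : ℕ) (x : M) :
    ∃ (Γ : ENNReal) (U : Set M), Γ ≠ ⊤ ∧ IsOpen U ∧ x ∈ U ∧ U ⊆ (chartAt (Model m) x).source ∧
      U ⊆ (trivializationAt ℂ L x).baseSet ∧
      ∀ S : ∀ p, ⨂[ℂ]^N (L p), h.IsHolomorphicSection S → ∀ p ∈ U,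
        ‖h.coeff (localFrame L x p) (S p)‖ₑ ^ 2 ≤
          Γ * ∫⁻ p, ‖h.innerPow (S p) (S p)‖ₑ ∂h.kahlerVolume := by
  set c := chartAt (Model m) x with hc
  have hxs : x ∈ c.source := mem_chart_source _ x
  have hxb := mem_baseSet_self (L := L) x
  have hcx : c.symm (c x) = x := c.left_inv hxs
  set d := potentialDet h x x (c x) / 2 with hd
  have hdpos : 0 < potentialDet h x x (c x) :=
    A.potentialDet_pos hact hpos (c.map_source hxs) (by rw [hcx]; exact hxb)
  have hd0 : 0 < d := half_pos hdpos
  have hdet : ContinuousAt (potentialDet h x x) (c x) :=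
    continuousAt_potentialDet (c.map_source hxs) (by rw [hcx]; exact hxb)
  set ν : M → ℝ := fun p => h.normSq (localFrame L x p) with hν
  have hν0 : 0 < ν x := h.normSq_pos (localFrame_ne_zero hxb)
  have hνc : ContinuousAt (fun w => ν (c.symm w)) (c x) :=
    ContinuousAt.comp (g := ν) (by rw [hcx]; exact continuousAt_normSq_localFrame h hxb)
      (c.continuousAt_symm (c.map_source hxs))
  have hev : ∀ᶠ w in 𝓝 (c x), (w ∈ c.target ∧ c.symm w ∈ (trivializationAt ℂ L x).baseSet ∧
      d ≤ potentialDet h x x w) ∧ ν x / 2 ≤ ν (c.symm w) := by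
    filter_upwards [(isOpen_chart_preimage (m := m) x (trivializationAt ℂ L x).open_baseSet).mem_nhds
      ⟨c.map_source hxs, by rw [mem_preimage, hcx]; exact hxb⟩,
      hdet.eventually (le_mem_nhds (half_lt_self hdpos)),
      hνc.eventually (p := fun t => ν x / 2 ≤ t) (by
        simp only [hcx]; exact le_mem_nhds (half_lt_self hν0))] with w h1 h2 h3
    exact ⟨⟨h1.1, h1.2, h2⟩, h3⟩
  obtain ⟨R, hR, hRW⟩ := Metric.eventually_nhds_iff_ball.1 hev
  -- A ball of radius `2r` about a point of the `r`-ball stays inside the `R`-ball, which leaves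
  -- room for the sub-mean value inequality at every point of the neighbourhood.
  set r := R / 3 with hr
  have hr0 : 0 < r := by positivity
  set κ : ENNReal := ENNReal.ofReal ((ν x / 2) ^ N) with hκ
  have hκ0 : κ ≠ 0 := by simp only [hκ, ne_eq, ENNReal.ofReal_eq_zero, not_le]; positivity
  have hdE : ENNReal.ofReal d ≠ 0 := by simpa using hd0
  have hvol : volume (Metric.ball (0 : Model m) r) ≠ 0 := (Metric.measure_ball_pos _ _ hr0).ne'
  have hvolT : volume (Metric.ball (0 : Model m) r) ≠ ⊤ := measure_ball_lt_top.ne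
  refine ⟨(κ * ENNReal.ofReal d * volume (Metric.ball (0 : Model m) r))⁻¹,
    c.source ∩ c ⁻¹' Metric.ball (c x) r, ?_, c.isOpen_inter_preimage Metric.isOpen_ball,
    ⟨hxs, Metric.mem_ball_self hr0⟩, inter_subset_left, ?_, ?_⟩
  · exact ENNReal.inv_ne_top.2 (mul_ne_zero (mul_ne_zero hκ0 hdE) hvol)
  · rintro p ⟨hp1, hp2⟩
    have := (hRW (c p) (Metric.ball_subset_ball (by linarith) hp2)).1.2.1
    rwa [c.left_inv hp1] at this
  rintro S hS p ⟨hp1, hp2⟩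
  have hfr := isHolomorphicFrame_localFrame (m := m) L x
  set f : Model m → ℂ := fun w => h.coeff (localFrame L x (c.symm w)) (S (c.symm w)) with hf
  have hsub : ∀ {s : ℝ}, s ≤ 2 * r → Metric.ball (c p) s ⊆ Metric.ball (c x) R := fun hs =>
    Metric.ball_subset_ball' (by
      have : dist (c p) (c x) < r := hp2
      linarith)
  have h1 := enorm_sq_mul_volume_ball_le (f := f) (w := c p) (r := r) (R := 2 * r) (by linarith)
    ((hS.differentiableOn hfr x).mono fun w hw => by
      have := (hRW w (hsub le_rfl hw)).1
      exact ⟨this.1, this.2.1⟩)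
  set B := Metric.ball (c p) r with hB
  have hBR : B ⊆ Metric.ball (c x) R := hsub (by linarith)
  have hm : AEMeasurable c.symm (volume.restrict B) :=
    (c.continuousOn_symm.mono fun w hw => (hRW w (hBR hw)).1.1).aemeasurable
      Metric.isOpen_ball.measurableSet
  have hcont : Continuous fun p => ‖h.innerPow (S p) (S p)‖ₑ :=
    (hS.continuous_innerPow hS).enorm
  have h2 : κ * ∫⁻ u in B, ‖f u‖ₑ ^ 2 ≤
      ∫⁻ u in B, ‖h.innerPow (S (c.symm u)) (S (c.symm u))‖ₑ := by
    refine (lintegral_const_mul_le _ _).trans (setLIntegral_mono' Metric.isOpen_ball.measurableSet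
      fun u hu => ?_)
    have h3 := hRW u (hBR hu)
    have h4 := h.norm_innerPow_self (localFrame_ne_zero h3.1.2.1) (S (c.symm u))
    have h5 : ‖f u‖ₑ ^ 2 = ENNReal.ofReal (‖f u‖ ^ 2) := by
      rw [ENNReal.ofReal_pow (norm_nonneg _), ofReal_norm]
    rw [h5, hκ, ← ENNReal.ofReal_mul (by positivity), ← ofReal_norm, h4]
    refine ENNReal.ofReal_le_ofReal ?_
    rw [mul_comm]
    have := pow_le_pow_left₀ (by positivity) h3.2 N
    gcongr
  have h3 : ENNReal.ofReal d * ∫⁻ u in B, ‖h.innerPow (S (c.symm u)) (S (c.symm u))‖ₑ ≤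
      ∫⁻ p, ‖h.innerPow (S p) (S p)‖ₑ ∂h.kahlerVolume := by
    have h4 := A.smul_map_volume_le hact (x := x) (B := B) Metric.isOpen_ball.measurableSet
      (d := d) fun w hw => (hRW w (hBR hw)).1
    have h5 := lintegral_mono' h4 (le_refl fun p => ‖h.innerPow (S p) (S p)‖ₑ)
    rwa [lintegral_smul_measure, lintegral_map' hcont.aemeasurable hm] at h5
  have h4 : ‖h.coeff (localFrame L x p) (S p)‖ₑ = ‖f (c p)‖ₑ := by
    exact (congrArg (fun q => ‖h.coeff (localFrame L x q) (S q)‖ₑ) (c.left_inv hp1)).symm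
  rw [h4, mul_comm, ← div_eq_mul_inv, ENNReal.le_div_iff_mul_le
    (Or.inl (mul_ne_zero (mul_ne_zero hκ0 hdE) hvol))
    (Or.inl (ENNReal.mul_ne_top (ENNReal.mul_ne_top ENNReal.ofReal_ne_top ENNReal.ofReal_ne_top)
      hvolT))]
  calc ‖f (c p)‖ₑ ^ 2 * (κ * ENNReal.ofReal d * volume (Metric.ball (0 : Model m) r))
      = ENNReal.ofReal d * (κ * (‖f (c p)‖ₑ ^ 2 * volume (Metric.ball (0 : Model m) r))) := by ring
    _ ≤ ENNReal.ofReal d * (κ * ∫⁻ u in B, ‖f u‖ₑ ^ 2) := by gcongr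
    _ ≤ _ := (by gcongr : _ ≤ ENNReal.ofReal d * _).trans h3

end Evaluation

/-! ## The Hilbert space of square integrable holomorphic sections -/

section HilbertSpace

variable {m : ℕ} {M : Type*} [TopologicalSpace M] [ChartedSpace (Model m) M]
  [IsManifold 𝓘(ℂ, Model m) ω M] [MulAction (Torus m) M]
  {L : M → Type*} [TopologicalSpace (TotalSpace ℂ L)] [∀ p, AddCommGroup (L p)]
  [∀ p, Module ℂ (L p)] [∀ p, TopologicalSpace (L p)] [FiberBundle ℂ L]
  [VectorBundle ℂ ℂ L] [ContMDiffVectorBundle ω ℂ L 𝓘(ℂ, Model m)]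
  {h : HermitianMetric L m} {A : ToricLift h} {μ : M → Fin m → ℝ}
  [MeasurableSpace M] [BorelSpace M] [SecondCountableTopology M] [Nonempty M]

namespace LogCoordinates

variable (C : LogCoordinates h A μ) {N : ℕ}

/-- The function `F e^{-Nφ/2}` on the open orbit representing the section `F e^{⊗N}`. -/
def l2Function (S : ∀ p, ⨂[ℂ]^N (L p)) : M → ℂ :=
  (openOrbit m M).indicator fun p =>
    h.coeff (C.e p) (S p) * (Real.exp (-(N * C.φ (C.rho p) / 2)) : ℂ)

lemma l2Function_mul_conj (S T : ∀ p, ⨂[ℂ]^N (L p)) {p : M} (hp : p ∈ openOrbit m M) :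
    C.l2Function S p * conj (C.l2Function T p) = h.innerPow (S p) (T p) := by
  have h1 : Real.exp (-(N * C.φ (C.rho p) / 2)) * Real.exp (-(N * C.φ (C.rho p) / 2)) =
      Real.exp (-C.φ (C.rho p)) ^ N := by
    rw [← Real.exp_add, ← Real.exp_nat_mul]; congr 1; ring
  rw [h.innerPow_eq (C.frame_e.ne_zero p hp), C.normSq_e_eq hp, ← h1, l2Function, l2Function,
    indicator_of_mem hp, indicator_of_mem hp, map_mul, Complex.conj_ofReal]
  push_cast
  ring

lemma norm_l2Function_sq (S : ∀ p, ⨂[ℂ]^N (L p)) {p : M} (hp : p ∈ openOrbit m M) :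
    ‖C.l2Function S p‖ ^ 2 = ‖h.innerPow (S p) (S p)‖ := by
  rw [← C.l2Function_mul_conj S S hp, norm_mul, RCLike.norm_conj, sq]

lemma ae_mem_openOrbit (C : LogCoordinates h A μ) (hact : IsToricAction m M) :
    ∀ᵐ p ∂h.kahlerVolume, p ∈ openOrbit m M :=
  C.kahlerVolume_compl_openOrbit hact

lemma aestronglyMeasurable_l2Function {S : ∀ p, ⨂[ℂ]^N (L p)} (hS : h.IsHolomorphicSection S) :
    AEStronglyMeasurable (C.l2Function S) h.kahlerVolume := by
  have h1 : ContinuousOn (fun p => h.coeff (C.e p) (S p) *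
      (Real.exp (-(N * C.φ (C.rho p) / 2)) : ℂ)) (openOrbit m M) := by
    refine (hS C.e _ C.frame_e).continuousOn.mul ?_
    exact Complex.continuous_ofReal.comp_continuousOn (Real.continuous_exp.comp_continuousOn
      ((continuousOn_const.mul C.continuousOn_φ_rho).div_const 2).neg)
  have hm := C.isOpen_orbit.measurableSet
  classical
  exact ((h1.measurable_piecewise (g := fun _ => (0 : ℂ)) continuousOn_const hm).aestronglyMeasurable).congr
    (Eventually.of_forall fun p => by
      by_cases hp : p ∈ openOrbit m M <;> simp [l2Function, hp, Set.piecewise])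

lemma memLp_l2Function_iff (hact : IsToricAction m M) {S : ∀ p, ⨂[ℂ]^N (L p)}
    (hS : h.IsHolomorphicSection S) : MemLp (C.l2Function S) 2 h.kahlerVolume ↔
      Integrable (fun p => h.innerPow (S p) (S p)) h.kahlerVolume := by
  rw [memLp_two_iff_integrable_sq_norm (C.aestronglyMeasurable_l2Function hS),
    ← integrable_norm_iff (hS.continuous_innerPow hS).aestronglyMeasurable]
  refine integrable_congr ?_
  filter_upwards [C.ae_mem_openOrbit hact] with p hp using C.norm_l2Function_sq S hp

lemma l2Function_add (S T : ∀ p, ⨂[ℂ]^N (L p)) :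
    C.l2Function (S + T) = C.l2Function S + C.l2Function T := by
  ext p
  by_cases hp : p ∈ openOrbit m M <;> simp [l2Function, hp, add_mul]

lemma l2Function_smul (a : ℂ) (S : ∀ p, ⨂[ℂ]^N (L p)) :
    C.l2Function (a • S) = a • C.l2Function S := by
  ext p
  by_cases hp : p ∈ openOrbit m M <;> simp [l2Function, hp, mul_assoc]

variable (N) in
/-- The space of square integrable holomorphic sections of `L^N`. -/
def l2Sections : Submodule ℂ (∀ p, ⨂[ℂ]^N (L p)) where
  carrier := {S | h.IsHolomorphicSection S ∧ MemLp (C.l2Function S) 2 h.kahlerVolume}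
  add_mem' := by
    rintro S T ⟨h1, h2⟩ ⟨h3, h4⟩
    refine ⟨fun e U he => ?_, by rw [C.l2Function_add]; exact h2.add h4⟩
    have := (h1 e U he).add (h3 e U he)
    refine this.congr fun p _ => ?_
    simp
  zero_mem' := by
    refine ⟨fun e U he => ?_, ?_⟩
    · simp only [Pi.zero_apply, map_zero]
      exact mdifferentiableOn_const
    · have : C.l2Function (0 : ∀ p, ⨂[ℂ]^N (L p)) = 0 := by
        ext p; by_cases hp : p ∈ openOrbit m M <;> simp [l2Function, hp]
      rw [this]
      exact MemLp.zero
  smul_mem' := by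
    rintro a S ⟨h1, h2⟩
    refine ⟨fun e U he => ?_, by rw [C.l2Function_smul]; exact h2.const_smul a⟩
    have := (h1 e U he).const_smul a
    refine this.congr fun p _ => ?_
    simp

lemma mem_l2Sections_iff (hact : IsToricAction m M) {S : ∀ p, ⨂[ℂ]^N (L p)} :
    S ∈ C.l2Sections N ↔ h.IsL2HolomorphicSection S :=
  ⟨fun hS => ⟨hS.1, (C.memLp_l2Function_iff hact hS.1).1 hS.2⟩,
    fun hS => ⟨hS.1, (C.memLp_l2Function_iff hact hS.1).2 hS.2⟩⟩

variable (N) in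
/-- The embedding of the space of sections into `L²`. -/
def toL2 : C.l2Sections N →ₗ[ℂ] Lp ℂ 2 h.kahlerVolume where
  toFun S := S.2.2.toLp (C.l2Function S.1)
  map_add' S T := by
    rw [← MemLp.toLp_add]
    exact MemLp.toLp_congr _ _ (Eventually.of_forall fun p => by
      rw [← C.l2Function_add]; rfl)
  map_smul' a S := by
    rw [RingHom.id_apply, ← MemLp.toLp_const_smul]
    exact MemLp.toLp_congr _ _ (Eventually.of_forall fun p => by
      rw [← C.l2Function_smul]; rfl)

lemma coeFn_toL2 (S : C.l2Sections N) :
    C.toL2 N S =ᵐ[h.kahlerVolume] C.l2Function S.1 := MemLp.coeFn_toLp S.2.2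

/-- The order is exchanged because the `L²` inner product is conjugate linear in its first argument
and `hilb` in its second. -/
lemma inner_toL2 (hact : IsToricAction m M) (S T : C.l2Sections N) :
    inner ℂ (C.toL2 N S) (C.toL2 N T) = h.hilb T.1 S.1 := by
  rw [L2.inner_def, HermitianMetric.hilb]
  refine integral_congr_ae ?_
  filter_upwards [C.coeFn_toL2 S, C.coeFn_toL2 T, C.ae_mem_openOrbit hact] with p h1 h2 h3
  rw [h1, h2, RCLike.inner_apply, C.l2Function_mul_conj _ _ h3]

lemma enorm_toL2_sq (hact : IsToricAction m M) (S : C.l2Sections N) :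
    ‖C.toL2 N S‖ₑ ^ 2 = ∫⁻ p, ‖h.innerPow (S.1 p) (S.1 p)‖ₑ ∂h.kahlerVolume := by
  have h1 : ‖C.toL2 N S‖ₑ = eLpNorm (C.l2Function S.1) 2 h.kahlerVolume := by
    rw [Lp.enorm_def]
    exact eLpNorm_congr_ae (C.coeFn_toL2 S)
  have h2 := eLpNorm_nnreal_pow_eq_lintegral (f := C.l2Function S.1) (μ := h.kahlerVolume)
    (p := 2) two_ne_zero
  rw [h1]
  simp only [ENNReal.coe_ofNat, NNReal.coe_ofNat, ENNReal.rpow_ofNat] at h2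
  rw [h2]
  refine lintegral_congr_ae ?_
  filter_upwards [C.ae_mem_openOrbit hact] with p hp
  rw [← ofReal_norm, ← ofReal_norm, ← C.norm_l2Function_sq S.1 hp,
    ENNReal.ofReal_pow (norm_nonneg _)]

/-- Evaluation is locally uniformly bounded in the `L²` norm. -/
theorem exists_norm_coeff_le (hact : IsToricAction m M) (hpos : h.IsPositive) (N : ℕ) (x : M) :
    ∃ (Γ : ℝ) (U : Set M), 0 ≤ Γ ∧ IsOpen U ∧ x ∈ U ∧ U ⊆ (chartAt (Model m) x).source ∧
      U ⊆ (trivializationAt ℂ L x).baseSet ∧ ∀ S : C.l2Sections N, ∀ p ∈ U,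
        ‖h.coeff (localFrame L x p) (S.1 p)‖ ≤ Γ * ‖C.toL2 N S‖ := by
  obtain ⟨Γ, U, hΓ, hU, hxU, hUs, hUb, hb⟩ := A.exists_coeff_bound hact hpos N x
  refine ⟨Real.sqrt Γ.toReal, U, Real.sqrt_nonneg _, hU, hxU, hUs, hUb, fun S p hp => ?_⟩
  have h1 := hb S.1 S.2.1 p hp
  rw [← C.enorm_toL2_sq hact S] at h1
  have h2 := ENNReal.toReal_mono (ENNReal.mul_ne_top hΓ (by finiteness)) h1
  simp only [ENNReal.toReal_mul, ENNReal.toReal_pow, toReal_enorm] at h2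
  refine le_of_sq_le_sq ?_ (by positivity)
  rw [mul_pow, Real.sq_sqrt ENNReal.toReal_nonneg]
  exact h2

/-- The evaluation bound makes a section of zero `L²` norm vanish at every point, not merely almost
everywhere. -/
lemma toL2_injective (hact : IsToricAction m M) (hpos : h.IsPositive) (N : ℕ) :
    Function.Injective (C.toL2 N) := by
  rw [injective_iff_map_eq_zero]
  intro S hS
  ext1
  funext p
  obtain ⟨Γ, U, -, -, hpU, -, hUb, hb⟩ := C.exists_norm_coeff_le hact hpos N p
  have h1 := hb S p hpU
  rw [hS, norm_zero, mul_zero] at h1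
  have h2 := norm_le_zero_iff.1 h1
  exact h.coeff_injective (localFrame_ne_zero (hUb hpU)) (by rw [h2]; simp)

end LogCoordinates
end HilbertSpace

/-! ## Completeness and the Bergman kernel -/

section Completeness

variable {m : ℕ} {M : Type*} [TopologicalSpace M] [ChartedSpace (Model m) M]
  [IsManifold 𝓘(ℂ, Model m) ω M] [MulAction (Torus m) M]
  {L : M → Type*} [TopologicalSpace (TotalSpace ℂ L)] [∀ p, AddCommGroup (L p)]
  [∀ p, Module ℂ (L p)] [∀ p, TopologicalSpace (L p)] [FiberBundle ℂ L]
  [VectorBundle ℂ ℂ L] [ContMDiffVectorBundle ω ℂ L 𝓘(ℂ, Model m)]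
  {h : HermitianMetric L m} {A : ToricLift h} {μ : M → Fin m → ℝ}
  [MeasurableSpace M] [BorelSpace M] [SecondCountableTopology M] [Nonempty M]

namespace LogCoordinates

variable (C : LogCoordinates h A μ) {N : ℕ}

lemma coeff_eq_mul_coeff (h : HermitianMetric L m) {p : M} {v e : L p} (he : e ≠ 0)
    (S : ⨂[ℂ]^N (L p)) : h.coeff v S =
      h.coeff e S * h.coeff v (PiTensorProduct.tprod ℂ fun _ : Fin N => e) := by
  conv_lhs => rw [← h.coeff_smul_tprod he S, map_smul, smul_eq_mul]

/-- The space of square integrable holomorphic sections is closed in `L²`. -/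
theorem isClosed_range_toL2 (hact : IsToricAction m M) (hpos : h.IsPositive) (N : ℕ) :
    IsClosed (LinearMap.range (C.toL2 N) : Set (Lp ℂ 2 h.kahlerVolume)) := by
  refine IsSeqClosed.isClosed fun Φ φ hΦ hlim => ?_
  choose S hS using hΦ
  obtain rfl : (fun n => C.toL2 N (S n)) = Φ := funext hS
  choose Γ U hΓ hU hxU hUs hUb hb using fun x => C.exists_norm_coeff_le hact hpos N x
  have hcauchy : ∀ x, UniformCauchySeqOn
      (fun n p => h.coeff (localFrame L x p) ((S n).1 p)) atTop (U x) := by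
    intro x
    rw [Metric.uniformCauchySeqOn_iff]
    intro ε hε
    obtain ⟨n₀, hn₀⟩ := Metric.cauchySeq_iff.1 hlim.cauchySeq (ε / (Γ x + 1))
      (div_pos hε (by have := hΓ x; positivity))
    refine ⟨n₀, fun n hn n' hn' p hp => ?_⟩
    have h1 := hn₀ n hn n' hn'
    have h2 := hb x (S n - S n') p hp
    rw [map_sub, ← dist_eq_norm] at h2
    have h3 : h.coeff (localFrame L x p) ((S n - S n').1 p) =
        h.coeff (localFrame L x p) ((S n).1 p) - h.coeff (localFrame L x p) ((S n').1 p) :=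
      map_sub _ _ _
    rw [h3, ← dist_eq_norm] at h2
    have h4 := hΓ x
    rw [lt_div_iff₀ (by positivity)] at h1
    nlinarith [dist_nonneg (x := C.toL2 N (S n)) (y := C.toL2 N (S n'))]
  have hpt : ∀ p, ∃ g, Tendsto (fun n => h.coeff (localFrame L p p) ((S n).1 p)) atTop (𝓝 g) :=
    fun p => cauchySeq_tendsto_of_complete ((hcauchy p).cauchySeq (hxU p))
  choose G hG using hpt
  set T : ∀ p, ⨂[ℂ]^N (L p) := fun p =>
    G p • PiTensorProduct.tprod ℂ fun _ : Fin N => localFrame L p p with hT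
  have hlf : ∀ p, localFrame L p p ≠ 0 := fun p => localFrame_ne_zero (mem_baseSet_self p)
  have hGT : ∀ p, h.coeff (localFrame L p p) (T p) = G p := fun p => by
    rw [hT, map_smul, h.coeff_tprod (hlf p), smul_eq_mul, mul_one]
  have htend : ∀ p (v : L p), Tendsto (fun n => h.coeff v ((S n).1 p)) atTop
      (𝓝 (h.coeff v (T p))) := by
    intro p v
    rw [coeff_eq_mul_coeff h (hlf p) (T p), hGT]
    refine ((hG p).mul_const _).congr fun n => ?_
    rw [← coeff_eq_mul_coeff h (hlf p)]
  have hThol : h.IsHolomorphicSection T := by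
    refine HermitianMetric.isHolomorphicSection_of_localFrame fun x => ?_
    have h1 : TendstoUniformlyOn (fun n p => h.coeff (localFrame L x p) ((S n).1 p))
        (fun p => h.coeff (localFrame L x p) (T p)) atTop (U x) :=
      (hcauchy x).tendstoUniformlyOn_of_tendsto fun p _ => htend p _
    set c := chartAt (Model m) x
    have hV : IsOpen (c.target ∩ c.symm ⁻¹' U x) := isOpen_chart_preimage x (hU x)
    have h2 : DifferentiableOn ℂ (fun w => h.coeff (localFrame L x (c.symm w)) (T (c.symm w)))
        (c.target ∩ c.symm ⁻¹' U x) := by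
      refine differentiableOn_of_tendstoUniformlyOn hV
        (f := fun n w => h.coeff (localFrame L x (c.symm w)) ((S n).1 (c.symm w)))
        (fun n => ?_) ((h1.comp c.symm).mono inter_subset_right)
      exact ((S n).2.1.differentiableOn (isHolomorphicFrame_localFrame (m := m) L x) x).mono
        fun w hw => ⟨hw.1, hUb x hw.2⟩
    have hxs : x ∈ c.source := mem_chart_source _ x
    have hx : c x ∈ c.target ∩ c.symm ⁻¹' U x :=
      ⟨c.map_source hxs, by rw [mem_preimage, c.left_inv hxs]; exact hxU x⟩
    exact mdifferentiableAt_of_comp_chart_symm hxs ((h2 _ hx).differentiableAt (hV.mem_nhds hx))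
  have hl2 : ∀ p, Tendsto (fun n => C.l2Function (S n).1 p) atTop (𝓝 (C.l2Function T p)) := by
    intro p
    by_cases hp : p ∈ openOrbit m M
    · simp only [l2Function, indicator_of_mem hp]
      exact (htend p _).mul_const _
    · simp only [l2Function, indicator_of_notMem hp]
      exact tendsto_const_nhds
  have hae : φ =ᵐ[h.kahlerVolume] C.l2Function T := by
    -- A subsequence converges almost everywhere to the `L²` limit, which identifies it with the
    -- pointwise limit section.
    obtain ⟨ns, hns, hns'⟩ := (tendstoInMeasure_of_tendsto_Lp hlim).exists_seq_tendsto_ae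
    have h1 : ∀ᵐ p ∂h.kahlerVolume, ∀ n, C.toL2 N (S n) p = C.l2Function (S n).1 p :=
      ae_all_iff.2 fun n => C.coeFn_toL2 (S n)
    filter_upwards [hns', h1] with p h2 h3
    simp only [h3] at h2
    exact tendsto_nhds_unique h2 ((hl2 p).comp hns.tendsto_atTop)
  have hTmem : MemLp (C.l2Function T) 2 h.kahlerVolume := (memLp_congr_ae hae).1 (Lp.memLp φ)
  refine ⟨⟨T, hThol, hTmem⟩, ?_⟩
  refine Lp.ext ((C.coeFn_toL2 _).trans hae.symm)

/-- This is Parseval's identity in the closed subspace of sections: once the functionals are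
represented by vectors, the sum over the basis is their inner product and no longer involves the
basis. -/
lemma hasSum_of_inner (hact : IsToricAction m M) (hpos : h.IsPositive)
    {f g : C.l2Sections N →ₗ[ℂ] ℂ} {a b : LinearMap.range (C.toL2 N)}
    (ha : ∀ S, f S = inner ℂ (a : Lp ℂ 2 h.kahlerVolume) (C.toL2 N S))
    (hb : ∀ S, g S = inner ℂ (b : Lp ℂ 2 h.kahlerVolume) (C.toL2 N S))
    {ι : Type*} {s : ι → ∀ p, ⨂[ℂ]^N (L p)} (hs : h.IsOrthonormalBasis s) :
    HasSum (fun j => g ⟨s j, (C.mem_l2Sections_iff hact).2 (hs.mem j)⟩ *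
      conj (f ⟨s j, (C.mem_l2Sections_iff hact).2 (hs.mem j)⟩)) (inner ℂ b a) := by
  have : CompleteSpace (LinearMap.range (C.toL2 N)) :=
    (C.isClosed_range_toL2 hact hpos N).completeSpace_coe
  set σ : ι → C.l2Sections N := fun j => ⟨s j, (C.mem_l2Sections_iff hact).2 (hs.mem j)⟩ with hσ
  set v : ι → LinearMap.range (C.toL2 N) := fun j => ⟨C.toL2 N (σ j), LinearMap.mem_range_self _ _⟩
    with hv
  have hvv : ∀ i j, inner ℂ (v i) (v j) = h.hilb (s j) (s i) := fun i j =>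
    C.inner_toL2 hact (σ i) (σ j)
  have horth : Orthonormal ℂ v := by
    refine ⟨fun j => ?_, fun i j hij => ?_⟩
    · have h1 := hvv j j
      have h0 := inner_self_eq_norm_sq_to_K (𝕜 := ℂ) (v j)
      have h2 : ‖v j‖ ^ 2 = 1 := by
        have h3 := h0.symm.trans (h1.trans (hs.norm_one j))
        exact Complex.ofReal_injective (by push_cast; exact h3)
      exact (pow_eq_one_iff_of_nonneg (norm_nonneg _) two_ne_zero).1 h2
    · exact (hvv i j).trans (hs.orthogonal j i (Ne.symm hij))
  have hbot : (Submodule.span ℂ (range v))ᗮ = ⊥ := by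
    rw [eq_bot_iff]
    rintro ⟨x, S, rfl⟩ hx
    rw [Submodule.mem_orthogonal] at hx
    have h1 : S.1 = 0 := hs.complete S.1 ((C.mem_l2Sections_iff hact).1 S.2) fun j => by
      have h2 := hx (v j) (Submodule.subset_span (mem_range_self j))
      have h3 := C.inner_toL2 hact (σ j) S
      rw [← h3]
      exact h2
    have h4 : S = 0 := Subtype.ext h1
    rw [Submodule.mem_bot]
    exact Subtype.ext ((congrArg (C.toL2 N) h4).trans (map_zero _))
  let B := HilbertBasis.mkOfOrthogonalEqBot horth hbot
  have hB := B.hasSum_inner_mul_inner b a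
  rw [HilbertBasis.coe_mkOfOrthogonalEqBot] at hB
  have hterm : (fun j => g (σ j) * conj (f (σ j))) = fun j => inner ℂ b (v j) * inner ℂ (v j) a := by
    ext j
    rw [ha, hb, ← inner_conj_symm (v j) a]
    rfl
  exact hterm ▸ hB

/-- For an orthonormal basis and bounded functionals `f`, `g`, the sum of `g(s_j) conj f(s_j)`
converges to a value independent of the basis. -/
theorem exists_hasSum_functional (hact : IsToricAction m M) (hpos : h.IsPositive)
    (f g : C.l2Sections N →ₗ[ℂ] ℂ) (hf : ∃ Γ, ∀ S, ‖f S‖ ≤ Γ * ‖C.toL2 N S‖)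
    (hg : ∃ Γ, ∀ S, ‖g S‖ ≤ Γ * ‖C.toL2 N S‖) {ι κ : Type*} {s : ι → ∀ p, ⨂[ℂ]^N (L p)}
    (hs : h.IsOrthonormalBasis s) {s' : κ → ∀ p, ⨂[ℂ]^N (L p)} (hs' : h.IsOrthonormalBasis s') :
    ∃ B : ℂ, HasSum (fun j => g ⟨s j, (C.mem_l2Sections_iff hact).2 (hs.mem j)⟩ *
        conj (f ⟨s j, (C.mem_l2Sections_iff hact).2 (hs.mem j)⟩)) B ∧
      HasSum (fun j => g ⟨s' j, (C.mem_l2Sections_iff hact).2 (hs'.mem j)⟩ *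
        conj (f ⟨s' j, (C.mem_l2Sections_iff hact).2 (hs'.mem j)⟩)) B := by
  set H := LinearMap.range (C.toL2 N) with hH
  have : CompleteSpace H := (C.isClosed_range_toL2 hact hpos N).completeSpace_coe
  let J : C.l2Sections N ≃ₗ[ℂ] H := LinearEquiv.ofInjective (C.toL2 N)
    (C.toL2_injective hact hpos N)
  have hJ : ∀ S, (J S : Lp ℂ 2 h.kahlerVolume) = C.toL2 N S := fun S => rfl
  -- The Riesz representation theorem is available because the image of the sections is closed,
  -- hence a Hilbert space.
  have hriesz : ∀ f : C.l2Sections N →ₗ[ℂ] ℂ, (∃ Γ, ∀ S, ‖f S‖ ≤ Γ * ‖C.toL2 N S‖) →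
      ∃ a : H, ∀ S, f S = inner ℂ (a : Lp ℂ 2 h.kahlerVolume) (C.toL2 N S) := by
    rintro f ⟨Γ, hΓ⟩
    let F : H →L[ℂ] ℂ := LinearMap.mkContinuous (f ∘ₗ J.symm.toLinearMap) Γ fun x => by
      obtain ⟨S, rfl⟩ := J.surjective x
      simpa [hJ] using hΓ S
    refine ⟨(InnerProductSpace.toDual ℂ H).symm F, fun S => ?_⟩
    have h1 := InnerProductSpace.toDual_symm_apply (𝕜 := ℂ) (x := J S) (y := F)
    rw [Submodule.coe_inner, hJ] at h1
    rw [h1]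
    simp [F]
  obtain ⟨a, ha⟩ := hriesz f hf
  obtain ⟨b, hb⟩ := hriesz g hg
  exact ⟨inner ℂ b a, C.hasSum_of_inner hact hpos ha hb hs, C.hasSum_of_inner hact hpos ha hb hs'⟩

end LogCoordinates
end Completeness

/-! ## Fourier analysis on the torus -/

section TorusFourier

variable {m : ℕ}

/-- The character `t ↦ t^k` of the torus. -/
def torusChar (k : Fin m → ℤ) (t : Torus m) : ℂ := ∏ j, (t j : ℂ) ^ k j

lemma continuous_torusChar (k : Fin m → ℤ) : Continuous (torusChar k) := by
  refine continuous_finsetProd _ fun j _ => ?_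
  exact (continuous_subtype_val.comp (continuous_apply j)).zpow₀ _ fun t =>
    Or.inl (Circle.coe_ne_zero _)

lemma torusChar_mul (k : Fin m → ℤ) (s t : Torus m) :
    torusChar k (s * t) = torusChar k s * torusChar k t := by
  simp [torusChar, mul_zpow, Finset.prod_mul_distrib]

lemma torusChar_add (k l : Fin m → ℤ) (t : Torus m) :
    torusChar (k + l) t = torusChar k t * torusChar l t := by
  simp [torusChar, zpow_add₀ (Circle.coe_ne_zero _), Finset.prod_mul_distrib]

lemma torusChar_zero (t : Torus m) : torusChar 0 t = 1 := by simp [torusChar]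

lemma norm_torusChar (k : Fin m → ℤ) (t : Torus m) : ‖torusChar k t‖ = 1 := by
  rw [torusChar, norm_prod]
  exact Finset.prod_eq_one fun j _ => by rw [norm_zpow, Circle.norm_coe, one_zpow]

lemma torusChar_ne_zero (k : Fin m → ℤ) (t : Torus m) : torusChar k t ≠ 0 :=
  norm_ne_zero_iff.1 (by rw [norm_torusChar]; exact one_ne_zero)

lemma torusChar_neg_mul (k : Fin m → ℤ) (t : Torus m) : torusChar (-k) t * torusChar k t = 1 := by
  rw [← torusChar_add, neg_add_cancel, torusChar_zero]

lemma conj_torusChar (k : Fin m → ℤ) (t : Torus m) : conj (torusChar k t) = torusChar (-k) t := by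
  have h1 : conj (torusChar k t) * torusChar k t = 1 := by
    rw [mul_comm, Complex.mul_conj, Complex.normSq_eq_norm_sq, norm_torusChar]; simp
  exact mul_right_cancel₀ (torusChar_ne_zero k t) (h1.trans (torusChar_neg_mul k t).symm)

lemma torusChar_expTorus (k : Fin m → ℤ) (θ : Fin m → ℝ) :
    torusChar k (expTorus θ) = character k θ := by
  simp only [torusChar, expTorus, character, Circle.coe_exp, ← Complex.exp_int_mul]
  rw [← Complex.exp_sum]
  congr 1
  push_cast
  rw [Finset.mul_sum]
  exact Finset.sum_congr rfl fun j _ => by ring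

instance : MeasurableSpace (Torus m) := borel _

instance : BorelSpace (Torus m) := ⟨rfl⟩

/-- The invariant probability measure of the torus. -/
def torusHaar (m : ℕ) : Measure (Torus m) := Measure.haarMeasure ⊤

instance : (torusHaar m).IsHaarMeasure := by unfold torusHaar; infer_instance

instance : IsProbabilityMeasure (torusHaar m) :=
  ⟨by have := Measure.haarMeasure_self (K₀ := (⊤ : TopologicalSpace.PositiveCompacts (Torus m)))
      simpa [torusHaar] using this⟩

/-- Translation by an element at which the character equals `-1` negates the integral and, by
invariance, preserves it. -/
lemma integral_torusChar {k : Fin m → ℤ} (hk : k ≠ 0) : ∫ t, torusChar k t ∂torusHaar m = 0 := by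
  obtain ⟨j, hj⟩ := Function.ne_iff.1 hk
  have hkj : (k j : ℝ) ≠ 0 := by exact_mod_cast hj
  set s : Torus m := expTorus (Pi.single j (Real.pi / k j)) with hs
  have h1 : torusChar k s = -1 := by
    rw [hs, torusChar_expTorus, character]
    have h2 : ∑ i, (k i : ℝ) * (Pi.single j (Real.pi / k j) : Fin m → ℝ) i = Real.pi := by
      rw [Finset.sum_eq_single j]
      · rw [Pi.single_eq_same]; field_simp
      · intro i _ hi; rw [Pi.single_eq_of_ne hi, mul_zero]
      · simp
    rw [h2, mul_comm, Complex.exp_pi_mul_I]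
  have h3 := integral_mul_left_eq_self (μ := torusHaar m) (torusChar k) s
  simp only [torusChar_mul, h1, integral_const_mul] at h3
  linear_combination (-1 / 2 : ℂ) * h3

/-- A continuous function on the torus vanishes if all its Fourier coefficients do. -/
theorem eq_zero_of_integral_torusChar {F : Torus m → ℂ} (hF : Continuous F)
    (h0 : ∀ k, ∫ t, torusChar (-k) t * F t ∂torusHaar m = 0) : F = 0 := by
  -- Uniform density of trigonometric polynomials is transported from the additive torus.
  let e : UnitAddTorus (Fin m) ≃ₜ Torus m :=
    Homeomorph.piCongrRight fun _ => AddCircle.homeomorphCircle one_ne_zero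
  have he : ∀ (k : Fin m → ℤ) u, UnitAddTorus.mFourier k u = torusChar k (e u) := by
    intro k u
    simp [UnitAddTorus.mFourier, torusChar, e, fourier_apply, AddCircle.toCircle_zsmul,
      AddCircle.homeomorphCircle_apply]
  have hint : ∀ G : Torus m → ℂ, Continuous G → Integrable G (torusHaar m) := fun G hG =>
    hG.integrable_of_hasCompactSupport (HasCompactSupport.of_compactSpace G)
  let Fe : C(UnitAddTorus (Fin m), ℂ) := ⟨fun u => F (e u), hF.comp e.continuous⟩
  have hspan : ∀ P ∈ Submodule.span ℂ (range (UnitAddTorus.mFourier (d := Fin m))),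
      ∫ t, conj (P (e.symm t)) * F t ∂torusHaar m = 0 := by
    intro P hP
    induction hP using Submodule.span_induction with
    | mem P hP =>
      obtain ⟨k, rfl⟩ := hP
      simp only [he, e.apply_symm_apply, conj_torusChar, h0]
    | zero => simp
    | add P Q _ _ hP hQ =>
      simp only [ContinuousMap.add_apply, map_add, add_mul]
      rw [integral_add, hP, hQ, add_zero]
      · exact hint _ ((Complex.continuous_conj.comp (P.continuous.comp e.symm.continuous)).mul hF)
      · exact hint _ ((Complex.continuous_conj.comp (Q.continuous.comp e.symm.continuous)).mul hF)
    | smul a P _ hP =>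
      simp only [ContinuousMap.smul_apply, smul_eq_mul, map_mul, mul_assoc]
      rw [integral_const_mul, hP, mul_zero]
  have hsq : ∫ t, ‖F t‖ ^ 2 ∂torusHaar m = 0 := by
    -- `F` is orthogonal to all trigonometric polynomials and is a uniform limit of them, so it is
    -- orthogonal to itself.
    have hI : ∫ t, conj (F t) * F t ∂torusHaar m = 0 := by
      by_contra hne
      set K := ∫ t, ‖F t‖ ∂torusHaar m
      have hK : 0 ≤ K := integral_nonneg fun _ => norm_nonneg _
      have hFe : Fe ∈ closure
          (Submodule.span ℂ (range (UnitAddTorus.mFourier (d := Fin m))) : Set _) := by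
        have := UnitAddTorus.span_mFourier_closure_eq_top (d := Fin m)
        rw [← Submodule.topologicalClosure_coe, this]; trivial
      obtain ⟨P, hP, hd⟩ := Metric.mem_closure_iff.1 hFe
        (‖∫ t, conj (F t) * F t ∂torusHaar m‖ / (K + 1))
        (div_pos (norm_pos_iff.2 hne) (by positivity))
      have h1 : ∫ t, conj (F t) * F t ∂torusHaar m =
          ∫ t, conj ((Fe - P) (e.symm t)) * F t ∂torusHaar m := by
        simp only [ContinuousMap.sub_apply, map_sub, sub_mul]
        rw [integral_sub, hspan P hP, sub_zero]
        · simp [Fe]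
        · exact hint _ ((Complex.continuous_conj.comp
            (Fe.continuous.comp e.symm.continuous)).mul hF)
        · exact hint _ ((Complex.continuous_conj.comp
            (P.continuous.comp e.symm.continuous)).mul hF)
      have h2 : ‖∫ t, conj ((Fe - P) (e.symm t)) * F t ∂torusHaar m‖ ≤ ‖Fe - P‖ * K := by
        rw [← integral_const_mul]
        refine norm_integral_le_of_norm_le ((hint F hF).norm.const_mul _)
          (Eventually.of_forall fun t => ?_)
        rw [norm_mul, RCLike.norm_conj]
        gcongr
        exact (Fe - P).norm_coe_le_norm _
      rw [← h1] at h2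
      rw [dist_eq_norm, lt_div_iff₀ (by positivity)] at hd
      have := norm_nonneg (Fe - P)
      nlinarith
    have h3 : ∀ t, conj (F t) * F t = ((‖F t‖ ^ 2 : ℝ) : ℂ) := fun t => by
      rw [mul_comm, Complex.mul_conj, Complex.normSq_eq_norm_sq]
    simp only [h3, integral_complex_ofReal] at hI
    exact_mod_cast hI
  have hc : Continuous fun t => ‖F t‖ ^ 2 := hF.norm.pow 2
  have h4 := (integral_eq_zero_iff_of_nonneg (μ := torusHaar m) (fun t => by positivity)
    (hc.integrable_of_hasCompactSupport (HasCompactSupport.of_compactSpace _))).1 hsq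
  have h5 := Continuous.ae_eq_iff_eq (torusHaar m) hc continuous_zero |>.1 h4
  ext t
  simpa using congrFun h5 t

end TorusFourier

/-! ## Weight decomposition of holomorphic sections -/

section Weights

variable {m : ℕ} {M : Type*} [TopologicalSpace M] [ChartedSpace (Model m) M]
  [IsManifold 𝓘(ℂ, Model m) ω M] [MulAction (Torus m) M]
  {L : M → Type*} [TopologicalSpace (TotalSpace ℂ L)] [∀ p, AddCommGroup (L p)]
  [∀ p, Module ℂ (L p)] [∀ p, TopologicalSpace (L p)] [FiberBundle ℂ L]
  [VectorBundle ℂ ℂ L] [ContMDiffVectorBundle ω ℂ L 𝓘(ℂ, Model m)]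
  {h : HermitianMetric L m} {A : ToricLift h} {μ : M → Fin m → ℝ}

lemma exists_expTorus_eq (t : Torus m) : ∃ θ, expTorus θ = t :=
  ⟨fun j => Complex.arg (t j), funext fun j => Circle.exp_arg (t j)⟩

/-- Invariance kills the derivative in imaginary directions, complex linearity then kills it in all
directions, and a convex set is connected. -/
lemma differentiableOn_eq_const {U : Set (Model m)} (hU : IsOpen U) (hc : Convex ℝ U)
    {H : Model m → ℂ} (hH : DifferentiableOn ℂ H U)
    (hinv : ∀ ζ ∈ U, ∀ θ : Fin m → ℝ, H (fun j => ζ j + Complex.I * θ j) = H ζ) :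
    ∃ c, ∀ ζ ∈ U, H ζ = c := by
  have hreal : ∀ ζ ∈ U, ∀ θ : Fin m → ℝ, fderiv ℂ H ζ (fun j => (θ j : ℂ)) = 0 := by
    intro ζ hζ θ
    have h1 := (hH.differentiableAt (hU.mem_nhds hζ)).hasFDerivAt.restrictScalars ℝ
    have h2 : HasDerivAt (fun r : ℝ => ζ + r • (fun j => Complex.I * (θ j : ℂ)))
        (fun j => Complex.I * (θ j : ℂ)) 0 := by
      simpa using ((hasDerivAt_id (0 : ℝ)).smul_const
        (fun j => Complex.I * (θ j : ℂ))).const_add ζ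
    have h3 : HasFDerivAt H ((fderiv ℂ H ζ).restrictScalars ℝ)
        (ζ + (0 : ℝ) • (fun j => Complex.I * (θ j : ℂ))) := by simpa using h1
    have h4 := h3.comp_hasDerivAt (0 : ℝ) h2
    have h5 : (H ∘ fun r : ℝ => ζ + r • (fun j => Complex.I * (θ j : ℂ))) = fun _ => H ζ := by
      ext r
      rw [← hinv ζ hζ fun j => r * θ j]
      simp only [Function.comp]
      congr 1
      ext j
      simp
      ring
    rw [h5] at h4
    have h6 := h4.unique (hasDerivAt_const _ _)
    have h7 : (fun j => Complex.I * (θ j : ℂ)) = Complex.I • fun j => (θ j : ℂ) := rfl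
    rw [ContinuousLinearMap.coe_restrictScalars', h7, map_smul, smul_eq_mul] at h6
    exact (mul_eq_zero.1 h6).resolve_left Complex.I_ne_zero
  have hz : ∀ ζ ∈ U, fderiv ℂ H ζ = 0 := by
    intro ζ hζ
    ext v
    have hv : v = (fun j => ((v j).re : ℂ)) + Complex.I • fun j => ((v j).im : ℂ) := by
      ext j
      simp [mul_comm Complex.I, Complex.re_add_im]
    rw [hv, map_add, map_smul, hreal ζ hζ, hreal ζ hζ]
    simp
  rcases U.eq_empty_or_nonempty with rfl | ⟨ζ₀, h₀⟩
  · exact ⟨0, fun ζ hζ => hζ.elim⟩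
  · exact ⟨H ζ₀, fun ζ hζ => hU.is_const_of_fderiv_eq_zero hc.isPreconnected hH hz hζ h₀⟩

namespace LogCoordinates

variable (C : LogCoordinates h A μ) {N : ℕ}

lemma monomial_smul (k : Fin m → ℤ) (t : Torus m) {p : M} (hp : p ∈ openOrbit m M) :
    C.monomial k (t • p) = torusChar k t * C.monomial k p := by
  simp only [monomial, torusChar, ← Finset.prod_mul_distrib, C.equivariant_z t p hp, mul_zpow]

lemma rho_smul (t : Torus m) {p : M} (hp : p ∈ openOrbit m M) : C.rho (t • p) = C.rho p := by
  ext j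
  rw [rho, rho, C.equivariant_z t p hp, norm_mul, Circle.norm_coe, one_mul]

/-- The function `F` for which `S = F e^{⊗N}` on the open orbit. -/
def frameCoeff (S : ∀ p, ⨂[ℂ]^N (L p)) (p : M) : ℂ := h.coeff (C.e p) (S p)

lemma innerPow_eq_frameCoeff (S T : ∀ p, ⨂[ℂ]^N (L p)) {p : M} (hp : p ∈ openOrbit m M) :
    h.innerPow (S p) (T p) = C.frameCoeff S p * conj (C.frameCoeff T p) *
      (Real.exp (-C.φ (C.rho p)) ^ N : ℝ) := by
  rw [h.innerPow_eq (C.frame_e.ne_zero p hp), C.normSq_e_eq hp]; rfl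

lemma continuousOn_frameCoeff {S : ∀ p, ⨂[ℂ]^N (L p)} (hS : h.IsHolomorphicSection S) :
    ContinuousOn (C.frameCoeff S) (openOrbit m M) := (hS C.e _ C.frame_e).continuousOn

lemma continuous_frameCoeff_smul {S : ∀ p, ⨂[ℂ]^N (L p)} (hS : h.IsHolomorphicSection S) {p : M}
    (hp : p ∈ openOrbit m M) : Continuous fun t : Torus m => C.frameCoeff S (t • p) :=
  (C.continuousOn_frameCoeff hS).comp_continuous
    (A.continuous_smul.comp (Continuous.prodMk_left p)) fun t => smul_mem_openOrbit hp t

/-- The Fourier coefficient of `F` along the orbits, for `S = F e^{⊗N}`. -/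
def orbitCoeff (S : ∀ p, ⨂[ℂ]^N (L p)) (k : Fin m → ℤ) (p : M) : ℂ :=
  ∫ t, torusChar (-k) t * C.frameCoeff S (t • p) ∂torusHaar m

lemma orbitCoeff_smul (S : ∀ p, ⨂[ℂ]^N (L p)) (k : Fin m → ℤ) (s : Torus m) (p : M) :
    C.orbitCoeff S k (s • p) = torusChar k s * C.orbitCoeff S k p := by
  rw [orbitCoeff, orbitCoeff, ← integral_mul_left_eq_self (μ := torusHaar m)
    (fun t => torusChar (-k) t * C.frameCoeff S (t • p)) s, ← integral_const_mul]
  refine integral_congr_ae (Eventually.of_forall fun t => ?_)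
  simp only [torusChar_mul, smul_smul, mul_comm s t]
  have := torusChar_neg_mul k s
  linear_combination -(torusChar (-k) t * C.frameCoeff S ((t * s) • p)) * this

variable [Nonempty M]

lemma differentiableOn_frameCoeff_point (hact : IsToricAction m M) {S : ∀ p, ⨂[ℂ]^N (L p)}
    (hS : h.IsHolomorphicSection S) :
    DifferentiableOn ℂ (fun ζ => C.frameCoeff S (C.point ζ)) C.tube := by
  intro ζ hζ
  set x := C.point ζ with hx
  have hxM : x ∈ openOrbit m M := C.point_mem hζ
  have hxs : x ∈ (chartAt (Model m) x).source := mem_chart_source _ x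
  have h1 := (differentiableOn_comp_chart_symm (hS C.e _ C.frame_e) x).differentiableAt
    ((isOpen_chart_preimage x C.isOpen_orbit).mem_nhds (x := chartAt (Model m) x x)
      ⟨mem_chart_target _ x, by rw [mem_preimage, (chartAt (Model m) x).left_inv hxs]; exact hxM⟩)
  have h2 := (C.contDiffAt_point hact hζ (x := x) hxs).1.differentiableAt (by simp)
  have h3 := DifferentiableAt.comp ζ (g := fun w => h.coeff (C.e ((chartAt (Model m) x).symm w))
    (S ((chartAt (Model m) x).symm w))) h1 h2
  refine (h3.congr_of_eventuallyEq ?_).differentiableWithinAt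
  have h4 := (C.continuousAt_point hact hζ).eventually
    ((chartAt (Model m) x).open_source.mem_nhds hxs)
  filter_upwards [h4] with ζ' hζ'
  rw [Function.comp, frameCoeff, (chartAt (Model m) x).left_inv hζ']

/-- The Fourier coefficient of weight `k` of a holomorphic section is a multiple of `z^k`. -/
theorem exists_orbitCoeff_eq (hact : IsToricAction m M) {S : ∀ p, ⨂[ℂ]^N (L p)}
    (hS : h.IsHolomorphicSection S) (k : Fin m → ℤ) :
    ∃ c, ∀ p ∈ openOrbit m M, C.orbitCoeff S k p = c * C.monomial k p := by
  have hcont : ContinuousOn (fun ζ => C.point ζ) C.tube := fun ζ hζ =>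
    (C.continuousAt_point hact hζ).continuousWithinAt
  have h1 : DifferentiableOn ℂ (fun ζ => C.orbitCoeff S k (C.point ζ)) C.tube := by
    have h2 := differentiableOn_integral_param (ν := torusHaar m) (K := univ) isCompact_univ
      MeasurableSet.univ C.isOpen_tube
      (F := fun t ζ => torusChar (-k) t * C.frameCoeff S (t • C.point ζ)) ?_ ?_
    · simp only [Measure.restrict_univ] at h2
      exact h2
    · refine ((continuous_torusChar _).comp continuous_fst).continuousOn.mul ?_
      refine (C.continuousOn_frameCoeff hS).comp ?_
        (fun q hq => smul_mem_openOrbit (C.point_mem hq.2) q.1)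
      exact A.continuous_smul.comp_continuousOn
        (continuous_fst.continuousOn.prodMk (hcont.comp continuousOn_snd fun q hq => hq.2))
    · intro t _
      obtain ⟨θ, rfl⟩ := exists_expTorus_eq t
      have h3 : DifferentiableOn ℂ
          (fun ζ => C.frameCoeff S (C.point fun j => ζ j + Complex.I * θ j)) C.tube :=
        (C.differentiableOn_frameCoeff_point hact hS).comp (by fun_prop)
          fun ζ hζ => C.add_I_mem_tube hζ θ
      refine (h3.congr fun ζ hζ => ?_).const_mul _
      rw [C.point_add_I hζ]
  have h2 : ∀ ζ : Model m, (∏ j, Complex.exp (ζ j) ^ k j) ≠ 0 := fun ζ =>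
    Finset.prod_ne_zero_iff.2 fun j _ => zpow_ne_zero _ (Complex.exp_ne_zero _)
  have hd : DifferentiableOn ℂ (fun ζ => C.orbitCoeff S k (C.point ζ) *
      (∏ j, Complex.exp (ζ j) ^ k j)⁻¹) C.tube := by
    refine h1.mul (DifferentiableOn.inv ?_ fun ζ _ => h2 ζ)
    intro ζ _
    refine (HasFDerivAt.finsetProd fun j _ =>
      DifferentiableAt.hasFDerivAt ?_).differentiableAt.differentiableWithinAt
    exact (differentiableAt_apply j _).cexp.zpow (Or.inl (Complex.exp_ne_zero _))
  -- The Fourier coefficient and `e^{⟨k, ζ⟩}` transform by the same character, so their quotient is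
  -- invariant under imaginary translations of the tube. Convexity of `Ω` enters here.
  obtain ⟨c, hc⟩ := differentiableOn_eq_const C.isOpen_tube C.convex_tube hd fun ζ hζ θ => by
    rw [C.point_add_I hζ, C.orbitCoeff_smul]
    have h5 : ∏ j, Complex.exp (ζ j + Complex.I * θ j) ^ k j =
        torusChar k (expTorus θ) * ∏ j, Complex.exp (ζ j) ^ k j := by
      rw [torusChar, ← Finset.prod_mul_distrib]
      refine Finset.prod_congr rfl fun j _ => ?_
      rw [Complex.exp_add, mul_zpow, mul_comm, mul_comm Complex.I]
      rfl
    rw [h5, mul_inv]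
    have := torusChar_ne_zero k (expTorus θ)
    field_simp
  refine ⟨c, fun p hp => ?_⟩
  obtain ⟨ζ, hζ, rfl⟩ := C.exists_point_eq hp
  have h3 := hc ζ hζ
  have h4 : C.monomial k (C.point ζ) = ∏ j, Complex.exp (ζ j) ^ k j := by
    rw [monomial, C.z_point hζ]
  rw [h4, ← h3, mul_assoc, inv_mul_cancel₀ (h2 ζ), mul_one]

lemma eq_zero_of_orbitCoeff {S : ∀ p, ⨂[ℂ]^N (L p)} (hS : h.IsHolomorphicSection S) {p : M}
    (hp : p ∈ openOrbit m M) (h0 : ∀ k, C.orbitCoeff S k p = 0) : S p = 0 := by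
  have h1 := eq_zero_of_integral_torusChar (C.continuous_frameCoeff_smul hS hp) h0
  have h2 : C.frameCoeff S p = 0 := by simpa using congrFun h1 1
  exact h.coeff_injective (C.frame_e.ne_zero p hp) (by rw [map_zero]; exact h2)

end LogCoordinates

end Weights

/-! ## The orthonormal basis of monomials -/

section MonomialBasis

variable {m : ℕ} {M : Type*} [TopologicalSpace M] [ChartedSpace (Model m) M]
  [IsManifold 𝓘(ℂ, Model m) ω M] [MulAction (Torus m) M]
  {L : M → Type*} [TopologicalSpace (TotalSpace ℂ L)] [∀ p, AddCommGroup (L p)]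
  [∀ p, Module ℂ (L p)] [∀ p, TopologicalSpace (L p)] [FiberBundle ℂ L]
  [VectorBundle ℂ ℂ L] [ContMDiffVectorBundle ω ℂ L 𝓘(ℂ, Model m)]
  {h : HermitianMetric L m} {A : ToricLift h} {μ : M → Fin m → ℝ}
  [MeasurableSpace M] [BorelSpace M] [SecondCountableTopology M] [Nonempty M]

namespace LogCoordinates

variable (C : LogCoordinates h A μ) {N : ℕ}

/-- Only weights in the moment polytope occur in holomorphic sections. -/
theorem mem_range_of_orbitCoeff (hact : IsToricAction m M) (hpos : h.IsPositive)
    (hμ : IsMomentMap h μ) (hproper : IsProperMap μ) (hN : 1 ≤ N) {k : Fin m → ℤ}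
    {S : ∀ p, ⨂[ℂ]^N (L p)} (hS : h.IsHolomorphicSection S) {c : ℂ} (hc : c ≠ 0)
    (hSc : ∀ p ∈ openOrbit m M, C.orbitCoeff S k p = c * C.monomial k p) :
    latticePoint N k ∈ range μ := by
  -- A nonzero multiple of `z^k e^{⊗N}` is an orbit average of `S`, so its norm is at most the
  -- supremum of `‖S‖` over the orbit. Local boundedness lets the monomial extend, and no square
  -- integrability of `S` is needed.
  suffices hbdd : ∀ q, ∃ B, ∀ᶠ p in 𝓝[openOrbit m M] q,
      ‖h.innerPow (C.monomialSection N k p) (C.monomialSection N k p)‖ ≤ B by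
    obtain ⟨T, hT, hTk⟩ := C.exists_section_extension hact
      (C.isHolomorphicOver_monomialSection N k) hbdd
    exact C.mem_range_of_monomial hact hpos hμ hproper hN hT hTk
  intro q
  have hg : Continuous fun x : Torus m × M => ‖h.innerPow (S (x.1 • x.2)) (S (x.1 • x.2))‖ :=
    ((hS.continuous_innerPow hS).comp A.continuous_smul).norm
  obtain ⟨B, hB⟩ : ∃ B, ∀ t : Torus m, ‖h.innerPow (S (t • q)) (S (t • q))‖ < B := by
    obtain ⟨B, hB⟩ := isCompact_univ.exists_bound_of_continuousOn (f := fun t : Torus m =>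
      ‖h.innerPow (S (t • q)) (S (t • q))‖)
      (hg.comp (Continuous.prodMk_left q)).continuousOn
    exact ⟨B + 1, fun t => by
      have := hB t trivial
      rw [norm_norm] at this
      linarith⟩
  -- By compactness of the torus, a strict bound along the orbit of `q` persists along all nearby
  -- orbits.
  have hev : ∀ᶠ p in 𝓝 q, ∀ t ∈ (univ : Set (Torus m)),
      ‖h.innerPow (S (t • p)) (S (t • p))‖ < B := by
    refine isCompact_univ.eventually_forall_of_forall_eventually fun t _ => ?_
    exact (hg.comp continuous_swap).continuousAt.eventually_lt continuousAt_const (hB t)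
  refine ⟨B / ‖c‖ ^ 2, eventually_nhdsWithin_iff.2 (hev.mono fun p hp hpM => ?_)⟩
  have hE : 0 < Real.exp (-C.φ (C.rho p)) ^ N := by positivity
  have hF : ∀ t : Torus m, ‖C.frameCoeff S (t • p)‖ ≤
      Real.sqrt (B / Real.exp (-C.φ (C.rho p)) ^ N) := by
    intro t
    refine Real.le_sqrt_of_sq_le ?_
    rw [le_div_iff₀ hE]
    refine le_trans (le_of_eq ?_) (hp t trivial).le
    rw [C.innerPow_eq_frameCoeff S S (smul_mem_openOrbit hpM t), C.rho_smul t hpM, norm_mul,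
      norm_mul, RCLike.norm_conj, Complex.norm_real, Real.norm_of_nonneg hE.le, sq]
  have h1 : ‖C.orbitCoeff S k p‖ ≤ Real.sqrt (B / Real.exp (-C.φ (C.rho p)) ^ N) := by
    have := norm_integral_le_of_norm_le_const (μ := torusHaar m)
      (f := fun t => torusChar (-k) t * C.frameCoeff S (t • p))
      (Eventually.of_forall fun t => by rw [norm_mul, norm_torusChar, one_mul]; exact hF t)
    simpa [orbitCoeff] using this
  have hB0 : 0 ≤ B := (norm_nonneg _).trans (hp 1 trivial).le
  have h2 : ‖C.orbitCoeff S k p‖ ^ 2 ≤ B / Real.exp (-C.φ (C.rho p)) ^ N := by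
    rw [← Real.sq_sqrt (div_nonneg hB0 hE.le)]
    gcongr
  rw [hSc p hpM, norm_mul, mul_pow, le_div_iff₀ hE] at h2
  have hc2 : 0 < ‖c‖ ^ 2 := by have := norm_pos_iff.2 hc; positivity
  rw [h.norm_innerPow_self (C.frame_e.ne_zero p hpM), C.coeff_monomialSection N k hpM,
    C.normSq_e_eq hpM, le_div_iff₀ hc2]
  linarith

lemma integrable_innerPow (C : LogCoordinates h A μ) (hact : IsToricAction m M)
    {S T : ∀ p, ⨂[ℂ]^N (L p)}
    (hS : h.IsL2HolomorphicSection S) (hT : h.IsL2HolomorphicSection T) :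
    Integrable (fun p => h.innerPow (S p) (T p)) h.kahlerVolume := by
  set S' : C.l2Sections N := ⟨S, (C.mem_l2Sections_iff hact).2 hS⟩
  set T' : C.l2Sections N := ⟨T, (C.mem_l2Sections_iff hact).2 hT⟩
  refine (L2.integrable_inner (𝕜 := ℂ) (C.toL2 N T') (C.toL2 N S')).congr ?_
  filter_upwards [C.coeFn_toL2 S', C.coeFn_toL2 T', C.ae_mem_openOrbit hact] with p h1 h2 h3
  rw [h1, h2, RCLike.inner_apply, C.l2Function_mul_conj _ _ h3]

/-- Integrals over `M` are unchanged by averaging over the orbits. -/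
theorem integral_average (A : ToricLift h) (hact : IsToricAction m M) {g : M → ℂ}
    (hg : Integrable g h.kahlerVolume) :
    ∫ p, ∫ t, g (t • p) ∂torusHaar m ∂h.kahlerVolume = ∫ p, g p ∂h.kahlerVolume := by
  have := A.sFinite_kahlerVolume hact
  -- The shear preserves the product measure because each `t` preserves the Kähler volume; this
  -- gives the integrability required by Fubini.
  have hmp : MeasurePreserving (fun x : Torus m × M => (x.1, x.1 • x.2))
      ((torusHaar m).prod h.kahlerVolume) ((torusHaar m).prod h.kahlerVolume) :=
    (MeasurePreserving.id (torusHaar m)).skew_product (g := fun t p => t • p)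
      A.continuous_smul.measurable (Eventually.of_forall fun t => A.map_kahlerVolume hact t)
  have h1 : Integrable (fun x : Torus m × M => g (x.1 • x.2))
      ((torusHaar m).prod h.kahlerVolume) :=
    hmp.integrable_comp_of_integrable (g := fun x : Torus m × M => g x.2) (hg.comp_snd _)
  rw [← integral_integral_swap (f := fun (t : Torus m) (p : M) => g (t • p)) h1]
  have h2 : ∀ t : Torus m, ∫ p, g (t • p) ∂h.kahlerVolume = ∫ p, g p ∂h.kahlerVolume := by
    intro t
    have h3 : AEStronglyMeasurable g (h.kahlerVolume.map fun p => t • p) := by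
      rw [A.map_kahlerVolume hact t]; exact hg.1
    rw [← integral_map (hact.continuous_smul t).measurable.aemeasurable h3,
      A.map_kahlerVolume hact t]
  simp [h2]

/-- The inner product with a monomial section is given by the Fourier coefficient. -/
theorem hilb_monomial (hact : IsToricAction m M) {k : Fin m → ℤ} {S T : ∀ p, ⨂[ℂ]^N (L p)}
    (hS : h.IsL2HolomorphicSection S) (hT : h.IsL2HolomorphicSection T) {c : ℂ}
    (hSc : ∀ p ∈ openOrbit m M, C.orbitCoeff S k p = c * C.monomial k p)
    (hTk : ∀ p ∈ openOrbit m M, T p = C.monomialSection N k p) :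
    h.hilb S T = c * C.monomialNormSq N k := by
  rw [HermitianMetric.hilb, ← integral_average A hact (C.integrable_innerPow hact hS hT),
    monomialNormSq, ← integral_complex_ofReal, ← integral_const_mul,
    Measure.restrict_eq_self_of_ae_mem (C.ae_mem_openOrbit hact)]
  refine integral_congr_ae ?_
  filter_upwards [C.ae_mem_openOrbit hact] with p hp
  -- Along an orbit `φ(ρ)` is constant and the monomial changes by a character, so averaging leaves
  -- exactly the Fourier coefficient of `S`.
  have h1 : ∀ t : Torus m, h.innerPow (S (t • p)) (T (t • p)) =
      torusChar (-k) t * C.frameCoeff S (t • p) *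
        (conj (C.monomial k p) * (Real.exp (-C.φ (C.rho p)) ^ N : ℝ)) := by
    intro t
    have h2 := smul_mem_openOrbit hp t
    rw [C.innerPow_eq_frameCoeff S T h2, C.rho_smul t hp, frameCoeff, frameCoeff, hTk _ h2,
      C.coeff_monomialSection N k h2, C.monomial_smul k t hp, map_mul, conj_torusChar]
    ring
  simp only [h1]
  rw [integral_mul_const]
  have h3 := hSc p hp
  rw [orbitCoeff] at h3
  rw [h3, ← C.innerPow_monomialSection N k hp, C.innerPow_eq_frameCoeff _ _ hp, frameCoeff,
    C.coeff_monomialSection N k hp]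
  ring

lemma orbitCoeff_monomial {k l : Fin m → ℤ} {T : ∀ p, ⨂[ℂ]^N (L p)}
    (hTl : ∀ p ∈ openOrbit m M, T p = C.monomialSection N l p) :
    ∀ p ∈ openOrbit m M, C.orbitCoeff T k p = (if k = l then 1 else 0) * C.monomial k p := by
  intro p hp
  have h1 : ∀ t : Torus m, torusChar (-k) t * C.frameCoeff T (t • p) =
      torusChar (-k + l) t * C.monomial l p := by
    intro t
    have h2 := smul_mem_openOrbit hp t
    rw [frameCoeff, hTl _ h2, C.coeff_monomialSection N l h2, C.monomial_smul l t hp,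
      torusChar_add, mul_assoc]
  simp only [orbitCoeff, h1]
  rw [integral_mul_const]
  split_ifs with hkl
  · subst hkl
    simp [torusChar_zero]
  · rw [integral_torusChar fun h0 => hkl (neg_add_eq_zero.1 h0), zero_mul, zero_mul]

lemma isL2HolomorphicSection_of_monomial (hact : IsToricAction m M) {k : Fin m → ℤ}
    {T : ∀ p, ⨂[ℂ]^N (L p)} (hT : h.IsHolomorphicSection T)
    (hTk : ∀ p ∈ openOrbit m M, T p = C.monomialSection N k p) (hfin : C.MonomialL2 N k) :
    h.IsL2HolomorphicSection T := by
  refine ⟨hT, ?_⟩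
  rw [MonomialL2, IntegrableOn,
    Measure.restrict_eq_self_of_ae_mem (C.ae_mem_openOrbit hact)] at hfin
  refine hfin.ofReal (𝕜 := ℂ) |>.congr ?_
  filter_upwards [C.ae_mem_openOrbit hact] with p hp
  rw [hTk p hp, C.innerPow_monomialSection N k hp]
  rfl

/-- It is the squared `L²` norm of a section which does not vanish on the open orbit. -/
lemma monomialNormSq_pos (hact : IsToricAction m M) (hpos : h.IsPositive) {k : Fin m → ℤ}
    {T : ∀ p, ⨂[ℂ]^N (L p)} (hT : h.IsL2HolomorphicSection T)
    (hTk : ∀ p ∈ openOrbit m M, T p = C.monomialSection N k p) : 0 < C.monomialNormSq N k := by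
  set T' : C.l2Sections N := ⟨T, (C.mem_l2Sections_iff hact).2 hT⟩ with hT'
  have h1 := C.inner_toL2 hact T' T'
  rw [C.hilb_monomial hact hT hT (C.orbitCoeff_monomial hTk) hTk, if_pos rfl, one_mul,
    inner_self_eq_norm_sq_to_K] at h1
  have h2 : C.monomialNormSq N k = ‖C.toL2 N T'‖ ^ 2 := by
    apply Complex.ofReal_injective
    rw [← h1]; push_cast; rfl
  rw [h2]
  have h3 : C.toL2 N T' ≠ 0 := by
    intro h0
    have h4 : T' = 0 := C.toL2_injective hact hpos N (by rw [h0, map_zero])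
    obtain ⟨p, hp⟩ := C.dense_orbit.nonempty
    have h5 : T p = 0 := congrFun (congrArg Subtype.val h4) p
    have h6 := C.coeff_monomialSection N k hp
    rw [← hTk p hp, h5, map_zero] at h6
    exact C.monomial_ne_zero k hp h6.symm
  have := norm_pos_iff.2 h3
  positivity

/-- The normalized monomials with exponents in the moment polytope form an orthonormal basis. -/
theorem isOrthonormalBasis_monomials (hact : IsToricAction m M) (hpos : h.IsPositive)
    (hμ : IsMomentMap h μ) (hproper : IsProperMap μ) (hN : 1 ≤ N)
    {T : {k : Fin m → ℤ // latticePoint N k ∈ range μ} → ∀ p, ⨂[ℂ]^N (L p)}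
    (hT : ∀ k, h.IsL2HolomorphicSection (T k))
    (hTk : ∀ k, ∀ p ∈ openOrbit m M, T k p = C.monomialSection N k.1 p) :
    h.IsOrthonormalBasis fun k => ((Real.sqrt (C.monomialNormSq N k.1))⁻¹ : ℂ) • T k := by
  have hn := fun k => C.monomialNormSq_pos hact hpos (hT k) (hTk k)
  have hs := fun k => Real.sqrt_pos.2 (hn k)
  have hhilb : ∀ (a b : ℂ) (S S' : ∀ p, ⨂[ℂ]^N (L p)),
      h.hilb (a • S) (b • S') = a * conj b * h.hilb S S' := by
    intro a b S S'
    rw [HermitianMetric.hilb, HermitianMetric.hilb, ← integral_const_mul]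
    refine integral_congr_ae (Eventually.of_forall fun p => ?_)
    simp only [HermitianMetric.innerPow, Pi.smul_apply, map_smul, smul_eq_mul, map_mul]
    ring
  have horth : ∀ k l, h.hilb (T k) (T l) =
      (if l = k then 1 else 0) * C.monomialNormSq N l.1 := by
    intro k l
    rw [C.hilb_monomial hact (hT k) (hT l) (C.orbitCoeff_monomial (hTk k)) (hTk l)]
    simp only [Subtype.ext_iff]
  refine ⟨fun k => ?_, fun k => ?_, fun k l hkl => ?_, fun t ht h0 => ?_⟩
  · exact (C.mem_l2Sections_iff hact).1
      ((C.l2Sections N).smul_mem _ ((C.mem_l2Sections_iff hact).2 (hT k)))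
  · rw [hhilb, horth, if_pos rfl]
    have h1 : (C.monomialNormSq N k.1 : ℂ) =
        (Real.sqrt (C.monomialNormSq N k.1) : ℂ) * Real.sqrt (C.monomialNormSq N k.1) := by
      rw [← Complex.ofReal_mul, Real.mul_self_sqrt (hn k).le]
    have h2 : (Real.sqrt (C.monomialNormSq N k.1) : ℂ) ≠ 0 := by exact_mod_cast (hs k).ne'
    rw [map_inv₀, Complex.conj_ofReal]
    rw [one_mul, h1]
    field_simp
  · rw [hhilb, horth, if_neg (Ne.symm hkl), zero_mul, mul_zero]
  -- A nonzero Fourier coefficient `c` of weight `k` forces `k/N ∈ P`, and then the pairing of `t`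
  -- with the corresponding basis vector is a nonzero multiple of `c`. So all coefficients vanish,
  -- `t` vanishes on the open orbit, and it is zero in `L²`.
  · have h1 : ∀ p ∈ openOrbit m M, t p = 0 := by
      intro p hp
      refine C.eq_zero_of_orbitCoeff ht.1 hp fun k => ?_
      obtain ⟨c, hc⟩ := C.exists_orbitCoeff_eq hact ht.1 k
      rw [hc p hp]
      rcases eq_or_ne c 0 with rfl | hc0
      · rw [zero_mul]
      exfalso
      have hk := C.mem_range_of_orbitCoeff hact hpos hμ hproper hN ht.1 hc0 hc
      have h2 := h0 ⟨k, hk⟩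
      rw [← one_smul ℂ t, hhilb, C.hilb_monomial hact ht (hT ⟨k, hk⟩) hc (hTk _), map_inv₀,
        Complex.conj_ofReal] at h2
      have h3 : (Real.sqrt (C.monomialNormSq N k) : ℂ) ≠ 0 := by
        exact_mod_cast (hs ⟨k, hk⟩).ne'
      have h4 : (C.monomialNormSq N k : ℂ) ≠ 0 := by exact_mod_cast (hn ⟨k, hk⟩).ne'
      simp [hc0, h3, h4] at h2
    set t' : C.l2Sections N := ⟨t, (C.mem_l2Sections_iff hact).2 ht⟩ with ht'
    have h2 : C.toL2 N t' = 0 := by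
      rw [← norm_eq_zero, ← sq_eq_zero_iff, ← Complex.ofReal_eq_zero, Complex.ofReal_pow]
      have h3 := C.inner_toL2 hact t' t'
      rw [inner_self_eq_norm_sq_to_K] at h3
      refine Eq.trans (by exact_mod_cast h3) ?_
      rw [HermitianMetric.hilb]
      refine integral_eq_zero_of_ae ?_
      filter_upwards [C.ae_mem_openOrbit hact] with p hp
      simp [ht', h1 p hp, HermitianMetric.innerPow]
    have h4 : t' = 0 := C.toL2_injective hact hpos N (by rw [h2, map_zero])
    exact congrArg Subtype.val h4

end LogCoordinates

end MonomialBasis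

/-! ## The Bergman kernel in the basis of monomials -/

section BergmanKernel

variable {m : ℕ} {M : Type*} [TopologicalSpace M] [ChartedSpace (Model m) M]
  [IsManifold 𝓘(ℂ, Model m) ω M] [MulAction (Torus m) M]
  {L : M → Type*} [TopologicalSpace (TotalSpace ℂ L)] [∀ p, AddCommGroup (L p)]
  [∀ p, Module ℂ (L p)] [∀ p, TopologicalSpace (L p)] [FiberBundle ℂ L]
  [VectorBundle ℂ ℂ L] [ContMDiffVectorBundle ω ℂ L 𝓘(ℂ, Model m)]
  {h : HermitianMetric L m} {A : ToricLift h} {μ : M → Fin m → ℝ}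
  [MeasurableSpace M] [BorelSpace M] [SecondCountableTopology M] [Nonempty M]

namespace LogCoordinates

variable (C : LogCoordinates h A μ) {N : ℕ}

lemma map_act_monomialSection (k : Fin m → ℤ) (t : Torus m) {p : M} (hp : p ∈ openOrbit m M) :
    C.monomialSection N k (t • p) =
      torusChar k t • PiTensorProduct.map (fun _ => A.act t p) (C.monomialSection N k p) := by
  rw [monomialSection, monomialSection, map_smul, PiTensorProduct.map_tprod, smul_smul,
    C.monomial_smul k t hp]
  simp only [C.invariant_e t p hp]

/-- The extended monomial sections have a weight under the lifted action. -/
theorem coeff_act_monomial (hact : IsToricAction m M) {k : Fin m → ℤ} {T : ∀ p, ⨂[ℂ]^N (L p)}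
    (hT : h.IsHolomorphicSection T)
    (hTk : ∀ p ∈ openOrbit m M, T p = C.monomialSection N k p) (t : Torus m) (q : M) :
    h.coeff (A.act t q (localFrame L q q)) (T (t • q)) =
      torusChar k t * h.coeff (localFrame L q q) (T q) := by
  have hqb := (isHolomorphicFrame_localFrame (m := m) L q).isOpen.mem_nhds
    (mem_baseSet_self (L := L) q)
  have hyb := (isHolomorphicFrame_localFrame (m := m) L (t • q)).isOpen.mem_nhds
    (mem_baseSet_self (L := L) (t • q))
  have hct := (hact.continuous_smul t).continuousAt (x := q)
  have hev : ∀ᶠ p in 𝓝 q, p ∈ (trivializationAt ℂ L q).baseSet ∧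
      t • p ∈ (trivializationAt ℂ L (t • q)).baseSet := by
    filter_upwards [hqb, hct.eventually hyb] with p h1 h2 using ⟨h1, h2⟩
  set κ : M → ℂ := fun p => frameCoord (t • q) (t • p) (A.act t p (localFrame L q p)) with hκ
  have hκc : ContinuousAt κ q :=
    (A.contMDiffOn_frameCoord_act t q (t • q)).continuousOn.continuousAt hev
  have hκ0 : ∀ p, p ∈ (trivializationAt ℂ L q).baseSet →
      t • p ∈ (trivializationAt ℂ L (t • q)).baseSet → κ p ≠ 0 := fun p h1 h2 =>
    frameCoord_ne_zero h2 (A.act_ne_zero (localFrame_ne_zero h1))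
  have hc1 : ∀ x, ContinuousAt (fun p => h.coeff (localFrame L x p) (T p)) x := fun x =>
    (hT _ _ (isHolomorphicFrame_localFrame (m := m) L x)).continuousOn.continuousAt
      ((isHolomorphicFrame_localFrame (m := m) L x).isOpen.mem_nhds (mem_baseSet_self (L := L) x))
  have hG : ContinuousAt (fun p => h.coeff (A.act t p (localFrame L q p)) (T (t • p))) q := by
    have h1 : ContinuousAt (fun p => (κ p ^ N)⁻¹ *
        h.coeff (localFrame L (t • q) (t • p)) (T (t • p))) q := by
      refine ((hκc.pow N).inv₀ (pow_ne_zero _ (hκ0 q (mem_baseSet_self q)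
        (mem_baseSet_self (t • q))))).mul ?_
      exact ContinuousAt.comp (g := fun p => h.coeff (localFrame L (t • q) p) (T p))
        (hc1 (t • q)) hct
    refine h1.congr (hev.mono fun p hp => ?_)
    have h2 := hκ0 p hp.1 hp.2
    beta_reduce
    rw [h.coeff_eq_pow_mul (localFrame_ne_zero hp.2) h2, frameCoord_smul_localFrame hp.2,
      inv_mul_cancel_left₀ (pow_ne_zero _ h2)]
  have hlim1 : Tendsto (fun p => h.coeff (A.act t p (localFrame L q p)) (T (t • p)))
      (𝓝[openOrbit m M] q) (𝓝 (h.coeff (A.act t q (localFrame L q q)) (T (t • q)))) :=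
    hG.tendsto.mono_left nhdsWithin_le_nhds
  have hlim2 : Tendsto (fun p => torusChar k t * h.coeff (localFrame L q p) (T p))
      (𝓝[openOrbit m M] q) (𝓝 (torusChar k t * h.coeff (localFrame L q q) (T q))) :=
    ((hc1 q).tendsto.mono_left nhdsWithin_le_nhds).const_mul _
  have := C.neBot q
  -- On the open orbit the identity is equivariance of `z` together with invariance of the frame;
  -- continuity and density carry it to `q`.
  refine tendsto_nhds_unique (l := 𝓝[openOrbit m M] q) (hlim1.congr' ?_) hlim2
  filter_upwards [self_mem_nhdsWithin, nhdsWithin_le_nhds hev] with p hp hpb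
  rw [hTk _ (smul_mem_openOrbit hp t), hTk p hp, C.map_act_monomialSection k t hp, map_smul,
    A.coeff_act_map (localFrame_ne_zero hpb.1), smul_eq_mul]

lemma exists_norm_coeff_apply_le (hact : IsToricAction m M) (hpos : h.IsPositive) (N : ℕ) {p : M}
    (w : L p) : ∃ Γ, ∀ S : C.l2Sections N, ‖h.coeff w (S.1 p)‖ ≤ Γ * ‖C.toL2 N S‖ := by
  obtain ⟨Γ, U, hΓ, hU, hpU, -, -, hb⟩ := C.exists_norm_coeff_le hact hpos N p
  refine ⟨Γ * ‖h.coeff w (PiTensorProduct.tprod ℂ fun _ : Fin N => localFrame L p p)‖,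
    fun S => ?_⟩
  rw [coeff_eq_mul_coeff h (localFrame_ne_zero (mem_baseSet_self p)) (S.1 p), norm_mul,
    mul_right_comm]
  exact mul_le_mul_of_nonneg_right (hb S p hpU) (norm_nonneg _)

/-- The `k`-th term `‖S_k‖²_{h^N} / ‖z^k‖²` of the density of states. -/
def weightTerm (T : {k : Fin m → ℤ // latticePoint N k ∈ range μ} → ∀ p, ⨂[ℂ]^N (L p)) (p : M)
    (k : {k : Fin m → ℤ // latticePoint N k ∈ range μ}) : ℂ :=
  h.innerPow (T k p) (T k p) / C.monomialNormSq N k.1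

lemma weightTerm_eq {T : {k : Fin m → ℤ // latticePoint N k ∈ range μ} → ∀ p, ⨂[ℂ]^N (L p)}
    (hTk : ∀ k, ∀ p ∈ openOrbit m M, T k p = C.monomialSection N k.1 p) {p : M}
    (hp : p ∈ openOrbit m M) (k : {k : Fin m → ℤ // latticePoint N k ∈ range μ}) :
    C.weightTerm T p k = ((C.monomialDensity N k.1 p / C.monomialNormSq N k.1 : ℝ) : ℂ) := by
  rw [weightTerm, hTk k p hp, C.innerPow_monomialSection N k.1 hp, Complex.ofReal_div]

/-- The Bergman kernel along the orbits is a Fourier series with the weight terms as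
coefficients. -/
theorem exists_hasSum_bergmanOrbit (hact : IsToricAction m M) (hpos : h.IsPositive)
    (hμ : IsMomentMap h μ) (hproper : IsProperMap μ) (hN : 1 ≤ N)
    {T : {k : Fin m → ℤ // latticePoint N k ∈ range μ} → ∀ p, ⨂[ℂ]^N (L p)}
    (hT : ∀ k, h.IsL2HolomorphicSection (T k))
    (hTk : ∀ k, ∀ p ∈ openOrbit m M, T k p = C.monomialSection N k.1 p)
    {ι : Type*} {s : ι → ∀ p, ⨂[ℂ]^N (L p)} (hs : h.IsOrthonormalBasis s) (t : Torus m) (p : M) :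
    ∃ B, HasSum (h.bergmanOrbitTerm A s t p) B ∧
      HasSum (fun k => torusChar k.1 t * C.weightTerm T p k) B := by
  set v := localFrame L p p with hv
  have hv0 : v ≠ 0 := localFrame_ne_zero (mem_baseSet_self p)
  -- `f` evaluates at `p` in the frame `v`, and `g` evaluates at `t • p` in the frame carried there
  -- by the lift, weighted by `‖v‖^{2N}`. Then `g(s_j) conj f(s_j)` is the `j`-th term of the
  -- kernel.
  let f : C.l2Sections N →ₗ[ℂ] ℂ :=
    (h.coeff v).comp ((LinearMap.proj p).comp (C.l2Sections N).subtype)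
  let g : C.l2Sections N →ₗ[ℂ] ℂ := ((h.normSq v ^ N : ℝ) : ℂ) •
    (h.coeff (A.act t p v)).comp ((LinearMap.proj (t • p)).comp (C.l2Sections N).subtype)
  have hf : ∀ S, f S = h.coeff v (S.1 p) := fun S => rfl
  have hg : ∀ S, g S = ((h.normSq v ^ N : ℝ) : ℂ) * h.coeff (A.act t p v) (S.1 (t • p)) :=
    fun S => rfl
  obtain ⟨B, h1, h2⟩ := C.exists_hasSum_functional hact hpos f g
    (C.exists_norm_coeff_apply_le hact hpos N v) (by
      obtain ⟨Γ, hΓ⟩ := C.exists_norm_coeff_apply_le hact hpos N (A.act t p v)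
      refine ⟨‖((h.normSq v ^ N : ℝ) : ℂ)‖ * Γ, fun S => ?_⟩
      rw [hg, norm_mul, mul_assoc]
      exact mul_le_mul_of_nonneg_left (hΓ S) (norm_nonneg _))
    hs (C.isOrthonormalBasis_monomials hact hpos hμ hproper hN hT hTk)
  refine ⟨B, h1.congr_fun fun j => ?_, h2.congr_fun fun k => ?_⟩
  · rw [HermitianMetric.bergmanOrbitTerm, h.innerPow_eq (A.act_ne_zero hv0), A.normSq_act,
      A.coeff_act_map hv0, hf, hg]
    ring
  · have hn := C.monomialNormSq_pos hact hpos (hT k) (hTk k)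
    have h3 : (Real.sqrt (C.monomialNormSq N k.1) : ℂ)⁻¹ * (Real.sqrt (C.monomialNormSq N k.1) : ℂ)⁻¹
        = (C.monomialNormSq N k.1 : ℂ)⁻¹ := by
      rw [← mul_inv, ← Complex.ofReal_mul, Real.mul_self_sqrt hn.le]
    have h4 := C.coeff_act_monomial hact (hT k).1 (hTk k) t p
    rw [hf, hg]
    simp only [Pi.smul_apply, map_smul, smul_eq_mul, map_mul, map_inv₀, Complex.conj_ofReal]
    rw [h4, weightTerm, h.innerPow_eq hv0, div_eq_mul_inv, ← h3]
    ring

theorem bergmanDiag_eq (hact : IsToricAction m M) (hpos : h.IsPositive)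
    (hμ : IsMomentMap h μ) (hproper : IsProperMap μ) (hN : 1 ≤ N)
    {T : {k : Fin m → ℤ // latticePoint N k ∈ range μ} → ∀ p, ⨂[ℂ]^N (L p)}
    (hT : ∀ k, h.IsL2HolomorphicSection (T k))
    (hTk : ∀ k, ∀ p ∈ openOrbit m M, T k p = C.monomialSection N k.1 p)
    {ι : Type*} {s : ι → ∀ p, ⨂[ℂ]^N (L p)} (hs : h.IsOrthonormalBasis s) (p : M) :
    h.bergmanDiag s p = ∑' k, C.weightTerm T p k := by
  obtain ⟨B, h1, h2⟩ := C.exists_hasSum_bergmanOrbit hact hpos hμ hproper hN hT hTk hs 1 p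
  have h3 : h.bergmanOrbitTerm A s 1 p = fun j => h.innerPow (s j p) (s j p) := by
    funext j
    set v := localFrame L p p with hv
    have hv0 : v ≠ 0 := localFrame_ne_zero (mem_baseSet_self p)
    -- The fibres over `1 • p` and `p` are equal only propositionally, so the comparison goes
    -- through the total space.
    have h4 : ∀ q (w : L q), (⟨q, w⟩ : TotalSpace ℂ L) = ⟨p, v⟩ →
        h.coeff w (s j q) = h.coeff v (s j p) := by
      rintro q w hqw
      obtain rfl : q = p := congrArg TotalSpace.proj hqw
      rw [TotalSpace.mk_inj] at hqw
      rw [hqw]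
    rw [HermitianMetric.bergmanOrbitTerm, h.innerPow_eq (A.act_ne_zero hv0), A.normSq_act,
      A.coeff_act_map hv0, h4 _ _ (A.one_act p v), h.innerPow_eq hv0]
  have h5 : (fun k : {k : Fin m → ℤ // latticePoint N k ∈ range μ} =>
      torusChar k.1 1 * C.weightTerm T p k) = C.weightTerm T p := by
    funext k
    simp [torusChar]
  rw [HermitianMetric.bergmanDiag, ← h3, h1.tsum_eq]
  rw [h5] at h2
  exact h2.tsum_eq.symm

end LogCoordinates

end BergmanKernel

/-! ## Generalized Szasz functions -/

section Szasz

variable {m : ℕ} {M : Type*} [TopologicalSpace M] [ChartedSpace (Model m) M]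
  [IsManifold 𝓘(ℂ, Model m) ω M] [MulAction (Torus m) M]
  {L : M → Type*} [TopologicalSpace (TotalSpace ℂ L)] [∀ p, AddCommGroup (L p)]
  [∀ p, Module ℂ (L p)] [∀ p, TopologicalSpace (L p)] [FiberBundle ℂ L]
  [VectorBundle ℂ ℂ L] [ContMDiffVectorBundle ω ℂ L 𝓘(ℂ, Model m)]
  {h : HermitianMetric L m} {A : ToricLift h} {μ : M → Fin m → ℝ}
  [MeasurableSpace M] [BorelSpace M] [SecondCountableTopology M] [Nonempty M]

lemma integral_exp_int_mul (n : ℤ) :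
    ∫ x in Set.Icc (0 : ℝ) (2 * Real.pi), Complex.exp (Complex.I * n * x) =
      if n = 0 then ((2 * Real.pi : ℝ) : ℂ) else 0 := by
  have hπ : (0 : ℝ) ≤ 2 * Real.pi := by positivity
  split_ifs with hn
  · subst hn
    simp [hπ]
  · rw [integral_Icc_eq_integral_Ioc, ← intervalIntegral.integral_of_le hπ,
      integral_exp_mul_complex (mul_ne_zero Complex.I_ne_zero (by exact_mod_cast hn))]
    have h1 : Complex.exp (Complex.I * n * ((2 * Real.pi : ℝ) : ℂ)) = 1 := by
      rw [← Complex.exp_int_mul_two_pi_mul_I n]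
      congr 1
      push_cast
      ring
    rw [h1]
    simp

lemma integral_character (k : Fin m → ℤ) :
    ∫ θ in Set.Icc (0 : Fin m → ℝ) (fun _ => 2 * Real.pi), character k θ =
      if k = 0 then (((2 * Real.pi) ^ m : ℝ) : ℂ) else 0 := by
  have h1 : Set.Icc (0 : Fin m → ℝ) (fun _ => 2 * Real.pi) =
      Set.univ.pi fun _ => Set.Icc (0 : ℝ) (2 * Real.pi) := (Set.pi_univ_Icc _ _).symm
  have h2 : ∀ θ : Fin m → ℝ, character k θ = ∏ j, Complex.exp (Complex.I * k j * θ j) := by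
    intro θ
    rw [character, ← Complex.exp_sum]
    congr 1
    push_cast
    rw [Finset.mul_sum]
    exact Finset.sum_congr rfl fun j _ => by ring
  simp only [h2]
  rw [h1, volume_pi, Measure.restrict_pi_pi, integral_fintype_prod_eq_prod
    (f := fun j (x : ℝ) => Complex.exp (Complex.I * k j * x))]
  simp only [integral_exp_int_mul]
  split_ifs with hk
  · subst hk
    simp
  · obtain ⟨j, hj⟩ := Function.ne_iff.1 hk
    exact Finset.prod_eq_zero (Finset.mem_univ j) (if_neg hj)

lemma character_add (k l : Fin m → ℤ) (θ : Fin m → ℝ) :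
    character (k + l) θ = character k θ * character l θ := by
  simp only [← torusChar_expTorus, torusChar_add]

lemma norm_character (k : Fin m → ℤ) (θ : Fin m → ℝ) : ‖character k θ‖ = 1 := by
  rw [← torusChar_expTorus, norm_torusChar]

lemma continuous_character (k : Fin m → ℤ) : Continuous (character k) := by
  unfold character
  fun_prop

/-- The Fourier coefficients of an absolutely convergent Fourier series. -/
lemma angleFourierCoeff_tsum {κ : Type*} [Countable κ] (i : κ → Fin m → ℤ) {a : κ → ℂ}
    (ha : Summable a) (l : Fin m → ℤ) :
    angleFourierCoeff (fun θ => ∑' k, character (i k) θ * a k) l =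
      ∑' k, if i k = l then a k else 0 := by
  have h1 : ∀ k, ∫ θ in Set.Icc (0 : Fin m → ℝ) (fun _ => 2 * Real.pi),
      character (i k) θ * a k * character (-l) θ =
        (((2 * Real.pi) ^ m : ℝ) : ℂ) * if i k = l then a k else 0 := by
    intro k
    have h2 : ∀ θ, character (i k) θ * a k * character (-l) θ =
        a k * character (i k + -l) θ := by
      intro θ
      rw [character_add]
      ring
    simp only [h2]
    rw [integral_const_mul, integral_character, ← sub_eq_add_neg]
    simp only [sub_eq_zero]
    split_ifs <;> ring
  have hfin : volume (Set.Icc (0 : Fin m → ℝ) (fun _ => 2 * Real.pi)) ≠ ⊤ :=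
    isCompact_Icc.measure_ne_top
  have h2 := hasSum_integral_of_summable_integral_norm
    (μ := volume.restrict (Set.Icc (0 : Fin m → ℝ) (fun _ => 2 * Real.pi)))
    (F := fun k θ => character (i k) θ * a k * character (-l) θ)
    (fun k => ((((continuous_character (i k)).mul continuous_const).mul
      (continuous_character (-l))).continuousOn.integrableOn_compact isCompact_Icc)) (by
      simp only [norm_mul, norm_character, one_mul, mul_one, integral_const, smul_eq_mul]
      exact ha.norm.mul_left _)
  simp only [h1, tsum_mul_right] at h2
  have hπ : (((2 * Real.pi) ^ m : ℝ) : ℂ) ≠ 0 := by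
    have := Real.pi_pos
    exact_mod_cast (by positivity : ((2 * Real.pi) ^ m : ℝ) ≠ 0)
  rw [angleFourierCoeff, ← h2.tsum_eq, tsum_mul_left, inv_mul_cancel_left₀ hπ]

/-- `f(N⁻¹ D_θ)` applied to an absolutely convergent Fourier series, at `θ = 0`. -/
theorem functionOfD_tsum {κ : Type*} [Countable κ] {i : κ → Fin m → ℤ}
    (hi : Function.Injective i) {a : κ → ℂ} (ha : Summable a) (f : (Fin m → ℝ) → ℂ) (N : ℕ) :
    functionOfD f N (fun θ => ∑' k, character (i k) θ * a k) 0 =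
      ∑' k, f (latticePoint N (i k)) * a k := by
  simp only [functionOfD, angleFourierCoeff_tsum i ha]
  have h0 : ∀ l : Fin m → ℤ, character l 0 = 1 := fun l => by simp [character]
  simp only [h0, mul_one]
  -- Frequencies outside the range of `i` have zero coefficient, so the sum over the lattice reduces
  -- to the index type.
  rw [← hi.tsum_eq]
  · refine tsum_congr fun k => ?_
    congr 1
    rw [tsum_eq_single k fun k' hk' => if_neg fun h1 => hk' (hi h1), if_pos rfl]
  · intro l hl
    by_contra hl'
    refine hl ?_
    have h1 : ∀ k, (if i k = l then a k else 0) = 0 := fun k =>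
      if_neg fun h2 => hl' ⟨k, h2⟩
    simp [h1]

/-- A bounded support scaled by `N` contains finitely many lattice points. -/
lemma finite_latticePoint_support {f : (Fin m → ℝ) → ℂ} (hf : HasCompactSupport f) {N : ℕ}
    (hN : 1 ≤ N) : {k : Fin m → ℤ | f (latticePoint N k) ≠ 0}.Finite := by
  obtain ⟨R, hR⟩ := hf.isBounded.exists_norm_le
  have hN0 : (0 : ℝ) < N := by exact_mod_cast hN
  refine (Set.finite_Icc (fun _ => -⌈R * N⌉ : Fin m → ℤ) (fun _ => ⌈R * N⌉)).subset
    fun k hk => ?_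
  have h1 := hR _ (subset_tsupport f hk)
  have h2 : ∀ j, |(k j : ℝ)| ≤ R * N := by
    intro j
    have h3 := (norm_le_pi_norm _ j).trans h1
    rwa [latticePoint, Real.norm_eq_abs, abs_div, abs_of_pos hN0, div_le_iff₀ hN0] at h3
  have h3 : ∀ j, |k j| ≤ ⌈R * N⌉ := fun j => by
    have := (h2 j).trans (Int.le_ceil (R * N))
    exact_mod_cast this
  exact ⟨fun j => (abs_le.1 (h3 j)).1, fun j => (abs_le.1 (h3 j)).2⟩

namespace LogCoordinates

variable (C : LogCoordinates h A μ) {N : ℕ}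

/-- Quantities depending on `p` through `ρ` alone are thus functions of the moment `x`, so the point
chosen over `x` in `szasz` is immaterial. -/
lemma rho_eq_of_moment_eq (hact : IsToricAction m M) (hpos : h.IsPositive)
    (hμ : IsMomentMap h μ) {p p' : M} (hp : p ∈ openOrbit m M) (hp' : p' ∈ openOrbit m M)
    (h1 : μ p = μ p') : C.rho p = C.rho p' := by
  refine C.injOn_grad hact hpos hμ (C.rho_mem hp) (C.rho_mem hp') ?_
  have h2 : μ p = grad C.φ (C.rho p) := C.moment_eq p hp
  have h3 : μ p' = grad C.φ (C.rho p') := C.moment_eq p' hp'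
  rw [← h2, ← h3, h1]

/-- At `x = ∇φ(ρ)` one has `∇u(x) = ρ` and `u(x) = ⟨x, ρ⟩ - φ(ρ)`, so the exponent `u(x) + ⟨y - x,
ρ⟩` collapses to `⟨y, ρ⟩ - φ(ρ)`. -/
lemma exp_symplecticPotential (hact : IsToricAction m M) (hpos : h.IsPositive)
    (hμ : IsMomentMap h μ) (hN : 1 ≤ N) (k : Fin m → ℤ) {p : M} (hp : p ∈ openOrbit m M) :
    Real.exp (N * (C.symplecticPotential (μ p) +
      ∑ j, (latticePoint N k j - μ p j) * grad C.symplecticPotential (μ p) j)) =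
        C.monomialDensity N k p := by
  have h2 : μ p = grad C.φ (C.rho p) := C.moment_eq p hp
  rw [C.monomialDensity_eq_exp hN k hp, h2, C.grad_symplecticPotential hact hpos hμ (C.rho_mem hp),
    C.symplecticPotential_grad hact hpos hμ (C.rho_mem hp), legendre]
  simp only [sub_mul, Finset.sum_sub_distrib]
  congr 2
  ring

variable {T : {k : Fin m → ℤ // latticePoint N k ∈ range μ} → ∀ p, ⨂[ℂ]^N (L p)}

lemma szaszSum_moment (hact : IsToricAction m M) (hpos : h.IsPositive)
    (hμ : IsMomentMap h μ) (hN : 1 ≤ N)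
    (hTk : ∀ k, ∀ p ∈ openOrbit m M, T k p = C.monomialSection N k.1 p)
    (f : (Fin m → ℝ) → ℂ) {p : M} (hp : p ∈ openOrbit m M) :
    C.szaszSum N f (μ p) = ∑' k, f (latticePoint N k.1) * C.weightTerm T p k := by
  refine tsum_congr fun k => ?_
  rw [C.exp_symplecticPotential hact hpos hμ hN k.1 hp, C.weightTerm_eq hTk hp]

lemma functionOfD_bergmanOrbit (hact : IsToricAction m M) (hpos : h.IsPositive)
    (hμ : IsMomentMap h μ) (hproper : IsProperMap μ) (hN : 1 ≤ N)
    (hT : ∀ k, h.IsL2HolomorphicSection (T k))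
    (hTk : ∀ k, ∀ p ∈ openOrbit m M, T k p = C.monomialSection N k.1 p)
    {ι : Type*} {s : ι → ∀ p, ⨂[ℂ]^N (L p)} (hs : h.IsOrthonormalBasis s)
    (f : (Fin m → ℝ) → ℂ) (p : M) :
    functionOfD f N (fun θ => h.bergmanOrbit A s (expTorus θ) p) 0 =
      ∑' k, f (latticePoint N k.1) * C.weightTerm T p k := by
  have h1 : ∀ θ, h.bergmanOrbit A s (expTorus θ) p =
      ∑' k : {k : Fin m → ℤ // latticePoint N k ∈ range μ},
        character k.1 θ * C.weightTerm T p k := by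
    intro θ
    obtain ⟨B, h2, h3⟩ :=
      C.exists_hasSum_bergmanOrbit hact hpos hμ hproper hN hT hTk hs (expTorus θ) p
    simp only [torusChar_expTorus] at h3
    rw [HermitianMetric.bergmanOrbit, h2.tsum_eq, h3.tsum_eq]
  have ha : Summable (C.weightTerm T p) := by
    obtain ⟨B, -, h3⟩ := C.exists_hasSum_bergmanOrbit hact hpos hμ hproper hN hT hTk hs 1 p
    refine h3.summable.congr fun k => ?_
    simp [torusChar]
  simp only [h1]
  exact functionOfD_tsum Subtype.val_injective ha f N

lemma continuous_weightTerm (hT : ∀ k, h.IsHolomorphicSection (T k))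
    (k : {k : Fin m → ℤ // latticePoint N k ∈ range μ}) :
    Continuous fun p => C.weightTerm T p k :=
  ((hT k).continuous_innerPow (hT k)).div_const _

/-- The compact support of `f` leaves finitely many terms, fixed independently of the point, and
each is continuous on all of `M` because the monomial sections extend. -/
lemma tendsto_tsum_weightTerm (hN : 1 ≤ N) (hT : ∀ k, h.IsHolomorphicSection (T k))
    {f : (Fin m → ℝ) → ℂ} (hf : HasCompactSupport f) (q : M) :
    Tendsto (fun p => ∑' k, f (latticePoint N k.1) * C.weightTerm T p k) (𝓝 q)
      (𝓝 (∑' k, f (latticePoint N k.1) * C.weightTerm T q k)) := by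
  have hfin : {k : {k : Fin m → ℤ // latticePoint N k ∈ range μ} |
      f (latticePoint N k.1) ≠ 0}.Finite :=
    (finite_latticePoint_support hf hN).preimage Subtype.val_injective.injOn
  have h1 : ∀ p, ∑' k, f (latticePoint N k.1) * C.weightTerm T p k =
      ∑ k ∈ hfin.toFinset, f (latticePoint N k.1) * C.weightTerm T p k := fun p =>
    tsum_eq_sum fun k hk => by
      have : f (latticePoint N k.1) = 0 := by simpa using hk
      rw [this, zero_mul]
  simp only [h1]
  exact tendsto_finsetSum _ fun k _ =>
    ((C.continuous_weightTerm hT k).tendsto q).const_mul _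

end LogCoordinates

end Szasz

end ToricSzasz

end

/-! ### The Szasz function on the open orbit and its continuous extension -/

theorem mainTheorem4 {m : ℕ} {M : Type*} [TopologicalSpace M] [T2Space M]
    [SecondCountableTopology M] [ConnectedSpace M] [ChartedSpace (ToricSzasz.Model m) M]
    [IsManifold 𝓘(ℂ, ToricSzasz.Model m) ω M] [MeasurableSpace M] [BorelSpace M]
    [MulAction (ToricSzasz.Torus m) M] (hact : ToricSzasz.IsToricAction m M)
    {L : M → Type*} [TopologicalSpace (TotalSpace ℂ L)] [∀ p, AddCommGroup (L p)]
    [∀ p, Module ℂ (L p)] [∀ p, TopologicalSpace (L p)] [FiberBundle ℂ L] [VectorBundle ℂ ℂ L]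
    [ContMDiffVectorBundle ω ℂ L 𝓘(ℂ, ToricSzasz.Model m)]
    (h : ToricSzasz.HermitianMetric L m) (hpos : h.IsPositive)
    (A : ToricSzasz.ToricLift h) (μ : M → Fin m → ℝ)
    (hμ : ToricSzasz.IsMomentMap h μ) (hproper : IsProperMap μ)
    (C : ToricSzasz.LogCoordinates h A μ)
    (N : ℕ) (hN : 1 ≤ N)
    (hfin : ∀ α : Fin m → ℤ, ToricSzasz.latticePoint N α ∈ Set.range μ → C.MonomialL2 N α)
    {ι : Type*} (s : ι → ∀ p, ⨂[ℂ]^N (L p)) (hs : h.IsOrthonormalBasis s)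
    (f : (Fin m → ℝ) → ℂ) (hf : ContDiff ℝ ∞ f) (hfc : HasCompactSupport f) :
    (∀ (t : ToricSzasz.Torus m) (p : M), Summable (h.bergmanOrbitTerm A s t p)) ∧
    (∀ p ∈ ToricSzasz.openOrbit m M, ∀ x : Fin m → ℝ, μ p = x →
      C.szasz s f x = (h.bergmanDiag s p)⁻¹ *
        ToricSzasz.functionOfD f N
          (fun θ => h.bergmanOrbit A s (ToricSzasz.expTorus θ) p) 0) ∧
    (∀ q : M, Tendsto (fun p => (h.bergmanDiag s q)⁻¹ * C.szaszSum N f (μ p))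
      (𝓝[ToricSzasz.openOrbit m M] q)
      (𝓝 ((h.bergmanDiag s q)⁻¹ *
        ToricSzasz.functionOfD f N
          (fun θ => h.bergmanOrbit A s (ToricSzasz.expTorus θ) q) 0))) := by
  choose T hT hTk using fun k : {k : Fin m → ℤ // ToricSzasz.latticePoint N k ∈ Set.range μ} =>
    C.exists_monomial_extension hact hpos hμ hN k.2
  have hT2 := fun k => C.isL2HolomorphicSection_of_monomial hact (hT k) (hTk k) (hfin k.1 k.2)
  have hD := C.functionOfD_bergmanOrbit hact hpos hμ hproper hN hT2 hTk hs f
  have hS := fun p (hp : p ∈ ToricSzasz.openOrbit m M) =>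
    C.szaszSum_moment hact hpos hμ hN hTk f hp
  refine ⟨fun t p => ?_, fun p hp x hx => ?_, fun q => ?_⟩
  · obtain ⟨B, h1, -⟩ := C.exists_hasSum_bergmanOrbit hact hpos hμ hproper hN hT2 hTk hs t p
    exact h1.summable
  -- `szasz` evaluates the diagonal kernel at a chosen point over `x`, possibly different from `p`;
  -- the two points share `ρ`, hence all weight terms.
  · have hmem : x ∈ μ '' ToricSzasz.openOrbit m M := ⟨p, hp, hx⟩
    have hp' := Function.invFunOn_mem hmem
    have hρ := C.rho_eq_of_moment_eq hact hpos hμ hp' hp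
      ((Function.invFunOn_eq hmem).trans hx.symm)
    have hB : h.bergmanDiag s (Function.invFunOn μ (ToricSzasz.openOrbit m M) x) =
        h.bergmanDiag s p := by
      rw [C.bergmanDiag_eq hact hpos hμ hproper hN hT2 hTk hs,
        C.bergmanDiag_eq hact hpos hμ hproper hN hT2 hTk hs]
      refine tsum_congr fun k => ?_
      rw [C.weightTerm_eq hTk hp', C.weightTerm_eq hTk hp, C.monomialDensity_eq_exp hN _ hp',
        C.monomialDensity_eq_exp hN _ hp, ToricSzasz.LogCoordinates.legendre,
        ToricSzasz.LogCoordinates.legendre, hρ]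
    rw [ToricSzasz.LogCoordinates.szasz, hB, hD, ← hx, hS p hp]
  -- The prefactor is frozen at `q`, so only the sums have to converge, and a vanishing kernel at
  -- `q` needs no separate treatment.
  · refine Tendsto.const_mul _ ?_
    rw [hD]
    refine ((C.tendsto_tsum_weightTerm hN hT hfc q).mono_left nhdsWithin_le_nhds).congr' ?_
    filter_upwards [self_mem_nhdsWithin] with p hp using (hS p hp).symm
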